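/- Let $d \ge 2$ be an integer, $\sigma^2 = \frac{d}{d^2-1}$, and let $\nu$ be the centered Gaussian law on $\mathbb{R}$ with variance $\sigma^2$. For $t \ge 0$ let $Q_t$ be the Ornstein-Uhlenbeck operator on $L^2(\nu)$ given by $Q_t g(a) = E\big[g(a e^{-t} + \sqrt{1-e^{-2t}}\,Y)\big]$, where $Y$ has law $\nu$. For $h \in \mathbb{R}$ let $\pi_h$ be the operator of multiplication by $1_{[h,\infty)}$ on $L^2(\nu)$, and set $L = d\,Q_{\log d}$, $L_h = \pi_h L \pi_h$ and $\lambda_h = \|L_h\|_{L^2(\nu)\to L^2(\nu)}$. Let $T$ be the $(d+1)$-regular tree with unit weights, and let $(\varphi_x)_{x\in T}$ be the Gaussian free field on $T$, that is, a centered Gaussian field with covariance $g(x,y) = \frac{1}{d+1} E_x\big[\sum_{k\ge 0} 1\{Z_k = y\}\big]$, where $(Z_k)_{k \ge 0}$ is the simple random walk on $T$ started at $x$ under $P_x$. Then there is a unique $h_* \in \mathbb{R}$ such that $\lambda_{h_*} = 1$, and - for every $h < h_*$, almost surely, the level set $\{x \in T : \varphi_x \ge h\}$ has an infinite connected component; -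 for every $h > h_*$, almost surely, all connected components of $\{x \in T : \varphi_x \ge h\}$ are finite. -/

import Mathlib

open MeasureTheory ProbabilityTheory
open scoped NNReal ENNReal

noncomputable section

namespace TreeGFF

/-! ### Random walk, Green function and Gaussian free field on a graph with unit weights -/

section Graph

variable {V : Type*} (T : SimpleGraph V) [T.LocallyFinite]

open Classical in
/-- One step of the simple random walk: jump to a uniformly chosen neighbour
(and stay put at an isolated vertex). -/
def walkStep (x : V) : PMF V :=
  if hx : (T.neighborFinset x).Nonempty then PMF.uniformOfFinset (T.neighborFinset x) hx
  else PMF.pure x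

/-- The law of the position `Z_k` at time `k` of the simple random walk started at `x`,
so that `walkLaw T x k y = P_x[Z_k = y]`. -/
def walkLaw (x : V) : ℕ → PMF V
  | 0 => PMF.pure x
  | k + 1 => (walkLaw x k).bind (walkStep T)

/-- The Green function `g(x,y) = deg(y)⁻¹ E_x[∑_{k ≥ 0} 1{Z_k = y}]`, that is,
`deg(y)⁻¹ ∑_{k ≥ 0} P_x[Z_k = y]`. The sum is taken in `[0,∞]`;
it is finite on transient graphs. -/
def green (x y : V) : ℝ :=
  ((T.degree y : ℝ≥0∞)⁻¹ * ∑' k : ℕ, walkLaw T x k y).toReal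

/-- `φ` is a Gaussian free field on `T` under `P`: a centered Gaussian field indexed by the
vertices, with covariance the Green function. -/
structure IsGaussianFreeField {Ω : Type*} [MeasurableSpace Ω] (φ : V → Ω → ℝ)
    (P : Measure Ω) : Prop where
  gaussian : IsGaussianProcess φ P
  centered : ∀ x, ∫ ω, φ x ω ∂P = 0
  covariance_eq : ∀ x y, cov[φ x, φ y; P] = green T x y

end Graph

/-- The subgraph of `T` induced by the level set `{x | f x ≥ h}`. -/
def levelGraph {V : Type*} (T : SimpleGraph V) (f : V → ℝ) (h : ℝ) :
    SimpleGraph {x : V | h ≤ f x} :=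
  T.induce {x : V | h ≤ f x}

/-! ### The Ornstein-Uhlenbeck operators on `L²` of a centered Gaussian law -/

/-- The map `(a, y) ↦ a e^{-t} + √(1 - e^{-2t}) y`. -/
def ouMap (t : ℝ) (p : ℝ × ℝ) : ℝ :=
  p.1 * Real.exp (-t) + Real.sqrt (1 - Real.exp (-2 * t)) * p.2

/-- `Q_t g (a) = E[g(a e^{-t} + √(1 - e^{-2t}) Y)]`, where `Y` is a centered Gaussian variable
with variance `v`. -/
def ouFun (v : ℝ≥0) (t : ℝ) (g : ℝ → ℝ) (a : ℝ) : ℝ :=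
  ∫ y, g (a * Real.exp (-t) + Real.sqrt (1 - Real.exp (-2 * t)) * y) ∂(gaussianReal 0 v)

theorem measurePreserving_ouMap (v : ℝ≥0) {t : ℝ} (ht : 0 ≤ t) :
    MeasurePreserving (ouMap t) ((gaussianReal 0 v).prod (gaussianReal 0 v))
      (gaussianReal 0 v) := by
  refine ⟨by unfold ouMap; fun_prop, ?_⟩
  have h1 : ouMap t = (fun q : ℝ × ℝ => q.1 + q.2) ∘
      Prod.map (fun a => a * Real.exp (-t))
        (fun y => Real.sqrt (1 - Real.exp (-2 * t)) * y) := by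
    ext p; rfl
  rw [h1, ← Measure.map_map (by fun_prop) (by fun_prop),
    ← Measure.map_prod_map _ _ (by fun_prop) (by fun_prop),
    gaussianReal_map_mul_const, gaussianReal_map_const_mul]
  change Measure.conv _ _ = _
  rw [gaussianReal_conv_gaussianReal]
  have h2 : Real.exp (-2 * t) ≤ 1 := by
    rw [Real.exp_le_one_iff]; linarith
  congr 1
  · simp
  · ext
    push_cast
    rw [Real.sq_sqrt (by linarith)]
    have : Real.exp (-t) ^ 2 = Real.exp (-2 * t) := by
      rw [← Real.exp_nat_mul]; congr 1; push_cast; ring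
    rw [this]; ring

theorem memLp_comp_ouMap {v : ℝ≥0} {t : ℝ} (ht : 0 ≤ t) {g : ℝ → ℝ}
    (hg : MemLp g 2 (gaussianReal 0 v)) :
    MemLp (g ∘ ouMap t) 2 ((gaussianReal 0 v).prod (gaussianReal 0 v)) :=
  hg.comp_measurePreserving (measurePreserving_ouMap v ht)

theorem aestronglyMeasurable_ouFun {v : ℝ≥0} {t : ℝ} (ht : 0 ≤ t) {g : ℝ → ℝ}
    (hg : MemLp g 2 (gaussianReal 0 v)) :
    AEStronglyMeasurable (ouFun v t g) (gaussianReal 0 v) :=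
  (memLp_comp_ouMap ht hg).1.integral_prod_right'

theorem eLpNorm_ouFun_le {v : ℝ≥0} {t : ℝ} (ht : 0 ≤ t) {g : ℝ → ℝ}
    (hg : MemLp g 2 (gaussianReal 0 v)) :
    eLpNorm (ouFun v t g) 2 (gaussianReal 0 v) ≤ eLpNorm g 2 (gaussianReal 0 v) := by
  set ν := gaussianReal 0 v
  have hG := memLp_comp_ouMap ht hg
  rw [← eLpNorm_comp_measurePreserving hg.1 (measurePreserving_ouMap v ht)]
  have key : ∀ (μ' : Measure ℝ) (f : ℝ → ℝ),
      eLpNorm f 2 μ' ^ (2 : ℝ) = ∫⁻ a, ‖f a‖ₑ ^ (2 : ℝ) ∂μ' := fun μ' f => by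
    have := eLpNorm_nnreal_pow_eq_lintegral (f := f) (μ := μ') (p := 2) (by norm_num)
    simpa using this
  have key2 : eLpNorm (g ∘ ouMap t) 2 (ν.prod ν) ^ (2 : ℝ)
      = ∫⁻ p, ‖(g ∘ ouMap t) p‖ₑ ^ (2 : ℝ) ∂(ν.prod ν) := by
    have := eLpNorm_nnreal_pow_eq_lintegral (f := g ∘ ouMap t) (μ := ν.prod ν) (p := 2)
      (by norm_num)
    simpa using this
  rw [← ENNReal.rpow_le_rpow_iff (z := 2) (by norm_num), key, key2,
    lintegral_prod _ (hG.1.enorm.pow_const _)]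
  refine lintegral_mono_ae ?_
  filter_upwards [hG.1.prodMk_left] with a ha
  have h1 : ‖ouFun v t g a‖ₑ ≤ eLpNorm (fun y => (g ∘ ouMap t) (a, y)) 1 ν := by
    rw [eLpNorm_one_eq_lintegral_enorm]
    exact enorm_integral_le_lintegral_enorm _
  have h2 := h1.trans (eLpNorm_le_eLpNorm_of_exponent_le (p := 1) (q := 2) (by norm_num) ha)
  calc ‖ouFun v t g a‖ₑ ^ (2 : ℝ)
      ≤ eLpNorm (fun y => (g ∘ ouMap t) (a, y)) 2 ν ^ (2 : ℝ) := by gcongr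
    _ = _ := key _ _

theorem memLp_ouFun {v : ℝ≥0} {t : ℝ} (ht : 0 ≤ t) {g : ℝ → ℝ}
    (hg : MemLp g 2 (gaussianReal 0 v)) : MemLp (ouFun v t g) 2 (gaussianReal 0 v) :=
  ⟨aestronglyMeasurable_ouFun ht hg, (eLpNorm_ouFun_le ht hg).trans_lt hg.2⟩

theorem ouFun_congr {v : ℝ≥0} {t : ℝ} (ht : 0 ≤ t) {f g : ℝ → ℝ}
    (hfg : f =ᵐ[gaussianReal 0 v] g) :
    ouFun v t f =ᵐ[gaussianReal 0 v] ouFun v t g := by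
  have h := (measurePreserving_ouMap v ht).quasiMeasurePreserving.ae_eq_comp hfg
  filter_upwards [Measure.ae_ae_of_ae_prod h] with a ha
  exact integral_congr_ae ha

theorem ouFun_add {v : ℝ≥0} {t : ℝ} (ht : 0 ≤ t) {f g : ℝ → ℝ}
    (hf : MemLp f 2 (gaussianReal 0 v)) (hg : MemLp g 2 (gaussianReal 0 v)) :
    ouFun v t (f + g) =ᵐ[gaussianReal 0 v] ouFun v t f + ouFun v t g := by
  have hF := ((memLp_comp_ouMap ht hf).integrable (by norm_num)).prod_right_ae
  have hG := ((memLp_comp_ouMap ht hg).integrable (by norm_num)).prod_right_ae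
  filter_upwards [hF, hG] with a ha hb
  exact integral_add ha hb

theorem ouFun_smul (v : ℝ≥0) (t c : ℝ) (g : ℝ → ℝ) :
    ouFun v t (c • g) = c • ouFun v t g := by
  ext a
  exact integral_const_mul c _

/-- The Ornstein-Uhlenbeck operator `Q_t`, `t ≥ 0`, as a bounded operator on `L²(ν)`,
with `ν` the centered Gaussian law of variance `v`. -/
def ouOp (v : ℝ≥0) (t : ℝ) (ht : 0 ≤ t) :
    Lp ℝ 2 (gaussianReal 0 v) →L[ℝ] Lp ℝ 2 (gaussianReal 0 v) :=
  LinearMap.mkContinuous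
    { toFun := fun g => (memLp_ouFun ht (Lp.memLp g)).toLp (ouFun v t g)
      map_add' := fun f g => by
        rw [← MemLp.toLp_add]
        exact MemLp.toLp_eq_toLp_iff _ _ |>.2 <|
          (ouFun_congr ht (Lp.coeFn_add f g)).trans (ouFun_add ht (Lp.memLp f) (Lp.memLp g))
      map_smul' := fun c g => by
        rw [RingHom.id_apply, ← MemLp.toLp_const_smul]
        refine MemLp.toLp_eq_toLp_iff _ _ |>.2 ?_
        rw [← ouFun_smul]
        exact ouFun_congr ht (Lp.coeFn_smul c g) }
    1 (fun g => by
      rw [one_mul]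
      change ‖(memLp_ouFun ht (Lp.memLp g)).toLp (ouFun v t g)‖ ≤ ‖g‖
      rw [Lp.norm_toLp, Lp.norm_def]
      exact ENNReal.toReal_mono (Lp.memLp g).2.ne (eLpNorm_ouFun_le ht (Lp.memLp g)))

theorem ouOp_coeFn (v : ℝ≥0) (t : ℝ) (ht : 0 ≤ t) (g : Lp ℝ 2 (gaussianReal 0 v)) :
    ouOp v t ht g =ᵐ[gaussianReal 0 v] ouFun v t g :=
  MemLp.coeFn_toLp (memLp_ouFun ht (Lp.memLp g))

theorem memLp_cut {μ : Measure ℝ} (h : ℝ) {g : ℝ → ℝ} (hg : MemLp g 2 μ) :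
    MemLp ((Set.Ici h).indicator g) 2 μ :=
  hg.indicator measurableSet_Ici

/-- `π_h`: multiplication by the indicator function of `[h, ∞)`, as a bounded operator
on `L²(μ)`. -/
def cutOp (μ : Measure ℝ) (h : ℝ) : Lp ℝ 2 μ →L[ℝ] Lp ℝ 2 μ :=
  LinearMap.mkContinuous
    { toFun := fun g => (memLp_cut h (Lp.memLp g)).toLp ((Set.Ici h).indicator g)
      map_add' := fun f g => by
        rw [← MemLp.toLp_add]
        refine MemLp.toLp_eq_toLp_iff _ _ |>.2 ?_
        rw [← Set.indicator_add']
        filter_upwards [Lp.coeFn_add f g] with a ha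
        simp only [Set.indicator_apply, ha]
      map_smul' := fun c g => by
        rw [RingHom.id_apply, ← MemLp.toLp_const_smul]
        refine MemLp.toLp_eq_toLp_iff _ _ |>.2 ?_
        filter_upwards [Lp.coeFn_smul c g] with a ha
        simp only [Set.indicator, ha, Pi.smul_apply]
        split_ifs <;> simp }
    1 (fun g => by
      rw [one_mul]
      change ‖(memLp_cut h (Lp.memLp g)).toLp ((Set.Ici h).indicator g)‖ ≤ ‖g‖
      rw [Lp.norm_toLp, Lp.norm_def]
      exact ENNReal.toReal_mono (Lp.memLp g).2.ne (eLpNorm_indicator_le _))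

theorem cutOp_coeFn (μ : Measure ℝ) (h : ℝ) (g : Lp ℝ 2 μ) :
    cutOp μ h g =ᵐ[μ] (Set.Ici h).indicator g :=
  MemLp.coeFn_toLp (memLp_cut h (Lp.memLp g))

/-! ### The spectral quantity `λ_h` of the `(d+1)`-regular tree -/

/-- `σ² = d / (d² - 1)`. -/
def sigmaSq (d : ℕ) : ℝ≥0 := Real.toNNReal ((d : ℝ) / ((d : ℝ) ^ 2 - 1))

/-- `L = d Q_{log d}` on `L²(ν)`, with `ν` the centered Gaussian law of variance `σ²`. -/
def opL (d : ℕ) :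
    Lp ℝ 2 (gaussianReal 0 (sigmaSq d)) →L[ℝ] Lp ℝ 2 (gaussianReal 0 (sigmaSq d)) :=
  (d : ℝ) • ouOp (sigmaSq d) (Real.log d) (Real.log_natCast_nonneg d)

/-- `L_h = π_h L π_h`. -/
def opLh (d : ℕ) (h : ℝ) :
    Lp ℝ 2 (gaussianReal 0 (sigmaSq d)) →L[ℝ] Lp ℝ 2 (gaussianReal 0 (sigmaSq d)) :=
  cutOp _ h ∘L opL d ∘L cutOp _ h

/-- `λ_h`: the operator norm of `L_h` on `L²(ν)`. -/
def lam (d : ℕ) (h : ℝ) : ℝ := ‖opLh d h‖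

end TreeGFF

end

noncomputable section

namespace TreeGFF

/-! ### The Mehler kernel -/

/-! On the tree the Green function is `σ² d^{-dist(x,y)}` (`green_eq`). Hence, once the tree is
rooted, the value at a vertex is `1/d` times the value at its parent plus an innovation of law `N(0,
1/d)`, and all innovations are independent (`iIndepFun_innov`). The transition operator of this
branching Markov chain is `Q = Q_{log d}`, its stationary law is `ν`, and its density with respect
to `ν` is symmetric and strictly positive.

By positivity, `λ_h` is the least `C ≥ 0` with `2 d ∫ f Qg dν ≤ C (∫ f² dν + ∫ g² dν)` for all
measurable `f, g ≥ 0` vanishing below `h` (`lintegral_mul_pou_le`, `lam_le_of_form_le`). All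
spectral facts are read off this inequality. Continuity comes from the smallness of the form on thin
strips, `λ_0 > 1` from the test function `1_{[0,∞)}`, and strict decrease on `[0,∞)` from
translating test functions (`lam_shift_le`). These facts give the unique root, which is positive,
and the strict inequalities on either side of it.

If `λ_h < 1`, a union bound over children makes the probability of surviving `n` generations a
subsolution of `s_{n+1} ≤ L_h s_n`, so it tends to zero in `L²(ν)`. An infinite cluster would
survive forever in the tree rooted at any of its vertices, and there are countably many roots.

If `λ_h > 1`, some compression of `L` to a compact interval still has norm above `1`. Its iterates
produce a bounded `ψ ≥ 0` with `Lψ ≥ μψ`, `μ > 1` (`exists_subeigenfunction`), and a small multiple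
of `ψ` bounds all survival probabilities from below. To reach probability one, let `W` be the limit,
as the depth grows, of the probability that no vertex at that depth survives forever. Then `W ≤
(QW)^d`, while `QW` and `W` have the same `ν`-integral, which forces `W = 0` almost everywhere
(`exists_lintegral_noSurvBelow_le`). -/

/-- The variance `1 / d` of the innovations of the field along the edges of the tree. -/
def innovVar (d : ℕ) : ℝ≥0 := (d : ℝ≥0)⁻¹

/-- The density of the transition kernel of the Ornstein-Uhlenbeck operator `Q_{log d}` with
respect to its reversible law. -/
def mehler (d : ℕ) (a b : ℝ) : ℝ :=
  (√(1 - ((d : ℝ) ^ 2)⁻¹))⁻¹ * Real.exp (a * b - (a ^ 2 + b ^ 2) / (2 * d))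

/-- The Mehler kernel with values in `[0, ∞]`. -/
def kern (d : ℕ) (a b : ℝ) : ℝ≥0∞ := ENNReal.ofReal (mehler d a b)

/-- The stationary law of the field. -/
abbrev statLaw (d : ℕ) : Measure ℝ := gaussianReal 0 (sigmaSq d)

/-- The Ornstein-Uhlenbeck operator on nonnegative functions. -/
def pou (d : ℕ) (f : ℝ → ℝ≥0∞) (a : ℝ) : ℝ≥0∞ := ∫⁻ b, kern d a b * f b ∂(statLaw d)

section Kernel

variable {d : ℕ}

theorem sigmaSq_coe (hd : 2 ≤ d) : (sigmaSq d : ℝ) = d / ((d : ℝ) ^ 2 - 1) := by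
  have : (2 : ℝ) ≤ d := by exact_mod_cast hd
  exact Real.coe_toNNReal _ (div_nonneg (by linarith) (by nlinarith))

theorem sigmaSq_pos (hd : 2 ≤ d) : 0 < (sigmaSq d : ℝ) := by
  have : (2 : ℝ) ≤ d := by exact_mod_cast hd
  rw [sigmaSq_coe hd]
  exact div_pos (by linarith) (by nlinarith)

theorem sigmaSq_ne_zero (hd : 2 ≤ d) : sigmaSq d ≠ 0 := by
  have := sigmaSq_pos hd
  exact fun h => by simp [h] at this

theorem innovVar_ne_zero (hd : 2 ≤ d) : innovVar d ≠ 0 := by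
  have : (d : ℝ≥0) ≠ 0 := by exact_mod_cast (by omega : d ≠ 0)
  exact inv_ne_zero this

theorem one_sub_inv_sq_pos (hd : 2 ≤ d) : 0 < 1 - ((d : ℝ) ^ 2)⁻¹ := by
  have : (2 : ℝ) ≤ d := by exact_mod_cast hd
  have : ((d : ℝ) ^ 2)⁻¹ < 1 := inv_lt_one_of_one_lt₀ (by nlinarith)
  linarith

theorem mehler_pos (hd : 2 ≤ d) (a b : ℝ) : 0 < mehler d a b :=
  mul_pos (inv_pos.2 (Real.sqrt_pos.2 (one_sub_inv_sq_pos hd))) (Real.exp_pos _)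

theorem mehler_comm (a b : ℝ) : mehler d a b = mehler d b a := by
  unfold mehler; ring_nf

theorem kern_comm (a b : ℝ) : kern d a b = kern d b a := by
  rw [kern, mehler_comm, kern]

theorem continuous_mehler : Continuous (fun p : ℝ × ℝ => mehler d p.1 p.2) := by
  unfold mehler; fun_prop

@[fun_prop]
theorem measurable_kern : Measurable (fun p : ℝ × ℝ => kern d p.1 p.2) :=
  continuous_mehler.measurable.ennreal_ofReal

@[fun_prop]
theorem measurable_kern_right (a : ℝ) : Measurable (kern d a) :=
  measurable_kern.comp (by fun_prop : Measurable fun b : ℝ => (a, b))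

theorem kern_ne_top (a b : ℝ) : kern d a b ≠ ∞ := ENNReal.ofReal_ne_top

/-- Completing the square, using `1/d = (1 - d⁻²) σ²`. It identifies one step of the field along an
edge, whose law is `N(a/d, 1/d)`, with a kernel that is symmetric relative to `ν`. -/
theorem gaussianPDFReal_innov (hd : 2 ≤ d) (a b : ℝ) :
    gaussianPDFReal (a / d) (innovVar d) b = mehler d a b * gaussianPDFReal 0 (sigmaSq d) b := by
  have hd' : (2 : ℝ) ≤ d := by exact_mod_cast hd
  have h1 : (d : ℝ) ^ 2 - 1 ≠ 0 := by nlinarith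
  have h0 := one_sub_inv_sq_pos hd
  have e1 : ((innovVar d : ℝ≥0) : ℝ) = (1 - ((d : ℝ) ^ 2)⁻¹) * sigmaSq d := by
    rw [sigmaSq_coe hd]
    simp only [innovVar, NNReal.coe_inv, NNReal.coe_natCast]
    field_simp
  unfold gaussianPDFReal mehler
  have e2 : √(2 * Real.pi * (innovVar d : ℝ)) =
      √(1 - ((d : ℝ) ^ 2)⁻¹) * √(2 * Real.pi * (sigmaSq d : ℝ)) := by
    rw [← Real.sqrt_mul h0.le, e1]; ring_nf
  rw [e2, mul_inv]
  have e3 : Real.exp (-(b - a / d) ^ 2 / (2 * (innovVar d : ℝ))) =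
      Real.exp (a * b - (a ^ 2 + b ^ 2) / (2 * d)) *
        Real.exp (-(b - 0) ^ 2 / (2 * (sigmaSq d : ℝ))) := by
    rw [← Real.exp_add, sigmaSq_coe hd]
    congr 1
    simp only [innovVar, NNReal.coe_inv, NNReal.coe_natCast]
    field_simp
    ring
  rw [e3]
  ring

theorem gaussianPDF_innov (hd : 2 ≤ d) (a b : ℝ) :
    gaussianPDF (a / d) (innovVar d) b = kern d a b * gaussianPDF 0 (sigmaSq d) b := by
  rw [gaussianPDF, gaussianPDFReal_innov hd, ENNReal.ofReal_mul (mehler_pos hd a b).le]; rfl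

theorem map_add_innov (a : ℝ) :
    (gaussianReal 0 (innovVar d)).map (fun u => a / d + u) =
      gaussianReal (a / d) (innovVar d) := by
  rw [gaussianReal_map_const_add, zero_add]

theorem gaussianReal_innov_eq (hd : 2 ≤ d) (a : ℝ) :
    gaussianReal (a / d) (innovVar d) = (statLaw d).withDensity (kern d a) := by
  rw [gaussianReal_of_var_ne_zero _ (innovVar_ne_zero hd), statLaw,
    gaussianReal_of_var_ne_zero _ (sigmaSq_ne_zero hd),
    ← withDensity_mul _ (measurable_gaussianPDF _ _) (by fun_prop)]
  congr 1
  ext b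
  rw [gaussianPDF_innov hd, Pi.mul_apply, mul_comm]

theorem pou_eq_lintegral_innov (hd : 2 ≤ d) {f : ℝ → ℝ≥0∞} (hf : Measurable f) (a : ℝ) :
    pou d f a = ∫⁻ u, f (a / d + u) ∂(gaussianReal 0 (innovVar d)) := by
  rw [← lintegral_map (f := f) (g := fun u => a / d + u) hf (by fun_prop), map_add_innov,
    gaussianReal_innov_eq hd, lintegral_withDensity_eq_lintegral_mul _ (by fun_prop) hf]
  rfl

theorem ouFun_eq (hd : 2 ≤ d) (g : ℝ → ℝ) (a : ℝ) :
    ouFun (sigmaSq d) (Real.log d) g a = ∫ u, g (a / d + u) ∂(gaussianReal 0 (innovVar d)) := by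
  have hd' : (2 : ℝ) ≤ d := by exact_mod_cast hd
  have h0 := one_sub_inv_sq_pos hd
  have hexp : Real.exp (-2 * Real.log d) = ((d : ℝ) ^ 2)⁻¹ := by
    rw [show -2 * Real.log d = -(Real.log d + Real.log d) by ring, Real.exp_neg, Real.exp_add,
      Real.exp_log (by linarith), sq]
  have hvar : gaussianReal 0 (innovVar d) =
      (gaussianReal 0 (sigmaSq d)).map (fun y => √(1 - ((d : ℝ) ^ 2)⁻¹) * y) := by
    rw [gaussianReal_map_const_mul, mul_zero]
    congr 1
    ext
    simp only [innovVar, NNReal.coe_inv, NNReal.coe_natCast, NNReal.coe_mul, NNReal.coe_mk]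
    rw [Real.sq_sqrt h0.le, sigmaSq_coe hd]
    have : (d : ℝ) ^ 2 - 1 ≠ 0 := by nlinarith
    field_simp
  -- The scaling is a measurable embedding, so no measurability of `g` is needed.
  rw [hvar, MeasurableEmbedding.integral_map]
  · unfold ouFun
    rw [hexp, Real.exp_neg, Real.exp_log (by linarith)]
    rfl
  · exact (Homeomorph.mulLeft₀ _ (Real.sqrt_pos.2 h0).ne').measurableEmbedding

theorem ofReal_ouFun (hd : 2 ≤ d) {g : ℝ → ℝ} (hg : Measurable g) (h0 : ∀ x, 0 ≤ g x)
    {M : ℝ} (hM : ∀ x, g x ≤ M) (a : ℝ) :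
    ENNReal.ofReal (ouFun (sigmaSq d) (Real.log d) g a) =
      pou d (fun x => ENNReal.ofReal (g x)) a := by
  rw [ouFun_eq hd, pou_eq_lintegral_innov hd (by fun_prop), ofReal_integral_eq_lintegral_ofReal]
  · refine Integrable.of_bound (hg.comp (by fun_prop)).aestronglyMeasurable M
      (ae_of_all _ fun u => ?_)
    rw [Real.norm_of_nonneg (h0 _)]
    exact hM _
  · exact ae_of_all _ fun u => h0 _

theorem lintegral_kern (hd : 2 ≤ d) (a : ℝ) : ∫⁻ b, kern d a b ∂(statLaw d) = 1 := by
  have := pou_eq_lintegral_innov hd (f := fun _ => 1) measurable_const a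
  simpa [pou] using this

@[fun_prop]
theorem measurable_pou {f : ℝ → ℝ≥0∞} (hf : Measurable f) : Measurable (pou d f) := by
  unfold pou
  exact Measurable.lintegral_prod_right' (f := fun p : ℝ × ℝ => kern d p.1 p.2 * f p.2)
    (by fun_prop)

/-- Tonelli and the symmetry of the kernel: this is the reversibility of `ν`. Taking one function
equal to `1` gives stationarity. -/
theorem lintegral_mul_pou_comm {f g : ℝ → ℝ≥0∞} (hf : Measurable f) (hg : Measurable g) :
    ∫⁻ a, f a * pou d g a ∂(statLaw d) = ∫⁻ a, g a * pou d f a ∂(statLaw d) := by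
  have h1 : ∀ f g : ℝ → ℝ≥0∞, Measurable f → Measurable g → ∀ a, f a * pou d g a =
      ∫⁻ b, f a * (kern d a b * g b) ∂(statLaw d) := fun f g hf hg a =>
    (lintegral_const_mul _ (by fun_prop)).symm
  simp_rw [h1 f g hf hg, h1 g f hg hf]
  rw [lintegral_lintegral_swap]
  · refine lintegral_congr fun a => lintegral_congr fun b => ?_
    rw [kern_comm]; ring
  · exact (by fun_prop : Measurable fun p : ℝ × ℝ => f p.1 * (kern d p.1 p.2 * g p.2)).aemeasurable

theorem lintegral_pou (hd : 2 ≤ d) {f : ℝ → ℝ≥0∞} (hf : Measurable f) :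
    ∫⁻ a, pou d f a ∂(statLaw d) = ∫⁻ a, f a ∂(statLaw d) := by
  have := lintegral_mul_pou_comm (d := d) (f := fun _ => 1) measurable_const hf
  simp only [one_mul] at this
  rw [this]
  refine lintegral_congr fun a => ?_
  simp [pou, lintegral_kern hd]

theorem kern_mul_pdf_le (hd : 2 ≤ d) (a b : ℝ) :
    kern d a b * gaussianPDF 0 (sigmaSq d) b ≤ ENNReal.ofReal (√(2 * Real.pi * innovVar d))⁻¹ := by
  rw [← gaussianPDF_innov hd, gaussianPDF]
  refine ENNReal.ofReal_le_ofReal ?_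
  rw [gaussianPDFReal]
  refine mul_le_of_le_one_right (by positivity) (Real.exp_le_one_iff.2 ?_)
  rw [neg_div]
  have : 0 ≤ (b - a / d) ^ 2 / (2 * (innovVar d : ℝ)) := by positivity
  linarith

/-- The Ornstein-Uhlenbeck transition kernel charges an interval by at most a constant times
its length. -/
theorem lintegral_kern_indicator_le (hd : 2 ≤ d) (a : ℝ) {s : Set ℝ} (hs : MeasurableSet s) :
    ∫⁻ b in s, kern d a b ∂(statLaw d) ≤
      ENNReal.ofReal (√(2 * Real.pi * innovVar d))⁻¹ * volume s := by
  rw [statLaw, gaussianReal_of_var_ne_zero _ (sigmaSq_ne_zero hd), restrict_withDensity hs,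
    lintegral_withDensity_eq_lintegral_mul _ (measurable_gaussianPDF _ _) (by fun_prop),
    ← setLIntegral_const]
  refine lintegral_mono fun b => ?_
  rw [Pi.mul_apply, mul_comm]
  exact kern_mul_pdf_le hd a b

end Kernel

/-! ### The norm of `L_h` through nonnegative functions -/

section Form

variable {d : ℕ}

theorem ofReal_norm_sq_Lp {μ : Measure ℝ} (u : Lp ℝ 2 μ) :
    ENNReal.ofReal (‖u‖ ^ 2) = ∫⁻ a, ‖u a‖ₑ ^ 2 ∂μ := by
  have := eLpNorm_nnreal_pow_eq_lintegral (f := u) (μ := μ) (p := 2) (by norm_num)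
  have h2 : eLpNorm u 2 μ ^ (2 : ℝ) = ∫⁻ a, ‖u a‖ₑ ^ (2 : ℝ) ∂μ := by simpa using this
  simp only [ENNReal.rpow_ofNat] at h2
  rw [← h2, Lp.norm_def, ENNReal.ofReal_pow ENNReal.toReal_nonneg,
    ENNReal.ofReal_toReal (Lp.memLp u).2.ne]

theorem opLh_coeFn (d : ℕ) (h : ℝ) (g : Lp ℝ 2 (statLaw d)) :
    opLh d h g =ᵐ[statLaw d] (Set.Ici h).indicator
      ((d : ℝ) • ouFun (sigmaSq d) (Real.log d) ((Set.Ici h).indicator g)) := by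
  have h1 := cutOp_coeFn (statLaw d) h (opL d (cutOp (statLaw d) h g))
  have h2 := Lp.coeFn_smul (d : ℝ)
    (ouOp (sigmaSq d) (Real.log d) (Real.log_natCast_nonneg d) (cutOp (statLaw d) h g))
  have h3 := ouOp_coeFn (sigmaSq d) (Real.log d) (Real.log_natCast_nonneg d)
    (cutOp (statLaw d) h g)
  have h4 := ouFun_congr (Real.log_natCast_nonneg d) (cutOp_coeFn (statLaw d) h g)
  filter_upwards [h1, h2, h3, h4] with a h1 h2 h3 h4
  change (cutOp (statLaw d) h (opL d (cutOp (statLaw d) h g))) a = _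
  rw [h1]
  simp only [Set.indicator_apply]
  split_ifs with ha
  · change (((d : ℝ) • ouOp (sigmaSq d) (Real.log d) (Real.log_natCast_nonneg d)
      (cutOp (statLaw d) h g) : Lp ℝ 2 (statLaw d)) : ℝ → ℝ) a = _
    rw [h2, Pi.smul_apply, Pi.smul_apply, h3, h4]
  · rfl

/-- Cauchy–Schwarz and the operator norm bound `⟨f, L_h g⟩` by `λ_h ‖f‖ ‖g‖`, and `2‖f‖‖g‖ ≤ ‖f‖² +
‖g‖²`. The additive form avoids square roots in `[0,∞]`; boundedness places `f` and `g` in `L²(ν)`,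
and is removed afterwards by truncation. -/
theorem lintegral_mul_pou_le_of_bounded (hd : 2 ≤ d) (h : ℝ) {f g : ℝ → ℝ≥0∞}
    (hf : Measurable f) (hg : Measurable g) (hg0 : ∀ x < h, g x = 0) (hf0 : ∀ x < h, f x = 0)
    (n : ℕ) (hfn : ∀ x, f x ≤ n) (hgn : ∀ x, g x ≤ n) :
    2 * (d * ∫⁻ a, f a * pou d g a ∂(statLaw d)) ≤ ENNReal.ofReal (lam d h) *
      (∫⁻ a, f a ^ 2 ∂(statLaw d) + ∫⁻ a, g a ^ 2 ∂(statLaw d)) := by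
  set F : ℝ → ℝ := fun x => (f x).toReal with hF
  set G : ℝ → ℝ := fun x => (g x).toReal with hG
  have fT : ∀ x, f x ≠ ∞ := fun x => ne_top_of_le_ne_top (by simp) (hfn x)
  have gT : ∀ x, g x ≠ ∞ := fun x => ne_top_of_le_ne_top (by simp) (hgn x)
  have mF : Measurable F := hf.ennreal_toReal
  have mG : Measurable G := hg.ennreal_toReal
  have bF : ∀ x, F x ≤ n := fun x => by
    simpa using ENNReal.toReal_mono (by simp) (hfn x)
  have bG : ∀ x, G x ≤ n := fun x => by
    simpa using ENNReal.toReal_mono (by simp) (hgn x)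
  have pF : ∀ x, 0 ≤ F x := fun x => ENNReal.toReal_nonneg
  have pG : ∀ x, 0 ≤ G x := fun x => ENNReal.toReal_nonneg
  have LF : MemLp F 2 (statLaw d) := MemLp.of_bound mF.aestronglyMeasurable n
    (ae_of_all _ fun x => by rw [Real.norm_of_nonneg (pF x)]; exact bF x)
  have LG : MemLp G 2 (statLaw d) := MemLp.of_bound mG.aestronglyMeasurable n
    (ae_of_all _ fun x => by rw [Real.norm_of_nonneg (pG x)]; exact bG x)
  have nF : ENNReal.ofReal (‖LF.toLp F‖ ^ 2) = ∫⁻ a, f a ^ 2 ∂(statLaw d) := by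
    rw [ofReal_norm_sq_Lp]
    refine lintegral_congr_ae ?_
    filter_upwards [LF.coeFn_toLp] with a ha
    rw [ha, Real.enorm_of_nonneg (pF a), ENNReal.ofReal_toReal (fT a)]
  have nG : ENNReal.ofReal (‖LG.toLp G‖ ^ 2) = ∫⁻ a, g a ^ 2 ∂(statLaw d) := by
    rw [ofReal_norm_sq_Lp]
    refine lintegral_congr_ae ?_
    filter_upwards [LG.coeFn_toLp] with a ha
    rw [ha, Real.enorm_of_nonneg (pG a), ENNReal.ofReal_toReal (gT a)]
  have key : inner ℝ (LF.toLp F) (opLh d h (LG.toLp G)) =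
      ∫ a, F a * (d * ouFun (sigmaSq d) (Real.log d) G a) ∂(statLaw d) := by
    rw [L2.inner_def]
    refine integral_congr_ae ?_
    have hcut : (Set.Ici h).indicator (LG.toLp G) =ᵐ[statLaw d] G := by
      filter_upwards [LG.coeFn_toLp] with a ha
      simp only [Set.indicator_apply, ha, Set.mem_Ici]
      split_ifs with hh
      · rfl
      · simp [hG, hg0 a (not_le.1 hh)]
    filter_upwards [LF.coeFn_toLp, opLh_coeFn d h (LG.toLp G),
      ouFun_congr (Real.log_natCast_nonneg d) hcut] with a h1 h2 h3
    rw [h1, h2]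
    simp only [Set.indicator_apply, Set.mem_Ici, Pi.smul_apply, h3, smul_eq_mul]
    by_cases hh : h ≤ a
    · rw [if_pos hh]; simp only [RCLike.inner_apply, conj_trivial]; ring
    · simp [hF, hf0 a (not_le.1 hh)]
  have pO : ∀ a, 0 ≤ ouFun (sigmaSq d) (Real.log d) G a := fun a =>
    integral_nonneg fun y => pG _
  have bO : ∀ a, ouFun (sigmaSq d) (Real.log d) G a ≤ n := fun a => by
    rw [ouFun_eq hd]
    have : Integrable (fun u => G (a / d + u)) (gaussianReal 0 (innovVar d)) :=
      Integrable.of_bound (mG.comp (by fun_prop)).aestronglyMeasurable n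
        (ae_of_all _ fun x => by rw [Real.norm_of_nonneg (pG _)]; exact bG _)
    calc _ ≤ ∫ u, (n : ℝ) ∂(gaussianReal 0 (innovVar d)) :=
          integral_mono this (integrable_const _) fun u => bG _
      _ = n := by simp
  have mO : AEStronglyMeasurable (ouFun (sigmaSq d) (Real.log d) G) (statLaw d) :=
    aestronglyMeasurable_ouFun (Real.log_natCast_nonneg d) LG
  have key2 : ENNReal.ofReal (∫ a, F a * (d * ouFun (sigmaSq d) (Real.log d) G a) ∂(statLaw d)) =
      d * ∫⁻ a, f a * pou d g a ∂(statLaw d) := by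
    rw [ofReal_integral_eq_lintegral_ofReal, ← lintegral_const_mul _ (by fun_prop)]
    · refine lintegral_congr fun a => ?_
      rw [ENNReal.ofReal_mul (pF a), ENNReal.ofReal_mul (by positivity),
        ofReal_ouFun hd mG pG bG, ENNReal.ofReal_toReal (fT a)]
      have : pou d (fun x => ENNReal.ofReal (G x)) a = pou d g a := by
        congr 1; ext x; exact ENNReal.ofReal_toReal (gT x)
      rw [this, ENNReal.ofReal_natCast]
      ring
    · refine Integrable.of_bound (mF.aestronglyMeasurable.mul (mO.const_mul (d : ℝ))) (n * (d * n))
        (ae_of_all _ fun a => ?_)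
      have := pF a
      have := pO a
      rw [Real.norm_of_nonneg (by positivity)]
      gcongr
      · exact bF a
      · exact bO a
    · exact ae_of_all _ fun a => mul_nonneg (pF a) (mul_nonneg (by positivity) (pO a))
  have bound : 2 * inner ℝ (LF.toLp F) (opLh d h (LG.toLp G)) ≤
      lam d h * (‖LF.toLp F‖ ^ 2 + ‖LG.toLp G‖ ^ 2) := by
    have h1 := real_inner_le_norm (LF.toLp F) (opLh d h (LG.toLp G))
    have h2 := (opLh d h).le_opNorm (LG.toLp G)
    have h3 : 0 ≤ lam d h := norm_nonneg _
    change _ ≤ lam d h * _ at h2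
    have h4 := mul_le_mul_of_nonneg_left h2 (norm_nonneg (LF.toLp F))
    nlinarith [sq_nonneg (‖LF.toLp F‖ - ‖LG.toLp G‖),
      mul_nonneg h3 (sq_nonneg (‖LF.toLp F‖ - ‖LG.toLp G‖))]
  have hl : 0 ≤ lam d h := norm_nonneg (opLh d h)
  rw [← key2, ← key, ← nF, ← nG, ← ENNReal.ofReal_add (by positivity) (by positivity),
    ← ENNReal.ofReal_mul hl]
  calc _ = ENNReal.ofReal (2 * inner ℝ (LF.toLp F) (opLh d h (LG.toLp G))) := by
        rw [ENNReal.ofReal_mul (by norm_num)]; simp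
    _ ≤ _ := ENNReal.ofReal_le_ofReal bound

theorem pou_iSup (d : ℕ) {g : ℕ → ℝ → ℝ≥0∞} (hg : ∀ n, Measurable (g n)) (hm : Monotone g)
    (a : ℝ) : pou d (fun x => ⨆ n, g n x) a = ⨆ n, pou d (g n) a := by
  unfold pou
  rw [← lintegral_iSup (f := fun n b => kern d a b * g n b) (fun n => by fun_prop)
    (fun i j hij b => mul_le_mul_right (hm hij b) _)]
  simp_rw [ENNReal.mul_iSup]

theorem pou_mono (d : ℕ) {f g : ℝ → ℝ≥0∞} (h : ∀ x, f x ≤ g x) (a : ℝ) :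
    pou d f a ≤ pou d g a :=
  lintegral_mono fun b => mul_le_mul_right (h b) _

/-- The form of `Q` along increasing truncations. -/
theorem lintegral_mul_pou_iSup (d : ℕ) {f g : ℕ → ℝ → ℝ≥0∞} (hf : ∀ n, Measurable (f n))
    (hg : ∀ n, Measurable (g n)) (hfm : Monotone f) (hgm : Monotone g) :
    ∫⁻ a, (⨆ n, f n a) * pou d (fun x => ⨆ n, g n x) a ∂(statLaw d) =
      ⨆ n, ∫⁻ a, f n a * pou d (g n) a ∂(statLaw d) := by
  rw [← lintegral_iSup (f := fun n a => f n a * pou d (g n) a) (fun n => by fun_prop)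
    (fun i j hij a => mul_le_mul' (hfm hij a) (pou_mono d (hgm hij) a))]
  refine lintegral_congr fun a => ?_
  rw [pou_iSup d hg hgm, ENNReal.iSup_mul]
  simp_rw [ENNReal.mul_iSup]
  refine le_antisymm (iSup_le fun i => iSup_le fun j => ?_)
    (iSup_le fun n => le_iSup_of_le n (le_iSup_of_le n le_rfl))
  exact le_iSup_of_le (max i j) (mul_le_mul' (hfm (le_max_left i j) a)
    (pou_mono d (hgm (le_max_right i j)) a))

theorem iSup_min_natCast (x : ℝ≥0∞) : ⨆ n : ℕ, min x n = x := by
  have : ⨆ n : ℕ, min x (n : ℝ≥0∞) = min x (⨆ n : ℕ, (n : ℝ≥0∞)) := (inf_iSup_eq _ _).symm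
  rw [this, ENNReal.iSup_natCast, min_eq_left le_top]

theorem lintegral_mul_pou_le (hd : 2 ≤ d) (h : ℝ) {f g : ℝ → ℝ≥0∞}
    (hf : Measurable f) (hg : Measurable g) (hf0 : ∀ x < h, f x = 0) (hg0 : ∀ x < h, g x = 0) :
    2 * (d * ∫⁻ a, f a * pou d g a ∂(statLaw d)) ≤ ENNReal.ofReal (lam d h) *
      (∫⁻ a, f a ^ 2 ∂(statLaw d) + ∫⁻ a, g a ^ 2 ∂(statLaw d)) := by
  have e := lintegral_mul_pou_iSup d (f := fun n x => min (f x) (n : ℕ))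
    (g := fun n x => min (g x) (n : ℕ)) (fun n => by fun_prop) (fun n => by fun_prop)
    (fun i j hij x => min_le_min_left _ (by exact_mod_cast hij))
    (fun i j hij x => min_le_min_left _ (by exact_mod_cast hij))
  simp only [iSup_min_natCast] at e
  rw [e, ENNReal.mul_iSup, ENNReal.mul_iSup]
  refine iSup_le fun n => ?_
  refine (lintegral_mul_pou_le_of_bounded hd h (by fun_prop) (by fun_prop)
    (fun x hx => by simp [hg0 x hx]) (fun x hx => by simp [hf0 x hx]) n
    (fun x => min_le_right _ _) (fun x => min_le_right _ _)).trans ?_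
  gcongr <;> exact min_le_left _ _

/-- Since `|L_h g| ≤ L_h |g|` pointwise, nonnegative test functions already see the whole operator
norm. The form is tested on `|g|` and a multiple of `|L_h g|`. -/
theorem lam_le_of_form_le (hd : 2 ≤ d) (h : ℝ) {C : ℝ} (hC : 0 ≤ C)
    (H : ∀ f g : ℝ → ℝ≥0∞, Measurable f → Measurable g → (∀ x < h, f x = 0) →
      (∀ x < h, g x = 0) → 2 * (d * ∫⁻ a, f a * pou d g a ∂(statLaw d)) ≤
        ENNReal.ofReal C * (∫⁻ a, f a ^ 2 ∂(statLaw d) + ∫⁻ a, g a ^ 2 ∂(statLaw d))) :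
    lam d h ≤ C := by
  refine ContinuousLinearMap.opNorm_le_bound _ hC fun g => ?_
  set u := opLh d h g with hu
  have mu : Measurable u := (Lp.stronglyMeasurable u).measurable
  have mg : Measurable g := (Lp.stronglyMeasurable g).measurable
  set g' : ℝ → ℝ≥0∞ := (Set.Ici h).indicator fun a => ‖g a‖ₑ with hg'
  set u' : ℝ → ℝ≥0∞ := (Set.Ici h).indicator fun a => ‖u a‖ₑ with hu'
  have mg' : Measurable g' := mg.enorm.indicator measurableSet_Ici
  have mu' : Measurable u' := mu.enorm.indicator measurableSet_Ici
  have hle : ∀ᵐ a ∂(statLaw d), ‖u a‖ₑ ^ 2 ≤ u' a * (d * pou d g' a) := by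
    filter_upwards [opLh_coeFn d h g] with a ha
    have hua : ‖u a‖ₑ ≤ d * pou d g' a := by
      rw [hu, ha]
      by_cases hh : h ≤ a
      · rw [Set.indicator_of_mem (by exact hh), Pi.smul_apply, smul_eq_mul, enorm_mul,
          ouFun_eq hd, pou_eq_lintegral_innov hd mg']
        refine mul_le_mul' (le_of_eq (by simp [enorm])) ?_
        refine (enorm_integral_le_lintegral_enorm _).trans (lintegral_mono fun y => ?_)
        simp only [hg', Set.indicator_apply]
        split_ifs <;> simp
      · rw [Set.indicator_of_notMem (by exact hh)]; simp
    by_cases hh : h ≤ a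
    · have : u' a = ‖u a‖ₑ := Set.indicator_of_mem (by exact hh) _
      rw [this, sq]
      gcongr
    · rw [hu, ha, Set.indicator_of_notMem (by exact hh)]; simp
  have hu'2 : ∫⁻ a, u' a ^ 2 ∂(statLaw d) ≤ ENNReal.ofReal (‖u‖ ^ 2) := by
    rw [ofReal_norm_sq_Lp]
    refine lintegral_mono fun a => ?_
    gcongr
    exact Set.indicator_le_self' (fun _ _ => zero_le) a
  have hg'2 : ∫⁻ a, g' a ^ 2 ∂(statLaw d) ≤ ENNReal.ofReal (‖g‖ ^ 2) := by
    rw [ofReal_norm_sq_Lp]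
    refine lintegral_mono fun a => ?_
    gcongr
    exact Set.indicator_le_self' (fun _ _ => zero_le) a
  -- The free scale `s` recovers the product bound from the additive one: `s = C⁻¹` gives `‖u‖² ≤ C²
  -- ‖g‖²`, and for `C = 0` the value `s = 1` already gives `u = 0`.
  have key : ∀ s : ℝ, 0 ≤ s → 2 * (s * ‖u‖ ^ 2) ≤ C * (s ^ 2 * ‖u‖ ^ 2 + ‖g‖ ^ 2) := by
    intro s hs
    have h1 := H (fun a => ENNReal.ofReal s * u' a) g' (by fun_prop) mg'
      (fun x hx => by simp [hu', hx]) (fun x hx => by simp [hg', hx])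
    have h2 : ENNReal.ofReal s * ENNReal.ofReal (‖u‖ ^ 2) ≤
        d * ∫⁻ a, ENNReal.ofReal s * u' a * pou d g' a ∂(statLaw d) := by
      rw [ofReal_norm_sq_Lp, ← lintegral_const_mul _ (by fun_prop),
        ← lintegral_const_mul _ (by fun_prop)]
      refine lintegral_mono_ae ?_
      filter_upwards [hle] with a ha
      calc _ ≤ ENNReal.ofReal s * (u' a * (d * pou d g' a)) := by gcongr
        _ = _ := by ring
    have h3 : ∫⁻ a, (ENNReal.ofReal s * u' a) ^ 2 ∂(statLaw d) ≤
        ENNReal.ofReal s ^ 2 * ENNReal.ofReal (‖u‖ ^ 2) := by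
      simp_rw [mul_pow]
      rw [lintegral_const_mul _ (by fun_prop)]
      gcongr
    have h4 : 2 * (ENNReal.ofReal s * ENNReal.ofReal (‖u‖ ^ 2)) ≤ ENNReal.ofReal C *
        (ENNReal.ofReal s ^ 2 * ENNReal.ofReal (‖u‖ ^ 2) + ENNReal.ofReal (‖g‖ ^ 2)) :=
      calc _ ≤ _ := mul_le_mul_right h2 2
        _ ≤ _ := h1
        _ ≤ _ := by gcongr
    rw [← ENNReal.ofReal_pow hs, ← ENNReal.ofReal_mul hs, ← ENNReal.ofReal_mul (by positivity),
      ← ENNReal.ofReal_add (by positivity) (by positivity), ← ENNReal.ofReal_mul hC,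
      two_mul, ← ENNReal.ofReal_add (by positivity) (by positivity)] at h4
    rw [two_mul]
    exact (ENNReal.ofReal_le_ofReal_iff (by positivity)).1 h4
  rcases hC.eq_or_lt with rfl | hC
  · have := key 1 zero_le_one
    rw [zero_mul]
    nlinarith [norm_nonneg u]
  · have := key C⁻¹ (by positivity)
    refine abs_le_of_sq_le_sq' ?_ (by positivity) |>.2
    field_simp at this
    nlinarith

end Form

/-! ### Monotonicity and continuity of `λ_h` -/

section Lam

variable {d : ℕ}

theorem lam_nonneg (d : ℕ) (h : ℝ) : 0 ≤ lam d h := norm_nonneg (opLh d h)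

theorem lam_antitone (hd : 2 ≤ d) : Antitone (lam d) := fun h h' hh =>
  lam_le_of_form_le hd h' (lam_nonneg d h) fun _ _ hf hg hf0 hg0 =>
    lintegral_mul_pou_le hd h hf hg (fun x hx => hf0 x (hx.trans_le hh))
      (fun x hx => hg0 x (hx.trans_le hh))

theorem two_mul_le_add_sq_ofReal {δ : ℝ} (hδ : 0 < δ) (x y : ℝ≥0∞) :
    2 * (x * y) ≤ ENNReal.ofReal δ * x ^ 2 + ENNReal.ofReal δ⁻¹ * y ^ 2 := by
  have p1 : ENNReal.ofReal δ ≠ 0 := by simpa using hδ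
  have p2 : ENNReal.ofReal δ⁻¹ ≠ 0 := by simpa using hδ
  rcases eq_or_ne x ∞ with rfl | hx
  · simp [ENNReal.mul_top p1]
  rcases eq_or_ne y ∞ with rfl | hy
  · simp [ENNReal.mul_top p2]
  lift x to ℝ≥0 using hx
  lift y to ℝ≥0 using hy
  rw [ENNReal.ofReal, ENNReal.ofReal]
  norm_cast
  rw [← NNReal.coe_le_coe]
  push_cast
  rw [Real.coe_toNNReal _ hδ.le, Real.coe_toNNReal _ (by positivity)]
  have : 0 ≤ δ⁻¹ * (δ * x - y) ^ 2 := by positivity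
  have e : δ⁻¹ * (δ * x - y) ^ 2 = δ * (x : ℝ) ^ 2 + δ⁻¹ * (y : ℝ) ^ 2 - 2 * (x * y) := by
    field_simp; ring
  linarith

theorem two_mul_pou_le (hd : 2 ≤ d) {g : ℝ → ℝ≥0∞} (hg : Measurable g) {δ : ℝ} (hδ : 0 < δ)
    (x : ℝ≥0∞) (a : ℝ) : 2 * (x * pou d g a) ≤
      ENNReal.ofReal δ * x ^ 2 + ENNReal.ofReal δ⁻¹ * pou d (fun b => g b ^ 2) a := by
  have e1 : ENNReal.ofReal δ * x ^ 2 = ∫⁻ b, kern d a b * (ENNReal.ofReal δ * x ^ 2)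
      ∂(statLaw d) := by
    rw [lintegral_mul_const _ (by fun_prop), lintegral_kern hd, one_mul]
  rw [e1]
  unfold pou
  rw [← mul_assoc, ← lintegral_const_mul _ (by fun_prop), ← lintegral_const_mul _ (by fun_prop),
    ← lintegral_add_left (by fun_prop)]
  refine lintegral_mono fun b => ?_
  calc 2 * x * (kern d a b * g b) = kern d a b * (2 * (x * g b)) := by ring
    _ ≤ kern d a b * (ENNReal.ofReal δ * x ^ 2 + ENNReal.ofReal δ⁻¹ * g b ^ 2) := by
      gcongr; exact two_mul_le_add_sq_ofReal hδ _ _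
    _ = _ := by ring

/-- The density of a transition is bounded, so a thin strip is hit with probability at most `δ²`
from any point. Weighted AM–GM gives `δ f² + δ⁻¹ 1_s Q(g²)`, and reversibility turns the last
integral into that of `g² Q1_s`, which is at most `δ² ∫ g²`. -/
theorem form_strip_le (hd : 2 ≤ d) {f g : ℝ → ℝ≥0∞} (hf : Measurable f) (hg : Measurable g)
    {s : Set ℝ} (hs : MeasurableSet s) {δ : ℝ} (hδ : 0 < δ)
    (hv : ENNReal.ofReal (√(2 * Real.pi * innovVar d))⁻¹ * volume s ≤ ENNReal.ofReal (δ ^ 2)) :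
    2 * ∫⁻ a, s.indicator f a * pou d g a ∂(statLaw d) ≤ ENNReal.ofReal δ *
      (∫⁻ a, f a ^ 2 ∂(statLaw d) + ∫⁻ a, g a ^ 2 ∂(statLaw d)) := by
  have m1 : Measurable (s.indicator f) := hf.indicator hs
  have m2 : Measurable (s.indicator (1 : ℝ → ℝ≥0∞)) := measurable_one.indicator hs
  rw [← lintegral_const_mul _ (by fun_prop)]
  calc _ ≤ ∫⁻ a, ENNReal.ofReal δ * f a ^ 2 +
        ENNReal.ofReal δ⁻¹ * (s.indicator 1 a * pou d (fun b => g b ^ 2) a) ∂(statLaw d) := by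
        refine lintegral_mono fun a => ?_
        by_cases ha : a ∈ s
        · simp only [Set.indicator_of_mem ha, Pi.one_apply, one_mul]
          exact two_mul_pou_le hd hg hδ _ _
        · simp [Set.indicator_of_notMem ha]
    _ = ENNReal.ofReal δ * ∫⁻ a, f a ^ 2 ∂(statLaw d) + ENNReal.ofReal δ⁻¹ *
        ∫⁻ a, g a ^ 2 * pou d (s.indicator 1) a ∂(statLaw d) := by
        rw [lintegral_add_left (by fun_prop), lintegral_const_mul _ (by fun_prop),
          lintegral_const_mul _ (by fun_prop), lintegral_mul_pou_comm m2 (by fun_prop)]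
    _ ≤ ENNReal.ofReal δ * ∫⁻ a, f a ^ 2 ∂(statLaw d) + ENNReal.ofReal δ⁻¹ *
        ∫⁻ a, g a ^ 2 * ENNReal.ofReal (δ ^ 2) ∂(statLaw d) := by
        gcongr with a
        refine le_trans (le_of_eq ?_) ((lintegral_kern_indicator_le hd a hs).trans hv)
        rw [pou, ← lintegral_indicator hs]
        refine lintegral_congr fun b => ?_
        by_cases hb : b ∈ s <;> simp [hb]
    _ = _ := by
        rw [lintegral_mul_const _ (by fun_prop), mul_add]
        congr 1
        rw [mul_comm (lintegral _ _), ← mul_assoc, ← ENNReal.ofReal_mul (by positivity)]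
        congr 2
        field_simp

/-- Cut both test functions at `h`. The part above `h` is controlled by `λ_h`; each of the two
remaining terms has one factor supported in the strip `[h', h)`. The resulting modulus of continuity
is of order `1/2`. -/
theorem lam_le_add (hd : 2 ≤ d) {h h' : ℝ} (hh : h' < h) :
    lam d h' ≤ lam d h + 2 * d * √((√(2 * Real.pi * innovVar d))⁻¹ * (h - h')) := by
  have hv : 0 < ((innovVar d : ℝ≥0) : ℝ) := by
    have := innovVar_ne_zero hd
    exact NNReal.coe_pos.2 (pos_iff_ne_zero.2 this)
  set C := (√(2 * Real.pi * innovVar d))⁻¹ with hC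
  have hCpos : 0 < C := by positivity
  set δ := √(C * (h - h')) with hδ
  have hδ0 : 0 < δ := Real.sqrt_pos.2 (mul_pos hCpos (by linarith))
  have hδ2 : δ ^ 2 = C * (h - h') := Real.sq_sqrt (mul_nonneg hCpos.le (by linarith))
  have hvol : ENNReal.ofReal C * volume (Set.Ico h' h) ≤ ENNReal.ofReal (δ ^ 2) := by
    rw [Real.volume_Ico, ← ENNReal.ofReal_mul hCpos.le, hδ2]
  refine lam_le_of_form_le hd h' (add_nonneg (lam_nonneg d h) (by positivity))
    fun f g hf hg hf0 hg0 => ?_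
  set f1 := (Set.Ici h).indicator f with hf1
  set g1 := (Set.Ici h).indicator g with hg1
  set f2 := (Set.Ico h' h).indicator f with hf2
  set g2 := (Set.Ico h' h).indicator g with hg2
  have split : ∀ u : ℝ → ℝ≥0∞, (∀ x < h', u x = 0) → ∀ x,
      u x = (Set.Ici h).indicator u x + (Set.Ico h' h).indicator u x := by
    intro u hu x
    by_cases h1 : h ≤ x
    · simp [Set.indicator, h1, not_lt.2 h1]
    · by_cases h2 : h' ≤ x
      · simp [Set.indicator, h1, h2, not_le.1 h1]
      · simp [Set.indicator, h1, h2, hu x (not_le.1 h2)]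
  have mf1 : Measurable f1 := hf.indicator measurableSet_Ici
  have mg1 : Measurable g1 := hg.indicator measurableSet_Ici
  have mf2 : Measurable f2 := hf.indicator measurableSet_Ico
  have mg2 : Measurable g2 := hg.indicator measurableSet_Ico
  have f1le : ∀ x, f1 x ≤ f x := Set.indicator_le_self' (fun _ _ => zero_le)
  have g1le : ∀ x, g1 x ≤ g x := Set.indicator_le_self' (fun _ _ => zero_le)
  have pouadd : ∀ a, pou d g a = pou d g1 a + pou d g2 a := by
    intro a
    unfold pou
    rw [← lintegral_add_left (by fun_prop)]
    refine lintegral_congr fun b => ?_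
    rw [← mul_add, ← split g hg0]
  have e : ∫⁻ a, f a * pou d g a ∂(statLaw d) = ∫⁻ a, f1 a * pou d g1 a ∂(statLaw d) +
      (∫⁻ a, g2 a * pou d f1 a ∂(statLaw d) + ∫⁻ a, f2 a * pou d g a ∂(statLaw d)) := by
    rw [lintegral_mul_pou_comm mg2 mf1, ← lintegral_add_left (by fun_prop),
      ← lintegral_add_left (by fun_prop)]
    refine lintegral_congr fun a => ?_
    calc f a * pou d g a = (f1 a + f2 a) * pou d g a := by rw [← split f hf0]
      _ = f1 a * (pou d g1 a + pou d g2 a) + f2 a * pou d g a := by rw [← pouadd]; ring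
      _ = _ := by ring
  set A := ∫⁻ a, f a ^ 2 ∂(statLaw d) with hA
  set B := ∫⁻ a, g a ^ 2 ∂(statLaw d) with hB
  have b1 := lintegral_mul_pou_le hd h mf1 mg1 (fun x hx => by simp [hf1, hx])
    (fun x hx => by simp [hg1, hx])
  have A1 : ∫⁻ a, f1 a ^ 2 ∂(statLaw d) ≤ A := lintegral_mono fun a => by gcongr; exact f1le a
  have B1 : ∫⁻ a, g1 a ^ 2 ∂(statLaw d) ≤ B := lintegral_mono fun a => by gcongr; exact g1le a
  have b2 := form_strip_le hd hg mf1 measurableSet_Ico hδ0 hvol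
  have b3 := form_strip_le hd hf hg measurableSet_Ico hδ0 hvol
  rw [e, ENNReal.ofReal_add (lam_nonneg d h) (by positivity), ENNReal.ofReal_mul (by positivity),
    ENNReal.ofReal_mul (by positivity), ENNReal.ofReal_natCast]
  calc _ = 2 * (d * ∫⁻ a, f1 a * pou d g1 a ∂(statLaw d)) +
        d * (2 * ∫⁻ a, g2 a * pou d f1 a ∂(statLaw d) +
          2 * ∫⁻ a, f2 a * pou d g a ∂(statLaw d)) := by ring
    _ ≤ ENNReal.ofReal (lam d h) * (A + B) +
        d * (ENNReal.ofReal δ * (B + A) + ENNReal.ofReal δ * (A + B)) := by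
        refine add_le_add (b1.trans ?_) (mul_le_mul_right (add_le_add (b2.trans ?_) b3) _)
        · gcongr
        · gcongr
    _ = (ENNReal.ofReal (lam d h) + 2 * d * ENNReal.ofReal δ) * (A + B) := by ring
    _ = _ := by simp

theorem continuous_lam (hd : 2 ≤ d) : Continuous (lam d) := by
  set C := (√(2 * Real.pi * innovVar d))⁻¹ with hC
  rw [continuous_iff_continuousAt]
  intro x
  have key : ∀ y, |lam d y - lam d x| ≤ 2 * d * √(C * |y - x|) := by
    intro y
    rcases lt_trichotomy y x with h | h | h
    · have h1 := lam_antitone hd h.le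
      have h2 := lam_le_add hd h
      rw [abs_of_nonneg (by linarith), abs_of_neg (by linarith : y - x < 0), neg_sub]
      linarith
    · simp [h]
    · have h1 := lam_antitone hd h.le
      have h2 := lam_le_add hd h
      rw [abs_of_nonpos (by linarith), abs_of_pos (by linarith : 0 < y - x)]
      linarith
  rw [ContinuousAt, tendsto_iff_norm_sub_tendsto_zero]
  refine squeeze_zero (fun y => norm_nonneg _) key ?_
  have : Continuous fun y => 2 * d * √(C * |y - x|) := by fun_prop
  simpa using this.tendsto x

theorem half_lt_gaussian (hd : 2 ≤ d) {x : ℝ} (hx : 0 < x) :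
    (2 : ℝ≥0∞)⁻¹ < gaussianReal 0 (innovVar d) (Set.Ici (-x)) := by
  have hv := innovVar_ne_zero hd
  set γ := gaussianReal 0 (innovVar d) with hγ
  have hsym : γ (Set.Iic 0) = γ (Set.Ici 0) := by
    have h1 : γ.map (fun y => -y) = γ := by rw [hγ, gaussianReal_map_neg, neg_zero]
    conv_lhs => rw [← h1, Measure.map_apply measurable_neg measurableSet_Iic]
    congr 1
    ext y; simp
  have h1 : 1 ≤ 2 * γ (Set.Ici 0) := by
    have : γ Set.univ ≤ γ (Set.Iic 0) + γ (Set.Ici 0) := by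
      rw [← Set.Iic_union_Ici (a := (0 : ℝ))]
      exact measure_union_le _ _
    rwa [measure_univ, hsym, ← two_mul] at this
  have h2 : (2 : ℝ≥0∞)⁻¹ ≤ γ (Set.Ici 0) := by
    rw [ENNReal.inv_le_iff_le_mul (by simp) (by simp)]
    exact h1
  have h3 : γ (Set.Ico (-x) 0) ≠ 0 := by
    intro h0
    have := gaussianReal_absolutelyContinuous' 0 hv h0
    rw [Real.volume_Ico] at this
    simp at this
    linarith
  have h4 : γ (Set.Ici (-x)) = γ (Set.Ico (-x) 0) + γ (Set.Ici 0) := by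
    rw [← measure_union _ measurableSet_Ici, Set.Ico_union_Ici_eq_Ici (by linarith)]
    rw [Set.disjoint_left]
    intro y hy hy'
    exact not_le.2 hy.2 hy'
  rw [h4]
  calc (2 : ℝ≥0∞)⁻¹ ≤ γ (Set.Ici 0) := h2
    _ < _ := by
      rw [add_comm]
      exact ENNReal.lt_add_right (measure_ne_top _ _) h3

/-- From `a > 0` the chain moves to a centre `a/d > 0`, so it stays nonnegative with probability
above `1/2`. Testing with `f = 1_{[0,∞)}` gives `⟨f, L f⟩ > (d/2) ‖f‖² ≥ ‖f‖²`. -/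
theorem one_lt_lam_zero (hd : 2 ≤ d) : 1 < lam d 0 := by
  by_contra hcon
  have hd0 : (0 : ℝ) < d := by exact_mod_cast (by omega : 0 < d)
  set f : ℝ → ℝ≥0∞ := (Set.Ici 0).indicator 1 with hf
  have mf : Measurable f := measurable_one.indicator measurableSet_Ici
  have h1 := lintegral_mul_pou_le hd 0 mf mf (fun x hx => by simp [hf, hx])
    (fun x hx => by simp [hf, hx])
  have e1 : ∫⁻ a, f a ^ 2 ∂(statLaw d) = statLaw d (Set.Ici 0) := by
    rw [← lintegral_indicator_one measurableSet_Ici]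
    refine lintegral_congr fun a => ?_
    by_cases ha : 0 ≤ a <;> simp [hf, ha]
  have e2 : ∫⁻ a, f a * pou d f a ∂(statLaw d) = ∫⁻ a in Set.Ici 0, pou d f a ∂(statLaw d) := by
    rw [← lintegral_indicator measurableSet_Ici]
    refine lintegral_congr fun a => ?_
    by_cases ha : 0 ≤ a <;> simp [hf, ha]
  have hpos : statLaw d (Set.Ioi 0) ≠ 0 := by
    intro h0
    have := gaussianReal_absolutelyContinuous' 0 (sigmaSq_ne_zero hd) h0
    simp at this
  have e3 : (2 : ℝ≥0∞)⁻¹ * statLaw d (Set.Ioi 0) < ∫⁻ a in Set.Ioi 0, pou d f a ∂(statLaw d) := by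
    rw [← setLIntegral_const]
    refine setLIntegral_strict_mono measurableSet_Ioi hpos (by fun_prop) ?_ ?_
    · rw [setLIntegral_const]
      exact ENNReal.mul_ne_top (by simp) (measure_ne_top _ _)
    · refine ae_of_all _ fun a ha => ?_
      rw [pou_eq_lintegral_innov hd mf]
      have : ∀ u, f (a / d + u) = (Set.Ici (-(a / d))).indicator 1 u := by
        intro u
        simp only [hf, Set.indicator_apply, Set.mem_Ici, neg_le_iff_add_nonneg, Pi.one_apply]
        congr 1
        rw [add_comm]
      simp_rw [this]
      rw [lintegral_indicator_one measurableSet_Ici]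
      exact half_lt_gaussian hd (div_pos ha hd0)
  have e4 : statLaw d (Set.Ioi 0) = statLaw d (Set.Ici 0) := by
    have := nullSingletonClass_gaussianReal (μ := 0) (sigmaSq_ne_zero hd)
    exact measure_congr Ioi_ae_eq_Ici
  have e5 : ∫⁻ a in Set.Ioi 0, pou d f a ∂(statLaw d) ≤ ∫⁻ a in Set.Ici 0, pou d f a ∂(statLaw d) :=
    lintegral_mono_set Set.Ioi_subset_Ici_self
  rw [e1, e2] at h1
  rw [e4] at e3
  have e6 := e3.trans_le e5
  set m := statLaw d (Set.Ici 0)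
  set A := ∫⁻ a in Set.Ici 0, pou d f a ∂(statLaw d)
  have h2 : 2 * (2 * A) ≤ 2 * m :=
    calc 2 * (2 * A) ≤ 2 * (d * A) := by gcongr; exact_mod_cast hd
      _ ≤ _ := h1
      _ ≤ 1 * (m + m) := by
        gcongr
        exact ENNReal.ofReal_le_one.2 (not_lt.1 hcon)
      _ = 2 * m := by ring
  have h3 : 2 * A ≤ m := by
    rwa [ENNReal.mul_le_mul_iff_right (by simp) (by simp)] at h2
  have h4 : A ≤ 2⁻¹ * m := by
    calc A = 2⁻¹ * (2 * A) := by
          rw [← mul_assoc, ENNReal.inv_mul_cancel (by simp) (by simp), one_mul]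
      _ ≤ _ := by gcongr
  exact absurd (e6.trans_le h4) (lt_irrefl _)

/-- The square root of the density of the stationary law translated by `c`. -/
def tiltWeight (d : ℕ) (c a : ℝ) : ℝ≥0∞ :=
  ENNReal.ofReal (Real.exp (-(2 * a * c + c ^ 2) / (4 * sigmaSq d)))

@[fun_prop]
theorem measurable_tiltWeight (c : ℝ) : Measurable (tiltWeight d c) := by
  unfold tiltWeight; fun_prop

/-- The Cameron–Martin formula: the density of the translated Gaussian law is the square of the
tilt, so translating and tilting is an isometry of `L²(ν)`. -/
theorem lintegral_statLaw_shift (hd : 2 ≤ d) (c : ℝ) {f : ℝ → ℝ≥0∞} (hf : Measurable f) :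
    ∫⁻ a, f a ∂(statLaw d) = ∫⁻ a, f (a + c) * tiltWeight d c a ^ 2 ∂(statLaw d) := by
  have hs := sigmaSq_pos hd
  rw [statLaw, gaussianReal_of_var_ne_zero _ (sigmaSq_ne_zero hd),
    lintegral_withDensity_eq_lintegral_mul _ (measurable_gaussianPDF _ _) hf,
    lintegral_withDensity_eq_lintegral_mul _ (measurable_gaussianPDF _ _) (by fun_prop),
    ← lintegral_add_right_eq_self _ c]
  refine lintegral_congr fun a => ?_
  simp only [Pi.mul_apply]
  have : gaussianPDF 0 (sigmaSq d) (a + c) =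
      gaussianPDF 0 (sigmaSq d) a * tiltWeight d c a ^ 2 := by
    rw [gaussianPDF, gaussianPDF, tiltWeight, ← ENNReal.ofReal_pow (Real.exp_pos _).le,
      ← ENNReal.ofReal_mul (gaussianPDFReal_nonneg _ _ _), gaussianPDFReal, gaussianPDFReal,
      ← Real.exp_nat_mul, mul_assoc (√_)⁻¹, ← Real.exp_add]
    congr 3
    field_simp
    push_cast
    ring
  rw [this]; ring

/-- After tilting, the shifted kernel is the original one times `exp(-κ (c(a+b) + c²))` with `κ =
(d-1)²/(2d)`. For `c ≥ 0` and `a, b ≥ h` the bracket is at least `2ch + c² = (h+c)² - h²`. -/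
theorem kern_shift_le (hd : 2 ≤ d) {h c a b : ℝ} (hc : 0 ≤ c) (ha : h ≤ a) (hb : h ≤ b) :
    kern d (a + c) (b + c) * (tiltWeight d c a * tiltWeight d c b) ≤
      ENNReal.ofReal (Real.exp (-(((d : ℝ) - 1) ^ 2 / (2 * d) * ((h + c) ^ 2 - h ^ 2)))) *
        kern d a b := by
  have hd' : (2 : ℝ) ≤ d := by exact_mod_cast hd
  have h1 : (d : ℝ) ^ 2 - 1 ≠ 0 := by nlinarith
  rw [kern, kern, tiltWeight, tiltWeight, ← ENNReal.ofReal_mul (Real.exp_pos _).le,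
    ← ENNReal.ofReal_mul (Real.exp_pos _).le, ← ENNReal.ofReal_mul (mehler_pos hd _ _).le]
  refine ENNReal.ofReal_le_ofReal ?_
  rw [mehler, mehler, mul_left_comm (Real.exp (-_)), mul_assoc, ← Real.exp_add, ← Real.exp_add,
    ← Real.exp_add]
  refine mul_le_mul_of_nonneg_left (Real.exp_le_exp.2 ?_) (by positivity)
  have e : (a + c) * (b + c) - ((a + c) ^ 2 + (b + c) ^ 2) / (2 * d) +
      (-(2 * a * c + c ^ 2) / (4 * (sigmaSq d : ℝ)) + -(2 * b * c + c ^ 2) / (4 * (sigmaSq d : ℝ)))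
      = -(((d : ℝ) - 1) ^ 2 / (2 * d) * (c * (a + b) + c ^ 2)) +
        (a * b - (a ^ 2 + b ^ 2) / (2 * d)) := by
    rw [sigmaSq_coe hd]
    field_simp
    ring
  rw [e]
  have : (h + c) ^ 2 - h ^ 2 ≤ c * (a + b) + c ^ 2 := by nlinarith
  have h3 : 0 ≤ ((d : ℝ) - 1) ^ 2 / (2 * d) := by positivity
  have := mul_le_mul_of_nonneg_left this h3
  linarith

/-- Translating the functions compares `λ` at different levels. -/
theorem lam_shift_le (hd : 2 ≤ d) {h h' : ℝ} (hh : h ≤ h') :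
    lam d h' ≤ Real.exp (-(((d : ℝ) - 1) ^ 2 / (2 * d) * (h' ^ 2 - h ^ 2))) * lam d h := by
  obtain ⟨c, hc, rfl⟩ : ∃ c, 0 ≤ c ∧ h' = h + c := ⟨h' - h, by linarith, by ring⟩
  set E := Real.exp (-(((d : ℝ) - 1) ^ 2 / (2 * d) * ((h + c) ^ 2 - h ^ 2))) with hE
  refine lam_le_of_form_le hd _ (mul_nonneg (Real.exp_pos _).le (lam_nonneg d h))
    fun f g hf hg hf0 hg0 => ?_
  set f' : ℝ → ℝ≥0∞ := fun a => f (a + c) * tiltWeight d c a with hf'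
  set g' : ℝ → ℝ≥0∞ := fun a => g (a + c) * tiltWeight d c a with hg'
  have mf' : Measurable f' := by fun_prop
  have mg' : Measurable g' := by fun_prop
  have H := lintegral_mul_pou_le hd h mf' mg'
    (fun x hx => by simp [hf', hf0 (x + c) (by linarith)])
    (fun x hx => by simp [hg', hg0 (x + c) (by linarith)])
  have nf : ∫⁻ a, f' a ^ 2 ∂(statLaw d) = ∫⁻ a, f a ^ 2 ∂(statLaw d) := by
    rw [lintegral_statLaw_shift hd c (f := fun a => f a ^ 2) (by fun_prop)]
    exact lintegral_congr fun a => by rw [hf', mul_pow]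
  have ng : ∫⁻ a, g' a ^ 2 ∂(statLaw d) = ∫⁻ a, g a ^ 2 ∂(statLaw d) := by
    rw [lintegral_statLaw_shift hd c (f := fun a => g a ^ 2) (by fun_prop)]
    exact lintegral_congr fun a => by rw [hg', mul_pow]
  rw [nf, ng] at H
  have key : ∫⁻ a, f a * pou d g a ∂(statLaw d) ≤
      ENNReal.ofReal E * ∫⁻ a, f' a * pou d g' a ∂(statLaw d) := by
    rw [lintegral_statLaw_shift hd c (by fun_prop), ← lintegral_const_mul _ (by fun_prop)]
    refine lintegral_mono fun a => ?_
    by_cases ha : h ≤ a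
    · unfold pou
      rw [lintegral_statLaw_shift hd c (by fun_prop)]
      have e1 : f (a + c) * (∫⁻ b, kern d (a + c) (b + c) * g (b + c) * tiltWeight d c b ^ 2
          ∂(statLaw d)) * tiltWeight d c a ^ 2 = ∫⁻ b, f' a * (kern d (a + c) (b + c) *
          (tiltWeight d c a * tiltWeight d c b) * g' b) ∂(statLaw d) := by
        rw [lintegral_const_mul _ (by fun_prop)]
        have : ∀ b, kern d (a + c) (b + c) * (tiltWeight d c a * tiltWeight d c b) * g' b =
            tiltWeight d c a * (kern d (a + c) (b + c) * g (b + c) * tiltWeight d c b ^ 2) :=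
          fun b => by simp only [hg']; ring
        simp_rw [this]
        rw [lintegral_const_mul _ (by fun_prop)]
        simp only [hf']
        ring
      rw [e1, mul_left_comm, ← lintegral_const_mul _ (by fun_prop),
        ← lintegral_const_mul _ (by fun_prop)]
      refine lintegral_mono fun b => ?_
      refine mul_le_mul_right ?_ _
      by_cases hb : h ≤ b
      · rw [← mul_assoc (ENNReal.ofReal E)]
        exact mul_le_mul_left (kern_shift_le hd hc ha hb) _
      · simp [hg', hg0 (b + c) (by linarith)]
    · simp [hf0 (a + c) (by linarith)]
  calc _ ≤ 2 * (d * (ENNReal.ofReal E * ∫⁻ a, f' a * pou d g' a ∂(statLaw d))) := by gcongr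
    _ = ENNReal.ofReal E * (2 * (d * ∫⁻ a, f' a * pou d g' a ∂(statLaw d))) := by ring
    _ ≤ _ := mul_le_mul_right H _
    _ = _ := by rw [ENNReal.ofReal_mul (Real.exp_pos _).le, mul_assoc]

theorem lam_shift_exponent_pos (hd : 2 ≤ d) : 0 < ((d : ℝ) - 1) ^ 2 / (2 * d) := by
  have : (2 : ℝ) ≤ d := by exact_mod_cast hd
  have : 0 < (d : ℝ) - 1 := by linarith
  positivity

theorem pos_of_lam_eq_one (hd : 2 ≤ d) {hs : ℝ} (h1 : lam d hs = 1) : 0 < hs := by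
  by_contra hc
  have := lam_antitone hd (not_lt.1 hc)
  linarith [one_lt_lam_zero hd]

/-- Positivity of the root matters: it makes `h² - hs²` positive, so the translation factor is
strictly below `1`. -/
theorem lam_lt_one (hd : 2 ≤ d) {hs h : ℝ} (h1 : lam d hs = 1) (hh : hs < h) : lam d h < 1 := by
  have hp := pos_of_lam_eq_one hd h1
  have := lam_shift_le hd hh.le
  rw [h1, mul_one] at this
  refine this.trans_lt (Real.exp_lt_one_iff.2 ?_)
  have := mul_pos (lam_shift_exponent_pos hd) (by nlinarith : 0 < h ^ 2 - hs ^ 2)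
  linarith

/-- Below zero, `λ_0 > 1` and monotonicity suffice. Otherwise `λ_h ≤ 1` would make `h` a second
root, and `lam_lt_one` started from `h` would contradict the value at `hs`. -/
theorem one_lt_lam (hd : 2 ≤ d) {hs h : ℝ} (h1 : lam d hs = 1) (hh : h < hs) : 1 < lam d h := by
  rcases lt_or_ge h 0 with h0 | h0
  · exact (one_lt_lam_zero hd).trans_le (lam_antitone hd h0.le)
  · by_contra hc
    have hle := lam_antitone hd hh.le
    have h2 : lam d h = 1 := le_antisymm (not_lt.1 hc) (h1 ▸ hle)
    exact absurd h1 (lam_lt_one hd h2 hh).ne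

/-- The translation bound from level `0` sends `λ` to zero at infinity; as `λ_0 > 1`, the
intermediate value theorem gives a root. -/
theorem existsUnique_lam_eq_one (hd : 2 ≤ d) : ∃! hs : ℝ, lam d hs = 1 := by
  have hκ := lam_shift_exponent_pos hd
  set κ := ((d : ℝ) - 1) ^ 2 / (2 * d) with hκd
  have hlim : Filter.Tendsto (fun h : ℝ => Real.exp (-(κ * (h ^ 2 - 0 ^ 2))) * lam d 0)
      Filter.atTop (nhds (0 * lam d 0)) := by
    refine Filter.Tendsto.mul_const _ (Real.tendsto_exp_neg_atTop_nhds_zero.comp ?_)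
    refine Filter.Tendsto.const_mul_atTop hκ ?_
    simp
  rw [zero_mul] at hlim
  obtain ⟨H, hH, hH0⟩ :=
    ((hlim.eventually (gt_mem_nhds one_pos)).and (Filter.eventually_ge_atTop 0)).exists
  have hHlt : lam d H < 1 := (lam_shift_le hd hH0).trans_lt hH
  obtain ⟨hs, -, hs1⟩ := intermediate_value_Icc' hH0 (continuous_lam hd).continuousOn
    ⟨hHlt.le, (one_lt_lam_zero hd).le⟩
  refine ⟨hs, hs1, fun h h1 => ?_⟩
  rcases lt_trichotomy h hs with hlt | heq | hlt
  · exact absurd h1 (one_lt_lam hd hs1 hlt).ne'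
  · exact heq
  · exact absurd h1 (lam_lt_one hd hs1 hlt).ne

end Lam

/-! ### Survival probabilities in the `d`-ary tree -/

section Recursion

variable {d : ℕ}

/-- The probability that a vertex of the `d`-ary tree with value `a` is not connected to its
descendants `n` generations below in the level set above `h`. -/
def noSurv (d : ℕ) (h : ℝ) : ℕ → ℝ → ℝ≥0∞
  | 0 => (Set.Iio h).indicator 1
  | n + 1 => fun a => (Set.Iio h).indicator 1 a + (Set.Ici h).indicator 1 a *
      pou d (noSurv d h n) a ^ d

/-- The probability that none of the descendants `m` generations below a vertex with value `a`
is connected to its own descendants `n` generations further below. -/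
def noSurvBelow (d : ℕ) (h : ℝ) (n : ℕ) : ℕ → ℝ → ℝ≥0∞
  | 0 => noSurv d h n
  | m + 1 => fun a => pou d (noSurvBelow d h n m) a ^ d

@[fun_prop]
theorem measurable_noSurv (h : ℝ) : ∀ n, Measurable (noSurv d h n)
  | 0 => measurable_one.indicator measurableSet_Iio
  | n + 1 => by
    have := measurable_noSurv h n
    have h1 : Measurable ((Set.Iio h).indicator (1 : ℝ → ℝ≥0∞)) :=
      measurable_one.indicator measurableSet_Iio
    have h2 : Measurable ((Set.Ici h).indicator (1 : ℝ → ℝ≥0∞)) :=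
      measurable_one.indicator measurableSet_Ici
    unfold noSurv
    fun_prop

@[fun_prop]
theorem measurable_noSurvBelow (h : ℝ) (n : ℕ) : ∀ m, Measurable (noSurvBelow d h n m)
  | 0 => measurable_noSurv h n
  | m + 1 => by
    have := measurable_noSurvBelow h n m
    unfold noSurvBelow
    fun_prop

theorem noSurv_of_lt {h a : ℝ} (ha : a < h) (n : ℕ) : noSurv d h n a = 1 := by
  cases n <;> simp [noSurv, ha]

theorem noSurv_succ_of_le {h a : ℝ} (ha : h ≤ a) (n : ℕ) :
    noSurv d h (n + 1) a = pou d (noSurv d h n) a ^ d := by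
  simp [noSurv, ha]

theorem pou_one (hd : 2 ≤ d) (a : ℝ) : pou d (fun _ => 1) a = 1 := by
  simp [pou, lintegral_kern hd]

theorem pou_le_one (hd : 2 ≤ d) {f : ℝ → ℝ≥0∞} (hf : ∀ x, f x ≤ 1) (a : ℝ) : pou d f a ≤ 1 :=
  (pou_mono d hf a).trans_eq (pou_one hd a)

theorem pou_const_mul (c : ℝ≥0∞) {f : ℝ → ℝ≥0∞} (hf : Measurable f) (a : ℝ) :
    pou d (fun x => c * f x) a = c * pou d f a := by
  unfold pou
  rw [← lintegral_const_mul _ (by fun_prop)]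
  exact lintegral_congr fun b => by ring

theorem pou_add {f g : ℝ → ℝ≥0∞} (hf : Measurable f) (a : ℝ) :
    pou d (fun x => f x + g x) a = pou d f a + pou d g a := by
  unfold pou
  rw [← lintegral_add_left (by fun_prop)]
  exact lintegral_congr fun b => by ring

theorem noSurv_le_one (hd : 2 ≤ d) (h : ℝ) : ∀ n a, noSurv d h n a ≤ 1
  | 0, a => by by_cases ha : a < h <;> simp [noSurv, ha]
  | n + 1, a => by
    by_cases ha : a < h
    · exact (noSurv_of_lt ha _).le
    · rw [noSurv_succ_of_le (not_lt.1 ha)]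
      exact pow_le_one₀ zero_le (pou_le_one hd (noSurv_le_one hd h n) a)

theorem noSurvBelow_le_one (hd : 2 ≤ d) (h : ℝ) (n : ℕ) : ∀ m a, noSurvBelow d h n m a ≤ 1
  | 0, a => noSurv_le_one hd h n a
  | m + 1, a => pow_le_one₀ zero_le (pou_le_one hd (noSurvBelow_le_one hd h n m) a)

theorem noSurv_le_succ (h : ℝ) : ∀ n a, noSurv d h n a ≤ noSurv d h (n + 1) a
  | 0, a => by
    by_cases ha : a < h
    · rw [noSurv_of_lt ha, noSurv_of_lt ha]
    · simp [noSurv, ha]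
  | n + 1, a => by
    by_cases ha : a < h
    · rw [noSurv_of_lt ha, noSurv_of_lt ha]
    · rw [noSurv_succ_of_le (not_lt.1 ha), noSurv_succ_of_le (not_lt.1 ha)]
      exact pow_le_pow_left' (pou_mono d (noSurv_le_succ h n) a) d

theorem noSurvBelow_mono (h : ℝ) : ∀ m, Monotone fun n => noSurvBelow d h n m
  | 0 => monotone_nat_of_le_succ fun n a => noSurv_le_succ h n a
  | m + 1 => fun _ _ hij a =>
    pow_le_pow_left' (pou_mono d (fun x => noSurvBelow_mono h m hij x) a) d

/-! ### The subcritical regime -/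

theorem one_sub_pow_le (n : ℕ) {x : ℝ≥0∞} (hx : x ≤ 1) : 1 - x ^ n ≤ n * (1 - x) := by
  lift x to ℝ≥0 using ne_top_of_le_ne_top (by simp) hx
  have hx' : x ≤ 1 := by exact_mod_cast hx
  have h1 : x ^ n ≤ 1 := pow_le_one₀ zero_le hx'
  norm_cast
  rw [← NNReal.coe_le_coe, NNReal.coe_sub h1, NNReal.coe_mul, NNReal.coe_sub hx']
  push_cast
  have := one_add_mul_le_pow (a := (x : ℝ) - 1) (by linarith [x.2]) n
  rw [add_sub_cancel] at this
  linarith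

theorem pou_one_sub (hd : 2 ≤ d) {f : ℝ → ℝ≥0∞} (hf : Measurable f) (h1 : ∀ x, f x ≤ 1) (a : ℝ) :
    pou d (fun x => 1 - f x) a = 1 - pou d f a := by
  refine ENNReal.eq_sub_of_add_eq (ne_top_of_le_ne_top (by simp) (pou_le_one hd h1 a)) ?_
  rw [← pou_add (by fun_prop)]
  simp_rw [tsub_add_cancel_of_le (h1 _)]
  exact pou_one hd a

/-- The union bound over the `d` children, in the form of Bernoulli's inequality. It linearizes the
recursion into an application of `L`. -/
theorem one_sub_noSurv_succ_le (hd : 2 ≤ d) (h : ℝ) (n : ℕ) (a : ℝ) :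
    1 - noSurv d h (n + 1) a ≤ d * pou d (fun x => 1 - noSurv d h n x) a := by
  by_cases ha : a < h
  · simp [noSurv_of_lt ha]
  · rw [noSurv_succ_of_le (not_lt.1 ha), pou_one_sub hd (by fun_prop) (noSurv_le_one hd h n)]
    exact one_sub_pow_le d (pou_le_one hd (noSurv_le_one hd h n) a)

theorem tendsto_lintegral_one_sub_noSurv (hd : 2 ≤ d) {h : ℝ} (hl : lam d h < 1) :
    Filter.Tendsto (fun n => ∫⁻ a, (1 - noSurv d h n a) ∂(statLaw d)) Filter.atTop (nhds 0) := by
  set s : ℕ → ℝ → ℝ≥0∞ := fun n a => 1 - noSurv d h n a with hs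
  have ms : ∀ n, Measurable (s n) := fun n => by simp only [hs]; fun_prop
  have s1 : ∀ n a, s n a ≤ 1 := fun n a => tsub_le_self
  set x : ℕ → ℝ := fun n => (∫⁻ a, s n a ^ 2 ∂(statLaw d)).toReal with hx
  have fin : ∀ n, ∫⁻ a, s n a ^ 2 ∂(statLaw d) ≠ ∞ := fun n => by
    refine ne_top_of_le_ne_top (b := ∫⁻ a, 1 ∂(statLaw d)) (by simp) (lintegral_mono fun a => ?_)
    exact pow_le_one₀ zero_le (s1 n a)
  -- Testing the form on two consecutive survival functions gives a linear recursion for the squared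
  -- norms, which contracts by `λ/(2-λ) < 1`.
  have step : ∀ n, 2 * x (n + 1) ≤ lam d h * (x (n + 1) + x n) := by
    intro n
    have h1 := lintegral_mul_pou_le hd h (ms (n + 1)) (ms n)
      (fun a ha => by simp [hs, noSurv_of_lt ha]) (fun a ha => by simp [hs, noSurv_of_lt ha])
    have h2 : ∫⁻ a, s (n + 1) a ^ 2 ∂(statLaw d) ≤
        d * ∫⁻ a, s (n + 1) a * pou d (s n) a ∂(statLaw d) := by
      have := ms n
      have := ms (n + 1)
      rw [← lintegral_const_mul _ (by fun_prop)]
      refine lintegral_mono fun a => ?_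
      calc s (n + 1) a ^ 2 = s (n + 1) a * s (n + 1) a := sq _
        _ ≤ s (n + 1) a * (d * pou d (s n) a) := by
          gcongr; exact one_sub_noSurv_succ_le hd h n a
        _ = _ := by ring
    have h3 := (mul_le_mul_right h2 2).trans h1
    have h4 := ENNReal.toReal_mono (by
      exact ENNReal.mul_ne_top (by simp) (ENNReal.add_ne_top.2 ⟨fin _, fin _⟩)) h3
    rw [ENNReal.toReal_mul, ENNReal.toReal_mul, ENNReal.toReal_ofReal (lam_nonneg d h),
      ENNReal.toReal_add (fin _) (fin _)] at h4
    simpa using h4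
  have x0 : ∀ n, 0 ≤ x n := fun n => ENNReal.toReal_nonneg
  set l := lam d h with hl'
  have l0 : 0 ≤ l := lam_nonneg d h
  set r := l / (2 - l) with hr
  have r0 : 0 ≤ r := div_nonneg l0 (by linarith)
  have r1 : r < 1 := by rw [hr, div_lt_one (by linarith)]; linarith
  have step2 : ∀ n, x (n + 1) ≤ r * x n := by
    intro n
    rw [hr, div_mul_eq_mul_div, le_div_iff₀ (by linarith)]
    linarith [step n]
  have geo : ∀ n, x n ≤ r ^ n * x 0 := by
    intro n
    induction n with
    | zero => simp
    | succ n ih =>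
      calc x (n + 1) ≤ r * x n := step2 n
        _ ≤ r * (r ^ n * x 0) := by gcongr
        _ = _ := by ring
  have xlim : Filter.Tendsto x Filter.atTop (nhds 0) := by
    refine squeeze_zero x0 geo ?_
    simpa using (tendsto_pow_atTop_nhds_zero_of_lt_one r0 r1).mul_const (x 0)
  have ylim : Filter.Tendsto (fun n => ∫⁻ a, s n a ^ 2 ∂(statLaw d)) Filter.atTop (nhds 0) := by
    exact (ENNReal.tendsto_toReal_iff fin (by simp)).1 (by simpa using xlim)
  rw [ENNReal.tendsto_nhds_zero] at ylim ⊢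
  intro ε hε
  rcases eq_or_ne ε ∞ with rfl | hεt
  · simp
  obtain ⟨δ, hδ, rfl⟩ : ∃ δ : ℝ, 0 < δ ∧ ε = ENNReal.ofReal δ :=
    ⟨ε.toReal, ENNReal.toReal_pos hε.ne' hεt, (ENNReal.ofReal_toReal hεt).symm⟩
  filter_upwards [ylim (ENNReal.ofReal (δ ^ 2)) (by simpa using by positivity)] with n hn
  -- `L²` decay gives `L¹` decay, since `ν` is a probability: AM–GM against the constant `1` with
  -- weight `δ`.
  have h1 : 2 * ∫⁻ a, s n a ∂(statLaw d) ≤ 2 * ENNReal.ofReal δ :=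
    calc 2 * ∫⁻ a, s n a ∂(statLaw d) = ∫⁻ a, 2 * (1 * s n a) ∂(statLaw d) := by
          rw [← lintegral_const_mul _ (ms n)]; simp
      _ ≤ ∫⁻ a, (ENNReal.ofReal δ * 1 ^ 2 + ENNReal.ofReal δ⁻¹ * s n a ^ 2) ∂(statLaw d) :=
          lintegral_mono fun a => two_mul_le_add_sq_ofReal hδ 1 (s n a)
      _ = ENNReal.ofReal δ + ENNReal.ofReal δ⁻¹ * ∫⁻ a, s n a ^ 2 ∂(statLaw d) := by
          have := ms n
          rw [lintegral_add_left (by fun_prop),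
            lintegral_const_mul (ENNReal.ofReal δ⁻¹) (by fun_prop)]
          simp
      _ ≤ ENNReal.ofReal δ + ENNReal.ofReal δ⁻¹ * ENNReal.ofReal (δ ^ 2) := by gcongr
      _ = 2 * ENNReal.ofReal δ := by
          rw [← ENNReal.ofReal_mul (by positivity), two_mul]
          congr 2
          field_simp
  rwa [ENNReal.mul_le_mul_iff_right (by simp) (by simp)] at h1

end Recursion

/-! ### The supercritical regime -/

section Supercritical

variable {d : ℕ}

/-- The restriction of `L` to a set, on nonnegative functions. -/
def cutL (d : ℕ) (J : Set ℝ) (u : ℝ → ℝ≥0∞) : ℝ → ℝ≥0∞ := J.indicator fun a => d * pou d u a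

theorem measurable_cutL {J : Set ℝ} (hJ : MeasurableSet J) {u : ℝ → ℝ≥0∞} (hu : Measurable u) :
    Measurable (cutL d J u) :=
  (by fun_prop : Measurable fun a => (d : ℝ≥0∞) * pou d u a).indicator hJ

theorem measurable_cutL_iterate {J : Set ℝ} (hJ : MeasurableSet J) {u : ℝ → ℝ≥0∞}
    (hu : Measurable u) : ∀ n, Measurable ((cutL d J)^[n] u)
  | 0 => hu
  | n + 1 => by
    rw [Function.iterate_succ_apply']
    exact measurable_cutL hJ (measurable_cutL_iterate hJ hu n)

theorem cutL_mono {J : Set ℝ} {u w : ℝ → ℝ≥0∞} (h : ∀ x, u x ≤ w x) (a : ℝ) :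
    cutL d J u a ≤ cutL d J w a :=
  Set.indicator_le_indicator (mul_le_mul_right (pou_mono d h a) _)

theorem cutL_iterate_mono {J : Set ℝ} {u w : ℝ → ℝ≥0∞} (h : ∀ x, u x ≤ w x) :
    ∀ n a, (cutL d J)^[n] u a ≤ (cutL d J)^[n] w a
  | 0, a => h a
  | n + 1, a => by
    rw [Function.iterate_succ_apply', Function.iterate_succ_apply']
    exact cutL_mono (cutL_iterate_mono h n) a

theorem cutL_const_mul {J : Set ℝ} (c : ℝ≥0∞) {u : ℝ → ℝ≥0∞} (hu : Measurable u) :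
    cutL d J (fun x => c * u x) = fun x => c * cutL d J u x := by
  ext a
  by_cases ha : a ∈ J
  · simp only [cutL, Set.indicator_of_mem ha, pou_const_mul c hu]; ring
  · simp [cutL, Set.indicator_of_notMem ha]

theorem cutL_iterate_const_mul {J : Set ℝ} (hJ : MeasurableSet J) (c : ℝ≥0∞) {u : ℝ → ℝ≥0∞}
    (hu : Measurable u) : ∀ n, (cutL d J)^[n] (fun x => c * u x) = fun x => c * (cutL d J)^[n] u x
  | 0 => rfl
  | n + 1 => by
    simp_rw [Function.iterate_succ_apply']
    rw [cutL_iterate_const_mul hJ c hu n, cutL_const_mul c (measurable_cutL_iterate hJ hu n)]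

theorem cutL_of_notMem {J : Set ℝ} {a : ℝ} (ha : a ∉ J) (u : ℝ → ℝ≥0∞) : cutL d J u a = 0 :=
  Set.indicator_of_notMem ha _

theorem lintegral_mul_cutL {J : Set ℝ} {u w : ℝ → ℝ≥0∞} (hu : Measurable u) (hw : Measurable w)
    (hu0 : ∀ x ∉ J, u x = 0) :
    ∫⁻ a, u a * cutL d J w a ∂(statLaw d) = d * ∫⁻ a, u a * pou d w a ∂(statLaw d) := by
  rw [← lintegral_const_mul _ (by fun_prop)]
  refine lintegral_congr fun a => ?_
  by_cases ha : a ∈ J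
  · simp only [cutL, Set.indicator_of_mem ha]; ring
  · simp [hu0 a ha]

theorem lintegral_mul_cutL_comm {J : Set ℝ} {u w : ℝ → ℝ≥0∞} (hu : Measurable u)
    (hw : Measurable w) (hu0 : ∀ x ∉ J, u x = 0) (hw0 : ∀ x ∉ J, w x = 0) :
    ∫⁻ a, u a * cutL d J w a ∂(statLaw d) = ∫⁻ a, w a * cutL d J u a ∂(statLaw d) := by
  rw [lintegral_mul_cutL hu hw hu0, lintegral_mul_cutL hw hu hw0, lintegral_mul_pou_comm hu hw]

theorem cutL_iterate_eq_zero {J : Set ℝ} {u : ℝ → ℝ≥0∞} (hu0 : ∀ x ∉ J, u x = 0) :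
    ∀ n, ∀ x ∉ J, (cutL d J)^[n] u x = 0
  | 0 => hu0
  | n + 1 => fun x hx => by rw [Function.iterate_succ_apply', cutL_of_notMem hx]

theorem lintegral_mul_cutL_iterate_comm {J : Set ℝ} (hJ : MeasurableSet J) :
    ∀ (n : ℕ) {u w : ℝ → ℝ≥0∞}, Measurable u → Measurable w →
      (∀ x ∉ J, u x = 0) → (∀ x ∉ J, w x = 0) →
    ∫⁻ a, (cutL d J)^[n] u a * w a ∂(statLaw d) = ∫⁻ a, u a * (cutL d J)^[n] w a ∂(statLaw d)
  | 0, _, _, _, _, _, _ => rfl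
  | n + 1, u, w, hu, hw, hu0, hw0 => by
    rw [Function.iterate_succ_apply, lintegral_mul_cutL_iterate_comm hJ n (measurable_cutL hJ hu)
      hw (fun x hx => cutL_of_notMem hx u) hw0, Function.iterate_succ_apply',
      lintegral_mul_cutL_comm hu (measurable_cutL_iterate hJ hw n) hu0
        (cutL_iterate_eq_zero hw0 n)]
    simp_rw [mul_comm]

theorem cutL_iterate_le (hd : 2 ≤ d) {J : Set ℝ} {u : ℝ → ℝ≥0∞} {B : ℝ≥0∞} (hu : ∀ x, u x ≤ B) :
    ∀ n a, (cutL d J)^[n] u a ≤ d ^ n * B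
  | 0, a => by simpa using hu a
  | n + 1, a => by
    rw [Function.iterate_succ_apply']
    refine (Set.indicator_le_self' (fun _ _ => zero_le) a).trans ?_
    calc d * pou d ((cutL d J)^[n] u) a ≤ d * pou d (fun _ => d ^ n * B * 1) a := by
          gcongr
          exact pou_mono d (fun x => by simpa using cutL_iterate_le hd hu n x) a
      _ = d ^ (n + 1) * B := by
          rw [pou_const_mul _ measurable_const, pou_one hd]; ring

/-- If `λ_h > 1` then the compression of `L` to some interval `[h, n]` has norm larger than `1`. -/
theorem exists_large_form (hd : 2 ≤ d) {h ρ : ℝ} (hρ0 : 0 ≤ ρ) (hρ : ρ < lam d h) :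
    ∃ (n : ℕ) (f g : ℝ → ℝ≥0∞), h < n ∧ Measurable f ∧ Measurable g ∧
      (∀ x, f x ≤ n) ∧ (∀ x, g x ≤ n) ∧
      (∀ x ∉ Set.Icc h n, f x = 0) ∧ (∀ x ∉ Set.Icc h n, g x = 0) ∧
      ENNReal.ofReal ρ * (∫⁻ a, f a ^ 2 ∂(statLaw d) + ∫⁻ a, g a ^ 2 ∂(statLaw d)) <
        2 * (d * ∫⁻ a, f a * pou d g a ∂(statLaw d)) := by
  by_contra! hcon
  obtain ⟨n₀, hn₀⟩ := exists_nat_gt h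
  refine absurd (lam_le_of_form_le hd h hρ0 fun f g hf hg hf0 hg0 => ?_) (not_le.2 hρ)
  -- Truncation in both argument and value. The offset `n₀ > h` makes every interval `[h, n + n₀]`
  -- nondegenerate.
  set tr : (ℝ → ℝ≥0∞) → ℕ → ℝ → ℝ≥0∞ := fun u n =>
    (Set.Iic ((n + n₀ : ℕ) : ℝ)).indicator fun x => min (u x) (n + n₀ : ℕ) with htr
  have mtr : ∀ u, Measurable u → ∀ n, Measurable (tr u n) := fun u hu n =>
    (hu.min measurable_const).indicator measurableSet_Iic
  have trmono : ∀ u, Monotone (tr u) := by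
    intro u i j hij x
    simp only [htr, Set.indicator_apply, Set.mem_Iic]
    have h1 : ((i + n₀ : ℕ) : ℝ) ≤ ((j + n₀ : ℕ) : ℝ) := by exact_mod_cast by omega
    have h2 : ((i + n₀ : ℕ) : ℝ≥0∞) ≤ ((j + n₀ : ℕ) : ℝ≥0∞) := by exact_mod_cast by omega
    split_ifs with h3 h4
    · exact min_le_min_left _ h2
    · exact absurd (h3.trans h1) h4
    · exact zero_le
    · exact le_rfl
  have trle : ∀ u n x, tr u n x ≤ u x := fun u n x => by
    simp only [htr, Set.indicator_apply]
    split_ifs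
    · exact min_le_left _ _
    · exact zero_le
  have trsup : ∀ u x, ⨆ n, tr u n x = u x := by
    intro u x
    refine le_antisymm (iSup_le fun n => trle u n x) ?_
    conv_lhs => rw [← iSup_min_natCast (u x)]
    refine iSup_le fun k => ?_
    obtain ⟨m, hm⟩ := exists_nat_ge x
    refine le_iSup_of_le (max m k) ?_
    have h1 : x ≤ ((max m k + n₀ : ℕ) : ℝ) :=
      hm.trans (by exact_mod_cast (le_max_left m k).trans (Nat.le_add_right _ _))
    simp only [htr, Set.indicator_apply, Set.mem_Iic, h1, if_true]
    refine min_le_min_left _ ?_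
    exact_mod_cast (le_max_right m k).trans (Nat.le_add_right _ _)
  have e := lintegral_mul_pou_iSup d (mtr f hf) (mtr g hg) (trmono f) (trmono g)
  simp only [trsup] at e
  rw [e, ENNReal.mul_iSup, ENNReal.mul_iSup]
  refine iSup_le fun n => ?_
  have supp : ∀ u : ℝ → ℝ≥0∞, (∀ x < h, u x = 0) → ∀ x ∉ Set.Icc h ((n + n₀ : ℕ) : ℝ),
      tr u n x = 0 := by
    intro u hu x hx
    by_cases h1 : h ≤ x
    · simp only [htr, Set.indicator_apply, Set.mem_Iic]
      rw [if_neg fun h2 => hx ⟨h1, h2⟩]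
    · exact le_antisymm ((trle u n x).trans (hu x (not_le.1 h1)).le) zero_le
  have bd : ∀ (u : ℝ → ℝ≥0∞) x, tr u n x ≤ (n + n₀ : ℕ) := fun u x => by
    simp only [htr, Set.indicator_apply]
    split_ifs
    · exact min_le_right _ _
    · exact zero_le
  refine (hcon (n + n₀) (tr f n) (tr g n) ?_ (mtr f hf n) (mtr g hg n) (bd f) (bd g)
    (supp f hf0) (supp g hg0)).trans ?_
  · exact hn₀.trans_le (by exact_mod_cast Nat.le_add_left _ _)
  · gcongr with a a
    · exact trle f n a
    · exact trle g n a

/-- A continuous positive kernel is bounded below on a compact square. This is the reason for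
compressing to a bounded interval. -/
theorem exists_pos_le_kern (hd : 2 ≤ d) (l r : ℝ) :
    ∃ κ : ℝ≥0∞, κ ≠ 0 ∧ ∀ a ∈ Set.Icc l r, ∀ b ∈ Set.Icc l r, κ ≤ kern d a b := by
  rcases (Set.Icc l r).eq_empty_or_nonempty with he | hne
  · exact ⟨1, one_ne_zero, fun a ha => by simp [he] at ha⟩
  · obtain ⟨p, hp, hmin⟩ := (isCompact_Icc.prod isCompact_Icc).exists_isMinOn (hne.prod hne)
      (continuous_mehler (d := d)).continuousOn
    refine ⟨ENNReal.ofReal (mehler d p.1 p.2), ?_, fun a ha b hb =>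
      ENNReal.ofReal_le_ofReal (hmin (Set.mk_mem_prod ha hb))⟩
    simpa using mehler_pos hd _ _

/-- Exponential growth of the iterates of a compression of `L`. -/
theorem exists_growth (hd : 2 ≤ d) {h ρ : ℝ} (hρ1 : 1 < ρ) (hρ : ρ < lam d h) :
    ∃ n : ℕ, h < n ∧ ∃ c : ℝ, 0 < c ∧ ∀ m : ℕ, ENNReal.ofReal (c * (ρ ^ 2) ^ m) ≤
      ∫⁻ a in Set.Icc h n, (cutL d (Set.Icc h n))^[2 * (m + 1)] ((Set.Icc h n).indicator 1) a
        ∂(statLaw d) := by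
  obtain ⟨n, f, g, hn, hf, hg, hfn, hgn, hf0, hg0, hlt⟩ := exists_large_form hd (by linarith) hρ
  refine ⟨n, hn, ?_⟩
  set J := Set.Icc h (n : ℝ) with hJ
  have mJ : MeasurableSet J := measurableSet_Icc
  set K := cutL d J with hK
  have mK : ∀ m, Measurable (K^[m] g) := measurable_cutL_iterate mJ hg
  have K0 : ∀ m, ∀ x ∉ J, K^[m] g x = 0 := cutL_iterate_eq_zero hg0
  have finsq : ∀ u : ℝ → ℝ≥0∞, ∀ B : ℝ≥0∞, B ≠ ∞ → (∀ x, u x ≤ B) →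
      ∫⁻ a, u a ^ 2 ∂(statLaw d) ≠ ∞ := by
    intro u B hB hu
    refine ne_top_of_le_ne_top (b := ∫⁻ a, B ^ 2 ∂(statLaw d)) ?_ (lintegral_mono fun a => ?_)
    · rw [lintegral_const, measure_univ, mul_one]
      exact ENNReal.pow_ne_top hB
    · exact pow_le_pow_left' (hu a) 2
  have fin : ∀ m, ∫⁻ a, K^[m] g a ^ 2 ∂(statLaw d) ≠ ∞ := fun m =>
    finsq _ (d ^ m * n) (by simp [ENNReal.mul_eq_top]) (cutL_iterate_le hd hgn m)
  set X : ℕ → ℝ := fun m => (∫⁻ a, K^[m] g a ^ 2 ∂(statLaw d)).toReal with hX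
  have X0 : ∀ m, 0 ≤ X m := fun m => ENNReal.toReal_nonneg
  have ofX : ∀ m, ENNReal.ofReal (X m) = ∫⁻ a, K^[m] g a ^ 2 ∂(statLaw d) := fun m =>
    ENNReal.ofReal_toReal (fin m)
  have hρ0 : 0 < ρ := by linarith
  have amgm : ∀ {u w : ℝ → ℝ≥0∞}, Measurable u → Measurable w → ∀ {δ : ℝ}, 0 < δ →
      2 * ∫⁻ a, u a * w a ∂(statLaw d) ≤ ENNReal.ofReal δ * ∫⁻ a, u a ^ 2 ∂(statLaw d) +
        ENNReal.ofReal δ⁻¹ * ∫⁻ a, w a ^ 2 ∂(statLaw d) := by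
    intro u w hu hw δ hδ
    rw [← lintegral_const_mul _ (by fun_prop), ← lintegral_const_mul _ (by fun_prop),
      ← lintegral_const_mul _ (by fun_prop), ← lintegral_add_left (by fun_prop)]
    exact lintegral_mono fun a => two_mul_le_add_sq_ofReal hδ _ _
  -- AM–GM with weight `ρ` gives `2⟨f, Kg⟩ ≤ ρ‖f‖² + ρ⁻¹‖Kg‖²`; the finite term `ρ‖f‖²` cancels
  -- against the lower bound.
  have first : ρ ^ 2 * X 0 < X 1 := by
    rw [← lintegral_mul_cutL hf hg hf0] at hlt
    have h1 := hlt.trans_le (amgm hf (mK 1) hρ0)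
    rw [mul_add, ENNReal.add_lt_add_iff_left
      (ENNReal.mul_ne_top (by simp) (finsq f n (by simp) hfn))] at h1
    change _ * ∫⁻ a, K^[0] g a ^ 2 ∂(statLaw d) < _ at h1
    rw [← ofX, ← ofX, ← ENNReal.ofReal_mul hρ0.le, ← ENNReal.ofReal_mul (by positivity)] at h1
    have h2 := (ENNReal.ofReal_lt_ofReal_iff_of_nonneg (mul_nonneg hρ0.le (X0 0))).1 h1
    field_simp at h2
    linarith
  -- Self-adjointness gives `‖K^{m+1} g‖² = ⟨K^m g, K^{m+2} g⟩`, and AM–GM with weight `ρ²` bounds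
  -- it. This form of log-convexity propagates the first ratio to all later ones.
  have conv : ∀ m, 2 * X (m + 1) ≤ ρ ^ 2 * X m + (ρ ^ 2)⁻¹ * X (m + 2) := by
    intro m
    have e : ∫⁻ a, K^[m] g a * K^[m + 2] g a ∂(statLaw d) =
        ∫⁻ a, K^[m + 1] g a ^ 2 ∂(statLaw d) := by
      rw [Function.iterate_succ_apply' K (m + 1), hK,
        lintegral_mul_cutL_comm (mK m) (mK (m + 1)) (K0 m) (K0 (m + 1))]
      refine lintegral_congr fun a => ?_
      rw [Function.iterate_succ_apply', sq]
    have h1 := amgm (mK m) (mK (m + 2)) (δ := ρ ^ 2) (by positivity)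
    rw [e, ← ofX, ← ofX, ← ofX, ← ENNReal.ofReal_mul (by positivity),
      ← ENNReal.ofReal_mul (by positivity), two_mul,
      ← ENNReal.ofReal_add (X0 _) (X0 _),
      ← ENNReal.ofReal_add (mul_nonneg (by positivity) (X0 _))
        (mul_nonneg (by positivity) (X0 _))] at h1
    have h2 := (ENNReal.ofReal_le_ofReal_iff (add_nonneg (mul_nonneg (by positivity) (X0 _))
      (mul_nonneg (by positivity) (X0 _)))).1 h1
    linarith
  have ratio : ∀ m, ρ ^ 2 * X m ≤ X (m + 1) := by
    intro m
    induction m with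
    | zero => exact first.le
    | succ m ih =>
      have h1 := conv m
      have h2 : X (m + 1) ≤ (ρ ^ 2)⁻¹ * X (m + 2) := by linarith
      rwa [inv_mul_eq_div, le_div_iff₀ (by positivity), mul_comm] at h2
  have X1 : 0 < X 1 := lt_of_le_of_lt (mul_nonneg (by positivity) (X0 0)) first
  have grow : ∀ m, (ρ ^ 2) ^ m * X 1 ≤ X (m + 1) := by
    intro m
    induction m with
    | zero => simp
    | succ m ih =>
      calc (ρ ^ 2) ^ (m + 1) * X 1 = ρ ^ 2 * ((ρ ^ 2) ^ m * X 1) := by ring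
        _ ≤ ρ ^ 2 * X (m + 1) := by gcongr
        _ ≤ _ := ratio _
  have hn0 : (n : ℝ≥0∞) ≠ 0 := by
    intro h0
    have hz : ∀ x, g x = 0 := fun x => le_antisymm ((hgn x).trans h0.le) zero_le
    have : X 1 = 0 := by
      simp only [hX, Function.iterate_one, hK, cutL, pou, hz]
      simp
    linarith
  have hn0' : (0 : ℝ) < n := by
    have : n ≠ 0 := by exact_mod_cast hn0
    positivity
  have mone : Measurable (J.indicator (1 : ℝ → ℝ≥0∞)) := measurable_one.indicator mJ
  have one0 : ∀ x ∉ J, J.indicator (1 : ℝ → ℝ≥0∞) x = 0 := fun x hx =>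
    Set.indicator_of_notMem hx _
  have gle : ∀ x, g x ≤ n * J.indicator 1 x := by
    intro x
    by_cases hx : x ∈ J
    · simpa [Set.indicator_of_mem hx] using hgn x
    · simp [hg0 x hx]
  refine ⟨X 1 / n ^ 2, by positivity, fun m => ?_⟩
  -- By self-adjointness `‖K^m g‖² = ⟨g, K^{2m} g⟩`, and `g ≤ n 1_J` on both sides replaces `g` by
  -- the indicator at the cost of `n²`.
  have key : ∀ m, ∫⁻ a, K^[m] g a ^ 2 ∂(statLaw d) ≤
      n ^ 2 * ∫⁻ a in J, K^[2 * m] (J.indicator 1) a ∂(statLaw d) := by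
    intro m
    calc _ = ∫⁻ a, K^[m] g a * K^[m] g a ∂(statLaw d) := by simp_rw [sq]
      _ = ∫⁻ a, g a * K^[2 * m] g a ∂(statLaw d) := by
          rw [hK, lintegral_mul_cutL_iterate_comm mJ m hg (mK m) hg0 (K0 m), two_mul]
          simp_rw [Function.iterate_add_apply]
          rfl
      _ ≤ ∫⁻ a, (n * J.indicator 1 a) * (n * K^[2 * m] (J.indicator 1) a) ∂(statLaw d) := by
          refine lintegral_mono fun a => mul_le_mul' (gle a) ?_
          have := cutL_iterate_mono (d := d) (J := J) gle (2 * m) a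
          rwa [cutL_iterate_const_mul mJ _ mone] at this
      _ = ∫⁻ a, n ^ 2 * J.indicator (K^[2 * m] (J.indicator 1)) a ∂(statLaw d) := by
          refine lintegral_congr fun a => ?_
          by_cases ha : a ∈ J
          · simp [Set.indicator_of_mem ha]; ring
          · simp [Set.indicator_of_notMem ha]
      _ = _ := by
          rw [lintegral_const_mul _ ((measurable_cutL_iterate mJ mone _).indicator mJ),
            lintegral_indicator mJ]
  have h2 : ENNReal.ofReal ((ρ ^ 2) ^ m * X 1) ≤
      n ^ 2 * ∫⁻ a in J, K^[2 * (m + 1)] (J.indicator 1) a ∂(statLaw d) :=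
    (ENNReal.ofReal_le_ofReal (grow m)).trans ((ofX (m + 1)).le.trans (key (m + 1)))
  have h3 : ENNReal.ofReal ((ρ ^ 2) ^ m * X 1) =
      n ^ 2 * ENNReal.ofReal (X 1 / n ^ 2 * (ρ ^ 2) ^ m) := by
    rw [← ENNReal.ofReal_natCast, ← ENNReal.ofReal_pow (by positivity),
      ← ENNReal.ofReal_mul (by positivity)]
    congr 1
    field_simp
  rw [h3] at h2
  exact (ENNReal.mul_le_mul_iff_right (pow_ne_zero 2 hn0) (by simp)).1 h2

end Supercritical

/-! ### Subeigenfunctions and lower bounds on survival -/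

section Subeigenfunction

variable {d : ℕ}

theorem cutL_sum {J : Set ℝ} {ι : Type*} (s : Finset ι) (u : ι → ℝ → ℝ≥0∞)
    (hu : ∀ i, Measurable (u i)) (a : ℝ) :
    cutL d J (fun x => ∑ i ∈ s, u i x) a = ∑ i ∈ s, cutL d J (u i) a := by
  by_cases ha : a ∈ J
  · simp only [cutL, Set.indicator_of_mem ha, pou, Finset.mul_sum]
    rw [lintegral_finsetSum s fun i _ => by have := hu i; fun_prop, Finset.mul_sum]
  · simp [cutL, Set.indicator_of_notMem ha]

/-- If `λ_h > 1`, there is a nonzero bounded function on `[h, ∞)` which `L_h` increases by a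
factor larger than `1`. -/
theorem exists_subeigenfunction (hd : 2 ≤ d) {h : ℝ} (hl : 1 < lam d h) :
    ∃ (ψ : ℝ → ℝ≥0∞) (B : ℝ) (μ : ℝ), Measurable ψ ∧ 0 < B ∧ 1 < μ ∧
      (∀ x, ψ x ≤ ENNReal.ofReal B) ∧ (∀ x < h, ψ x = 0) ∧ ¬ (ψ =ᵐ[statLaw d] 0) ∧
      ∀ a, ENNReal.ofReal μ * ψ a ≤ d * pou d ψ a := by
  obtain ⟨ρ, hρ1, hρ⟩ := exists_between hl
  obtain ⟨n, hn, c, hc, hgrow⟩ := exists_growth hd hρ1 hρ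
  obtain ⟨κ, hκ0, hκ⟩ := exists_pos_le_kern hd h n
  set J := Set.Icc h (n : ℝ) with hJ
  have mJ : MeasurableSet J := measurableSet_Icc
  set K := cutL d J with hK
  set e : ℝ → ℝ≥0∞ := J.indicator 1 with he
  have me : Measurable e := measurable_one.indicator mJ
  have e0 : ∀ x ∉ J, e x = 0 := fun x hx => Set.indicator_of_notMem hx _
  have e1 : ∀ x, e x ≤ 1 := fun x => Set.indicator_apply_le fun _ => le_rfl
  have mK : ∀ m, Measurable (K^[m] e) := measurable_cutL_iterate mJ me
  -- One more application of `K` turns growth of integrals into a uniform pointwise bound on `J`,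
  -- through the lower bound `κ` of the kernel.
  have low : ∀ m, ∀ a ∈ J, d * κ * ENNReal.ofReal (c * (ρ ^ 2) ^ m) ≤
      K^[2 * (m + 1) + 1] e a := by
    intro m a ha
    rw [Function.iterate_succ_apply', hK, cutL, Set.indicator_of_mem ha, mul_assoc]
    gcongr
    calc κ * ENNReal.ofReal (c * (ρ ^ 2) ^ m)
        ≤ κ * ∫⁻ b in J, K^[2 * (m + 1)] e b ∂(statLaw d) := by gcongr; exact hgrow m
      _ = ∫⁻ b in J, κ * K^[2 * (m + 1)] e b ∂(statLaw d) := by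
          rw [lintegral_const_mul _ (mK _)]
      _ ≤ ∫⁻ b in J, kern d a b * K^[2 * (m + 1)] e b ∂(statLaw d) := by
          refine setLIntegral_mono' mJ fun b hb => ?_
          gcongr
          exact hκ a ha b hb
      _ ≤ pou d (K^[2 * (m + 1)] e) a := setLIntegral_le_lintegral _ _
  obtain ⟨m, hm⟩ : ∃ m : ℕ, 2 ≤ d * κ * ENNReal.ofReal (c * (ρ ^ 2) ^ m) := by
    rcases eq_or_ne κ ∞ with rfl | hκt
    · refine ⟨0, ?_⟩
      have h1 : (d : ℝ≥0∞) ≠ 0 := by exact_mod_cast (by omega : d ≠ 0)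
      rw [ENNReal.mul_top h1, ENNReal.top_mul (by simpa using hc)]
      exact le_top
    · set k := ((d : ℝ≥0∞) * κ).toReal with hk
      have hk0 : 0 < k := ENNReal.toReal_pos
        (mul_ne_zero (by exact_mod_cast (by omega : d ≠ 0)) hκ0)
        (ENNReal.mul_ne_top (by simp) hκt)
      obtain ⟨m, hm⟩ := pow_unbounded_of_one_lt (2 / (k * c)) (by nlinarith : 1 < ρ ^ 2)
      refine ⟨m, ?_⟩
      rw [← ENNReal.ofReal_toReal (a := (d : ℝ≥0∞) * κ) (ENNReal.mul_ne_top (by simp) hκt), ← hk,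
        ← ENNReal.ofReal_mul hk0.le, ← ENNReal.ofReal_ofNat 2]
      refine ENNReal.ofReal_le_ofReal ?_
      rw [div_lt_iff₀ (by positivity)] at hm
      linarith
  set N := 2 * (m + 1) + 1 with hN
  have hKN : ∀ a, 2 * e a ≤ K^[N] e a := by
    intro a
    by_cases ha : a ∈ J
    · have : e a = 1 := Set.indicator_of_mem ha _
      rw [this, mul_one]
      exact hm.trans (low m a ha)
    · simp [e0 a ha]
  have hN0 : N ≠ 0 := by omega
  -- The doubling `K^N e ≥ 2e` over `N` steps is spread evenly, a factor `2^{1/N}` per step.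
  set μ : ℝ := (2 : ℝ) ^ ((N : ℝ)⁻¹) with hμ
  have hμ1 : 1 < μ := Real.one_lt_rpow (by norm_num) (by positivity)
  have hμ0 : 0 < μ := by linarith
  have hμN : μ ^ N = 2 := Real.rpow_inv_natCast_pow (by norm_num) hN0
  set r : ℝ≥0∞ := ENNReal.ofReal μ⁻¹ with hr
  have hrN : r ^ N = 2⁻¹ := by
    rw [hr, ← ENNReal.ofReal_pow (by positivity), inv_pow, hμN,
      ENNReal.ofReal_inv_of_pos (by norm_num), ENNReal.ofReal_ofNat]
  have hμr : ENNReal.ofReal μ * r = 1 := by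
    rw [hr, ← ENNReal.ofReal_mul hμ0.le, mul_inv_cancel₀ hμ0.ne', ENNReal.ofReal_one]
  -- With `r = μ⁻¹`, this truncated Neumann series telescopes: `r Kψ = ψ - e + r^N K^N e ≥ ψ`,
  -- because `r^N = 1/2`.
  set ψ : ℝ → ℝ≥0∞ := fun x => ∑ j ∈ Finset.range N, r ^ j * K^[j] e x with hψ
  have mψ : Measurable ψ := Finset.measurable_fun_sum _ fun j _ => (mK j).const_mul _
  have hsum : ∀ a, r * K ψ a + e a = ψ a + r ^ N * K^[N] e a := by
    intro a
    have h1 : r * K ψ a = ∑ j ∈ Finset.range N, r ^ (j + 1) * K^[j + 1] e a := by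
      rw [hK, hψ, cutL_sum _ _ (fun j => (mK j).const_mul _), Finset.mul_sum]
      refine Finset.sum_congr rfl fun j _ => ?_
      rw [cutL_const_mul _ (mK j), Function.iterate_succ_apply', pow_succ']
      ring
    have h2 := Finset.sum_range_succ' (fun j => r ^ j * K^[j] e a) N
    rw [Finset.sum_range_succ] at h2
    rw [h1, hψ]
    simpa using h2.symm
  have hle : ∀ a, ψ a ≤ r * K ψ a := by
    intro a
    have h1 : ψ a + e a ≤ r * K ψ a + e a := by
      rw [hsum]
      gcongr
      calc e a = 2⁻¹ * (2 * e a) := by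
            rw [← mul_assoc, ENNReal.inv_mul_cancel (by simp) (by simp), one_mul]
        _ ≤ _ := by rw [hrN]; gcongr; exact hKN a
    exact (ENNReal.add_le_add_iff_right (ne_top_of_le_ne_top (by simp) (e1 a))).1 h1
  obtain ⟨B, hB⟩ : ∃ B : ℝ≥0, ∀ x, ψ x ≤ B := by
    have hT : ∑ j ∈ Finset.range N, r ^ j * ((d : ℝ≥0∞) ^ j * 1) ≠ ∞ := by
      refine ENNReal.sum_ne_top.2 fun j _ => ?_
      exact ENNReal.mul_ne_top (ENNReal.pow_ne_top ENNReal.ofReal_ne_top)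
        (ENNReal.mul_ne_top (ENNReal.pow_ne_top (by simp)) (by simp))
    refine ⟨(∑ j ∈ Finset.range N, r ^ j * ((d : ℝ≥0∞) ^ j * 1)).toNNReal, fun x => ?_⟩
    rw [ENNReal.coe_toNNReal hT]
    exact Finset.sum_le_sum fun j _ => mul_le_mul_right (cutL_iterate_le hd e1 j x) _
  have eψ : ∀ x, e x ≤ ψ x := fun x => by
    have : r ^ 0 * K^[0] e x ≤ ψ x := Finset.single_le_sum
      (f := fun j => r ^ j * K^[j] e x) (fun _ _ => zero_le) (Finset.mem_range.2 (by omega))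
    simpa using this
  refine ⟨ψ, B + 1, μ, mψ, by positivity, hμ1, fun x => (hB x).trans ?_, fun x hx => ?_, ?_, ?_⟩
  · rw [← ENNReal.ofReal_coe_nnreal]
    exact ENNReal.ofReal_le_ofReal (by simp)
  · refine Finset.sum_eq_zero fun j _ => ?_
    rw [hK, cutL_iterate_eq_zero e0 j x (fun hx' => not_lt.2 hx'.1 hx), mul_zero]
  · intro h0
    have h1 : statLaw d J = 0 := by
      refine measure_mono_null (t := {x | ¬ ψ x = (0 : ℝ → ℝ≥0∞) x}) (fun x hx h2 => ?_)
        (ae_iff.1 h0)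
      have := eψ x
      rw [h2, he, Set.indicator_of_mem hx] at this
      simp at this
    have := gaussianReal_absolutelyContinuous' 0 (sigmaSq_ne_zero hd) h1
    rw [hJ, Real.volume_Icc, ENNReal.ofReal_eq_zero] at this
    linarith
  · intro a
    calc ENNReal.ofReal μ * ψ a ≤ ENNReal.ofReal μ * (r * K ψ a) := by gcongr; exact hle a
      _ = K ψ a := by rw [← mul_assoc, hμr, one_mul]
      _ ≤ _ := Set.indicator_le_self' (fun _ _ => zero_le) a

/-- With `y = nz`, Bernoulli gives `(1-z)^n (1+y) ≤ (1-z²)^n ≤ 1`, and `1/(1+y) ≤ 1 - y/μ` exactly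
because `0 ≤ y ≤ μ - 1`. The gain `μ` thus absorbs the nonlinear loss in the recursion. -/
theorem one_sub_pow_le_of_small {n : ℕ} {z w μ : ℝ} (hz0 : 0 ≤ z) (hz1 : z ≤ 1) (hμ : 1 < μ)
    (hzμ : n * z ≤ μ - 1) (hw : μ * w ≤ n * z) : (1 - z) ^ n + w ≤ 1 := by
  have hμ0 : 0 < μ := by linarith
  set y := n * z with hy
  have hy0 : 0 ≤ y := by positivity
  have h1 : (1 - z) ^ n * (1 + y) ≤ 1 := by
    calc (1 - z) ^ n * (1 + y) ≤ (1 - z) ^ n * (1 + z) ^ n := by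
          refine mul_le_mul_of_nonneg_left (one_add_mul_le_pow (by linarith) n)
            (pow_nonneg (by linarith) n)
      _ = (1 - z ^ 2) ^ n := by rw [← mul_pow]; ring
      _ ≤ 1 := pow_le_one₀ (by nlinarith) (by nlinarith)
  have h2 : w ≤ y / μ := by rw [le_div_iff₀ hμ0]; linarith
  have h3 : 1 ≤ (1 - y / μ) * (1 + y) := by
    have : (1 - y / μ) * (1 + y) - 1 = y * (μ - 1 - y) / μ := by field_simp; ring
    have h4 : 0 ≤ y * (μ - 1 - y) / μ := by
      apply div_nonneg (mul_nonneg hy0 (by linarith)) hμ0.le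
    linarith
  have h5 : (1 - z) ^ n ≤ 1 - y / μ := by
    by_contra! hc
    have := mul_lt_mul_of_pos_right hc (by linarith : 0 < 1 + y)
    linarith
  linarith

/-- In the supercritical regime the survival probabilities are bounded below. -/
theorem exists_noSurv_add_le (hd : 2 ≤ d) {h : ℝ} (hl : 1 < lam d h) :
    ∃ u : ℝ → ℝ≥0∞, Measurable u ∧ ¬ (u =ᵐ[statLaw d] 0) ∧
      ∀ n a, noSurv d h n a + u a ≤ 1 := by
  obtain ⟨ψ, B, μ, mψ, hB, hμ, hψB, hψ0, hψne, hψ⟩ := exists_subeigenfunction hd hl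
  have hd0 : (0 : ℝ) < d := by exact_mod_cast (by omega : 0 < d)
  -- The first bound keeps `εψ ≤ 1`; the second keeps `d ε Qψ ≤ μ - 1`, as `one_sub_pow_le_of_small`
  -- requires.
  set ε : ℝ := min B⁻¹ ((μ - 1) / (d * B)) with hε
  have hε0 : 0 < ε := lt_min (by positivity) (div_pos (by linarith) (by positivity))
  have hεB : ε * B ≤ 1 := by
    calc ε * B ≤ B⁻¹ * B := by gcongr; exact min_le_left _ _
      _ = 1 := inv_mul_cancel₀ hB.ne'
  have hεB2 : d * (ε * B) ≤ μ - 1 := by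
    calc d * (ε * B) ≤ d * ((μ - 1) / (d * B) * B) := by gcongr; exact min_le_right _ _
      _ = μ - 1 := by field_simp
  refine ⟨fun x => ENNReal.ofReal ε * ψ x, by fun_prop, fun h0 => hψne ?_, fun n => ?_⟩
  · filter_upwards [h0] with x hx
    simpa [not_le.2 hε0] using hx
  · induction n with
    | zero =>
      intro a
      by_cases ha : a < h
      · simp [noSurv, hψ0 a ha, ha]
      · have : ENNReal.ofReal ε * ψ a ≤ 1 := by
          calc _ ≤ ENNReal.ofReal ε * ENNReal.ofReal B := by gcongr; exact hψB a
            _ = ENNReal.ofReal (ε * B) := (ENNReal.ofReal_mul hε0.le).symm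
            _ ≤ 1 := ENNReal.ofReal_le_one.2 hεB
        simpa [noSurv, ha] using this
    | succ n ih =>
      intro a
      by_cases ha : a < h
      · simp [noSurv_of_lt ha, hψ0 a ha]
      rw [noSurv_succ_of_le (not_lt.1 ha)]
      have hx : pou d (noSurv d h n) a + ENNReal.ofReal ε * pou d ψ a ≤ 1 := by
        rw [← pou_const_mul _ mψ, ← pou_add (by fun_prop)]
        exact pou_le_one hd ih a
      have hyB : pou d ψ a ≤ ENNReal.ofReal B := by
        calc pou d ψ a ≤ pou d (fun _ => ENNReal.ofReal B * 1) a :=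
              pou_mono d (fun x => by simpa using hψB x) a
          _ = ENNReal.ofReal B := by rw [pou_const_mul _ measurable_const, pou_one hd, mul_one]
      have hψa := hψ a
      set x := pou d (noSurv d h n) a
      set y := pou d ψ a
      have hxt : x ≠ ∞ := ne_top_of_le_ne_top (by simp) (le_self_add.trans hx)
      have hyt : y ≠ ∞ := ne_top_of_le_ne_top (by simp) hyB
      have hwt : ψ a ≠ ∞ := ne_top_of_le_ne_top (by simp) (hψB a)
      have r1 : x.toReal + ε * y.toReal ≤ 1 := by
        have := ENNReal.toReal_mono (by simp) hx
        rwa [ENNReal.toReal_add hxt (ENNReal.mul_ne_top (by simp) hyt), ENNReal.toReal_mul,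
          ENNReal.toReal_ofReal hε0.le, ENNReal.toReal_one] at this
      have r2 : μ * (ψ a).toReal ≤ d * y.toReal := by
        have := ENNReal.toReal_mono (ENNReal.mul_ne_top (by simp) hyt) hψa
        rwa [ENNReal.toReal_mul, ENNReal.toReal_mul, ENNReal.toReal_ofReal (by linarith),
          ENNReal.toReal_natCast] at this
      have r3 : y.toReal ≤ B := ENNReal.toReal_le_of_le_ofReal hB.le hyB
      have y0 : 0 ≤ y.toReal := ENNReal.toReal_nonneg
      have x0 : 0 ≤ x.toReal := ENNReal.toReal_nonneg
      have hz : ε * y.toReal ≤ ε * B := by gcongr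
      have main : (1 - ε * y.toReal) ^ d + ε * (ψ a).toReal ≤ 1 := by
        refine one_sub_pow_le_of_small (μ := μ) (by positivity) (hz.trans hεB) hμ ?_ ?_
        · calc _ ≤ d * (ε * B) := by gcongr
            _ ≤ _ := hεB2
        · nlinarith
      have main2 : x.toReal ^ d + ε * (ψ a).toReal ≤ 1 := by
        have : x.toReal ^ d ≤ (1 - ε * y.toReal) ^ d := by gcongr; linarith
        linarith
      change x ^ d + ENNReal.ofReal ε * ψ a ≤ 1
      rw [← ENNReal.ofReal_toReal hxt, ← ENNReal.ofReal_toReal hwt, ← ENNReal.ofReal_pow x0,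
        ← ENNReal.ofReal_mul hε0.le, ← ENNReal.ofReal_add (by positivity) (by positivity)]
      exact ENNReal.ofReal_le_one.2 main2

/-- In the supercritical regime, survival from some vertex of a late generation is likely. -/
theorem exists_lintegral_noSurvBelow_le (hd : 2 ≤ d) {h : ℝ} (hl : 1 < lam d h) {ε : ℝ≥0∞}
    (hε : 0 < ε) : ∃ m, ∀ n, ∫⁻ a, noSurvBelow d h n m a ∂(statLaw d) ≤ ε := by
  obtain ⟨u, mu, hu0, hu⟩ := exists_noSurv_add_le hd hl
  -- The supremum over `n` is an increasing limit: the probability that no descendant at depth `m`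
  -- survives all generations.
  set w : ℕ → ℝ → ℝ≥0∞ := fun m a => ⨆ n, noSurvBelow d h n m a with hw
  have mw : ∀ m, Measurable (w m) := fun m => Measurable.iSup fun n => by fun_prop
  have w1 : ∀ m a, w m a ≤ 1 := fun m a => iSup_le fun n => noSurvBelow_le_one hd h n m a
  have wsucc : ∀ m a, w (m + 1) a = pou d (w m) a ^ d := by
    intro m a
    rw [hw, pou_iSup d (fun n => by fun_prop) (noSurvBelow_mono h m)]
    have hmono : Monotone fun n => pou d (noSurvBelow d h n m) a := fun i j hij =>
      pou_mono d (fun x => noSurvBelow_mono h m hij x) a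
    refine tendsto_nhds_unique (tendsto_atTop_iSup (f := fun n => noSurvBelow d h n (m + 1) a)
      (fun i j hij => noSurvBelow_mono h (m + 1) hij a)) ?_
    exact ((ENNReal.continuous_pow d).tendsto _).comp (tendsto_atTop_iSup hmono)
  -- For `m = 0`: above `h`, a vertex that dies within `n + 1` generations is one whose children all
  -- die within `n`; below `h` the right side is `1`.
  have wanti1 : ∀ m a, w (m + 1) a ≤ w m a := by
    intro m
    induction m with
    | zero =>
      intro a
      refine iSup_le fun n => ?_
      refine le_trans ?_ (le_iSup (fun n => noSurvBelow d h n 0 a) (n + 1))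
      change pou d (noSurv d h n) a ^ d ≤ noSurv d h (n + 1) a
      by_cases ha : a < h
      · rw [noSurv_of_lt ha]
        exact pow_le_one₀ zero_le (pou_le_one hd (noSurv_le_one hd h n) a)
      · rw [noSurv_succ_of_le (not_lt.1 ha)]
    | succ m ih =>
      intro a
      rw [wsucc, wsucc]
      exact pow_le_pow_left' (pou_mono d ih a) d
  have wanti : Antitone w := antitone_nat_of_succ_le fun m a => wanti1 m a
  set W : ℝ → ℝ≥0∞ := fun a => ⨅ m, w m a with hW
  have mW : Measurable W := Measurable.iInf mw
  have W1 : ∀ a, W a ≤ 1 := fun a => (iInf_le _ 0).trans (w1 0 a)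
  have pouW : ∀ a, Filter.Tendsto (fun m => pou d (w m) a) Filter.atTop (nhds (pou d W a)) := by
    intro a
    have : pou d W a = ⨅ m, pou d (w m) a := by
      unfold pou
      rw [← lintegral_iInf (f := fun m b => kern d a b * w m b)
        (fun m => by have := mw m; fun_prop)
        (fun i j hij b => mul_le_mul_right (wanti hij b) _) ?_]
      · refine lintegral_congr fun b => ?_
        rw [hW, ENNReal.mul_iInf_of_ne (by
          simpa [kern] using mehler_pos hd a b) (kern_ne_top a b)]
      · exact ne_top_of_le_ne_top (by simp) (pou_le_one hd (w1 0) a)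
    rw [this]
    exact tendsto_atTop_iInf fun i j hij => pou_mono d (fun x => wanti hij x) a
  have Wle : ∀ a, W a ≤ pou d W a ^ d := by
    intro a
    refine ge_of_tendsto (((ENNReal.continuous_pow d).tendsto _).comp (pouW a))
      (Filter.Eventually.of_forall fun m => ?_)
    exact (iInf_le _ (m + 1)).trans_eq (wsucc m a)
  have p1 : ∀ a, pou d W a ≤ 1 := pou_le_one hd W1
  have Wle2 : ∀ a, W a ≤ pou d W a ^ 2 := fun a =>
    (Wle a).trans (pow_le_pow_right_of_le_one' (p1 a) hd)
  have hint : ∫⁻ a, pou d W a ∂(statLaw d) = ∫⁻ a, W a ∂(statLaw d) := lintegral_pou hd mW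
  have intW : ∫⁻ a, W a ∂(statLaw d) ≠ ∞ := by
    refine ne_top_of_le_ne_top (b := ∫⁻ a, 1 ∂(statLaw d)) (by simp) (lintegral_mono W1)
  -- Stationarity gives `QW` and `W` the same finite integral, so the pointwise inequality `W ≤
  -- (QW)² ≤ QW` must be an equality almost everywhere. The square is available because `d ≥ 2`.
  have Weq : W =ᵐ[statLaw d] pou d W := by
    refine ae_eq_of_ae_le_of_lintegral_le (ae_of_all _ fun a => ?_) intW (by fun_prop) hint.le
    exact (Wle2 a).trans (by rw [sq]; exact mul_le_of_le_one_left' (p1 a))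
  have Wzero : W =ᵐ[statLaw d] 0 := by
    -- A single zero of `QW` kills `W`, the kernel being strictly positive. Without zeros, `QW ≤
    -- (QW)²` forces `W = 1` almost everywhere, contradicting the lower bound `u` on survival.
    by_cases hz : ∃ a, pou d W a = 0
    · obtain ⟨a, ha⟩ := hz
      rw [pou, lintegral_eq_zero_iff (by fun_prop)] at ha
      filter_upwards [ha] with b hb
      have : kern d a b ≠ 0 := by simpa [kern] using mehler_pos hd a b
      simpa [this] using hb
    · push Not at hz
      refine absurd ?_ hu0
      filter_upwards [Weq] with a ha
      have h1 : pou d W a ≤ pou d W a * pou d W a := by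
        rw [← sq]; exact ha.symm.le.trans (Wle2 a)
      have h2 : 1 ≤ pou d W a := by
        have hne : pou d W a ≠ ∞ := ne_top_of_le_ne_top (by simp) (p1 a)
        have h3 : pou d W a * 1 ≤ pou d W a * pou d W a := by rwa [mul_one]
        exact (ENNReal.mul_le_mul_iff_right (hz a) hne).1 h3
      have h4 : 1 ≤ w 0 a := by
        rw [← ha] at h2
        exact h2.trans (iInf_le _ 0)
      have h5 : w 0 a + u a ≤ 1 := by
        rw [hw, ENNReal.iSup_add]
        exact iSup_le fun n => hu n a
      have h6 : 1 + u a ≤ 1 + 0 := by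
        rw [add_zero]
        exact le_trans (by gcongr) h5
      exact le_antisymm ((ENNReal.add_le_add_iff_left (by simp)).1 h6) zero_le
  have lim : Filter.Tendsto (fun m => ∫⁻ a, w m a ∂(statLaw d)) Filter.atTop (nhds 0) := by
    have h0 : ∫⁻ a, W a ∂(statLaw d) = 0 := by
      rw [lintegral_congr_ae Wzero]; simp
    rw [← h0, hW, lintegral_iInf mw wanti]
    · exact tendsto_atTop_iInf fun i j hij => lintegral_mono (wanti hij)
    · exact ne_top_of_le_ne_top (b := ∫⁻ a, 1 ∂(statLaw d)) (by simp) (lintegral_mono (w1 0))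
  obtain ⟨m, hm⟩ := ((ENNReal.tendsto_nhds_zero.1 lim) ε hε).exists
  exact ⟨m, fun n => (lintegral_mono fun a =>
    le_iSup (fun n => noSurvBelow d h n m a) n).trans hm⟩

end Subeigenfunction

/-! ### Rooted regular trees -/

section Tree

variable {V : Type*} {T : SimpleGraph V}

theorem exists_adj_closer (hT : T.Connected) {w z : V} (h : w ≠ z) :
    ∃ z', T.Adj z z' ∧ T.dist w z = T.dist w z' + 1 := by
  obtain ⟨p, hp⟩ := hT.exists_walk_length_eq_dist z w
  cases p with
  | nil => exact absurd rfl h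
  | @cons _ v _ hadj q =>
    refine ⟨v, hadj, ?_⟩
    have h1 : T.dist v w ≤ q.length := SimpleGraph.dist_le q
    have h2 := hT.dist_triangle (u := z) (v := v) (w := w)
    have h3 : T.dist z v = 1 := SimpleGraph.dist_eq_one_iff_adj.2 hadj
    rw [SimpleGraph.Walk.length_cons] at hp
    rw [SimpleGraph.dist_comm, SimpleGraph.dist_comm (u := w)]
    omega

/-- Either neighbour extends a geodesic from `w` to a path ending at `z`. Paths in a tree are
unique, so the penultimate vertices agree. -/
theorem eq_of_adj_closer (hT : T.IsTree) {w z a b : V} (ha : T.Adj z a) (hb : T.Adj z b)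
    (hda : T.dist w z = T.dist w a + 1) (hdb : T.dist w z = T.dist w b + 1) : a = b := by
  have key : ∀ c, T.Adj z c → T.dist w z = T.dist w c + 1 →
      ∃ p : T.Walk w z, p.IsPath ∧ p.penultimate = c := by
    intro c hc hdc
    obtain ⟨q, hq⟩ := hT.connected.exists_walk_length_eq_dist w c
    refine ⟨q.concat hc.symm, SimpleGraph.Walk.isPath_of_length_eq_dist _ ?_, ?_⟩
    · rw [SimpleGraph.Walk.length_concat, hq, hdc]
    · simp
  obtain ⟨p, hp, rfl⟩ := key a ha hda
  obtain ⟨q, hq, rfl⟩ := key b hb hdb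
  rw [(hT.existsUnique_path w z).unique hp hq]

open Classical in
/-- The parent of a vertex in the tree rooted at `r` (the root is its own parent). -/
def par (T : SimpleGraph V) (r y : V) : V :=
  if h : ∃ z, T.Adj y z ∧ T.dist r y = T.dist r z + 1 then h.choose else y

theorem par_spec (hT : T.Connected) {r y : V} (h : y ≠ r) :
    T.Adj y (par T r y) ∧ T.dist r y = T.dist r (par T r y) + 1 := by
  have := exists_adj_closer hT h.symm
  rw [par, dif_pos this]
  exact this.choose_spec

theorem par_root (r : V) : par T r r = r := by
  rw [par, dif_neg]
  rintro ⟨z, -, hz⟩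
  simp at hz

theorem eq_par (hT : T.IsTree) {r y z : V} (hadj : T.Adj y z)
    (hd : T.dist r y = T.dist r z + 1) : par T r y = z := by
  have hy : y ≠ r := by rintro rfl; simp at hd
  have := par_spec hT.connected hy
  exact eq_of_adj_closer hT this.1 hadj this.2 hd

open Classical in
/-- The children of a vertex in the tree rooted at `r`. -/
def kids (T : SimpleGraph V) [T.LocallyFinite] (r y : V) : Finset V :=
  (T.neighborFinset y).filter fun z => T.dist r z = T.dist r y + 1

theorem mem_kids [T.LocallyFinite] (hT : T.IsTree) {r y z : V} :
    z ∈ kids T r y ↔ z ≠ r ∧ par T r z = y := by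
  rw [kids, Finset.mem_filter, SimpleGraph.mem_neighborFinset]
  constructor
  · rintro ⟨h1, h2⟩
    exact ⟨by rintro rfl; simp at h2, eq_par hT h1.symm h2⟩
  · rintro ⟨h1, rfl⟩
    have := par_spec hT.connected h1
    exact ⟨this.1.symm, this.2⟩

theorem card_kids_root [T.LocallyFinite] {k : ℕ} (hk : T.IsRegularOfDegree k)
    (r : V) : (kids T r r).card = k := by
  rw [← hk r, ← SimpleGraph.card_neighborFinset_eq_degree, kids, Finset.filter_true_of_mem]
  intro z hz
  rw [SimpleGraph.mem_neighborFinset] at hz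
  simpa using SimpleGraph.dist_eq_one_iff_adj.2 hz

open Classical in
theorem neighborFinset_eq_insert [T.LocallyFinite] (hT : T.IsTree) {r y : V} (hy : y ≠ r) :
    T.neighborFinset y = insert (par T r y) (kids T r y) := by
  have hp := par_spec hT.connected hy
  ext z
  rw [Finset.mem_insert, kids, Finset.mem_filter, SimpleGraph.mem_neighborFinset]
  constructor
  · intro h
    rcases hT.dist_eq_dist_add_one_of_adj r h with h2 | h2
    · exact Or.inl (eq_par hT h h2).symm
    · exact Or.inr ⟨h, h2⟩
  · rintro (rfl | h)
    · exact hp.1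
    · exact h.1

theorem par_notMem_kids [T.LocallyFinite] (hT : T.Connected) {r y : V} (hy : y ≠ r) :
    par T r y ∉ kids T r y := by
  classical
  have hp := (par_spec hT hy).2
  rw [kids, Finset.mem_filter]
  rintro ⟨-, h⟩
  omega

theorem card_kids [T.LocallyFinite] (hT : T.IsTree) {d : ℕ} (hk : T.IsRegularOfDegree (d + 1))
    {r y : V} (hy : y ≠ r) : (kids T r y).card = d := by
  classical
  have h3 := hk y
  rw [← SimpleGraph.card_neighborFinset_eq_degree, neighborFinset_eq_insert hT hy,
    Finset.card_insert_of_notMem (par_notMem_kids hT.connected hy)] at h3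
  omega

/-- The descendants of a vertex in the tree rooted at `r`, including itself. -/
def desc (T : SimpleGraph V) (r z : V) : Set V := {w | ∃ n, (par T r)^[n] w = z}

/-- The descendants of a vertex in the tree rooted at `r`, other than itself. -/
def sdesc (T : SimpleGraph V) (r z : V) : Set V := desc T r z \ {z}

theorem dist_par (hT : T.Connected) (r w : V) : T.dist r (par T r w) = T.dist r w - 1 := by
  by_cases h : w = r
  · subst h; simp [par_root]
  · have := (par_spec hT h).2
    omega

theorem dist_par_iterate (hT : T.Connected) (r w : V) (n : ℕ) :
    T.dist r ((par T r)^[n] w) = T.dist r w - n := by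
  induction n with
  | zero => rfl
  | succ n ih => rw [Function.iterate_succ_apply', dist_par hT, ih]; omega

theorem mem_desc_self (r z : V) : z ∈ desc T r z := ⟨0, rfl⟩

theorem mem_desc_of_par {r z w : V} (h : par T r w ∈ desc T r z) : w ∈ desc T r z := by
  obtain ⟨n, hn⟩ := h
  exact ⟨n + 1, by rwa [Function.iterate_succ_apply]⟩

theorem desc_subset {r y z : V} (h : y ∈ desc T r z) : desc T r y ⊆ desc T r z := by
  rintro w ⟨n, rfl⟩
  obtain ⟨m, rfl⟩ := h
  exact ⟨m + n, Function.iterate_add_apply _ _ _ _⟩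

theorem dist_le_of_mem_desc (hT : T.Connected) {r z w : V} (h : w ∈ desc T r z) :
    T.dist r z ≤ T.dist r w := by
  obtain ⟨n, rfl⟩ := h
  rw [dist_par_iterate hT]; omega

theorem eq_of_mem_desc_of_dist (hT : T.Connected) {r z w : V} (h : w ∈ desc T r z)
    (hd : T.dist r z = T.dist r w) : z = w := by
  obtain ⟨n, rfl⟩ := h
  rw [dist_par_iterate hT] at hd
  rcases Nat.eq_zero_or_pos n with rfl | hn
  · rfl
  · have hw : T.dist r w = 0 := by omega
    have : r = w := (hT.dist_eq_zero_iff).1 hw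
    subst this
    exact Function.iterate_fixed (par_root r) n

theorem not_mem_desc_of_mem_desc (hT : T.Connected) {r z w : V} (hne : z ≠ w)
    (h : w ∈ desc T r z) : z ∉ desc T r w := fun h' =>
  hne (eq_of_mem_desc_of_dist hT h
    (le_antisymm (dist_le_of_mem_desc hT h) (dist_le_of_mem_desc hT h')))

theorem desc_kid_subset (hT : T.Connected) {r z : V} (hz : z ≠ r) :
    desc T r z ⊆ sdesc T r (par T r z) := by
  intro w hw
  refine ⟨desc_subset ⟨1, rfl⟩ hw, ?_⟩
  rintro rfl
  have h1 := dist_le_of_mem_desc hT hw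
  have h2 := (par_spec hT hz).2
  omega

/-- The depth of a common descendant determines the number of parent steps to a given positive
depth, so both ancestors would coincide. -/
theorem disjoint_desc (hT : T.Connected) {r y z : V} (hy : y ≠ r) (hyz : y ≠ z)
    (hd : T.dist r y = T.dist r z) : Disjoint (desc T r y) (desc T r z) := by
  rw [Set.disjoint_left]
  rintro w ⟨n, hn⟩ ⟨m, hm⟩
  have h1 := dist_par_iterate hT r w n
  have h2 := dist_par_iterate hT r w m
  rw [hn] at h1
  rw [hm] at h2
  have h3 : 0 < T.dist r y := hT.pos_dist_of_ne hy.symm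
  have : n = m := by omega
  subst this
  exact hyz (hn.symm.trans hm)

theorem notMem_sdesc_self (r z : V) : z ∉ sdesc T r z := fun h => h.2 rfl

/-- The geodesic from outside the subtree enters through the parent. Conversely, if the parent of
`z` is farther from `w` than `z`, the next vertex towards `w` is a child of `z` in the same
situation, and induction on the distance puts `w` below `z`. -/
theorem dist_par_of_notMem_desc (hT : T.IsTree) {r z : V} (hz : z ≠ r) :
    ∀ {w : V}, w ∉ desc T r z → T.dist w z = T.dist w (par T r z) + 1 := by
  have key : ∀ (n : ℕ) (w z : V), z ≠ r → T.dist w z = n →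
      T.dist w (par T r z) = T.dist w z + 1 → w ∈ desc T r z := by
    intro n
    induction n with
    | zero =>
      intro w z _ h0 _
      rw [hT.connected.dist_eq_zero_iff.1 h0]
      exact mem_desc_self r z
    | succ n ih =>
      intro w z hz hn h
      have hwz : w ≠ z := by rintro rfl; simp at hn
      obtain ⟨z', hadj, hz'⟩ := exists_adj_closer hT.connected hwz
      rcases hT.dist_eq_dist_add_one_of_adj r hadj with h1 | h1
      · rw [eq_par hT hadj h1] at h
        omega
      · have hp : par T r z' = z := eq_par hT hadj.symm h1
        have hz'r : z' ≠ r := by rintro rfl; simp at h1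
        have := ih w z' hz'r (by omega) (by rw [hp]; exact hz')
        exact desc_subset ⟨1, hp⟩ this
  intro w hw
  rcases hT.dist_eq_dist_add_one_of_adj w (par_spec hT.connected hz).1 with h | h
  · exact h
  · exact absurd (key _ w z hz rfl h) hw

theorem finite_dist_le [T.LocallyFinite] (hT : T.Connected) (r : V) (n : ℕ) :
    {w | T.dist r w ≤ n}.Finite := by
  classical
  induction n with
  | zero =>
    refine (Set.finite_singleton r).subset fun w hw => ?_
    exact (hT.dist_eq_zero_iff.1 (Nat.le_zero.1 hw)).symm
  | succ n ih =>
    refine (ih.union (ih.biUnion fun w _ => (T.neighborFinset w).finite_toSet)).subset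
      fun w hw => ?_
    have hw' : T.dist r w ≤ n + 1 := hw
    by_cases hne : r = w
    · subst hne; left; simp
    · obtain ⟨z, h1, h2⟩ := exists_adj_closer hT hne
      right
      simp only [Set.mem_iUnion]
      refine ⟨z, ?_, ?_⟩
      · change T.dist r z ≤ n; omega
      · simpa using h1.symm

theorem countable_of_connected [T.LocallyFinite] (hT : T.Connected) : Countable V := by
  obtain ⟨r⟩ := hT.nonempty
  have : (Set.univ : Set V) = ⋃ n, {w | T.dist r w ≤ n} := by
    ext w
    simp only [Set.mem_univ, Set.mem_iUnion, true_iff]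
    exact ⟨T.dist r w, le_refl (T.dist r w)⟩
  rw [← Set.countable_univ_iff, this]
  exact Set.countable_iUnion fun n => (finite_dist_le hT r n).countable

end Tree

/-! ### The Green function of the regular tree -/

section Green

variable {V : Type*} {T : SimpleGraph V} [T.LocallyFinite] {d : ℕ}

theorem walkStep_apply (hk : T.IsRegularOfDegree (d + 1)) (z y : V) [Decidable (T.Adj z y)] :
    walkStep T z y = if T.Adj z y then ((d : ℝ≥0∞) + 1)⁻¹ else 0 := by
  classical
  have hne : (T.neighborFinset z).Nonempty := by
    rw [← Finset.card_pos, SimpleGraph.card_neighborFinset_eq_degree, hk z]; omega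
  rw [walkStep, dif_pos hne, PMF.uniformOfFinset_apply]
  simp [hk z]

theorem walkLaw_succ_apply (hk : T.IsRegularOfDegree (d + 1)) (x y : V) (k : ℕ) :
    walkLaw T x (k + 1) y =
      (∑ z ∈ T.neighborFinset y, walkLaw T x k z) * ((d : ℝ≥0∞) + 1)⁻¹ := by
  classical
  rw [walkLaw, PMF.bind_apply, tsum_eq_sum (s := T.neighborFinset y), Finset.sum_mul]
  · refine Finset.sum_congr rfl fun z hz => ?_
    rw [SimpleGraph.mem_neighborFinset] at hz
    rw [walkStep_apply hk, if_pos hz.symm]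
  · intro z hz
    rw [SimpleGraph.mem_neighborFinset] at hz
    rw [walkStep_apply hk, if_neg fun h => hz h.symm, mul_zero]

theorem walkLaw_succ_toReal (hk : T.IsRegularOfDegree (d + 1)) (x y : V) (k : ℕ) :
    (walkLaw T x (k + 1) y).toReal =
      (∑ z ∈ T.neighborFinset y, (walkLaw T x k z).toReal) / (d + 1) := by
  rw [walkLaw_succ_apply hk, ENNReal.toReal_mul, ENNReal.toReal_sum fun z _ => PMF.apply_ne_top _ _,
    ENNReal.toReal_inv, ENNReal.toReal_add (by simp) (by simp)]
  simp [div_eq_mul_inv]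

theorem sum_neighbor_radial (hT : T.IsTree) (hk : T.IsRegularOfDegree (d + 1)) {x y : V}
    (hy : y ≠ x) (g : ℕ → ℝ) : ∑ z ∈ T.neighborFinset y, g (T.dist x z) =
      g (T.dist x y - 1) + d * g (T.dist x y + 1) := by
  classical
  rw [neighborFinset_eq_insert hT hy, Finset.sum_insert (par_notMem_kids hT.connected hy),
    dist_par hT.connected]
  congr 1
  rw [Finset.sum_congr rfl (g := fun _ => g (T.dist x y + 1)), Finset.sum_const,
    card_kids hT hk hy, nsmul_eq_mul]
  intro z hz
  rw [kids, Finset.mem_filter] at hz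
  rw [hz.2]

theorem sum_neighbor_radial_self (hk : T.IsRegularOfDegree (d + 1)) (x : V) (g : ℕ → ℝ) :
    ∑ z ∈ T.neighborFinset x, g (T.dist x z) = (d + 1) * g 1 := by
  rw [Finset.sum_congr rfl (g := fun _ => g 1), Finset.sum_const,
    SimpleGraph.card_neighborFinset_eq_degree, hk x, nsmul_eq_mul]
  · push_cast; rfl
  · intro z hz
    rw [SimpleGraph.mem_neighborFinset] at hz
    rw [SimpleGraph.dist_eq_one_iff_adj.2 hz]

/-- The candidate `f = C d^{-dist}` solves `f = δ_x + Af`, where `A` averages over neighbours. The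
remainder after `n` terms is therefore `A^n f`. It tends to zero by comparison with `C ρ^n
β^{dist}`, since `A β^{dist} ≤ ρ β^{dist}` and `ρ < 1`. -/
theorem hasSum_walkLaw (hd : 2 ≤ d) (hT : T.IsTree) (hk : T.IsRegularOfDegree (d + 1)) (x y : V) :
    HasSum (fun k => (walkLaw T x k y).toReal) (d / (d - 1) * (d : ℝ)⁻¹ ^ T.dist x y) := by
  classical
  have hd' : (2 : ℝ) ≤ d := by exact_mod_cast hd
  have hd1 : (0 : ℝ) < d - 1 := by linarith
  set C : ℝ := d / (d - 1) with hC
  have hC0 : 0 < C := by positivity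
  -- The quantity `β⁻¹ + dβ` equals `d + 1` at `β = 1/d` and at `β = 1`, and is smaller strictly in
  -- between; `2/(d+1)` is the harmonic mean of these endpoints. The inequality `β ≤ ρ` serves at
  -- the root, where every neighbour is farther away.
  set β : ℝ := 2 / (d + 1) with hβ
  have hβ0 : 0 < β := by positivity
  set ρ : ℝ := (β⁻¹ + d * β) / (d + 1) with hρ
  have hρ0 : 0 < ρ := by positivity
  have hβ1 : β < 1 := by rw [hβ, div_lt_one (by linarith)]; linarith
  have hρ1 : ρ < 1 := by
    rw [hρ, div_lt_one (by linarith), hβ, inv_div]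
    have : d * (2 / ((d : ℝ) + 1)) < 2⁻¹ * (d + 1) := by
      rw [mul_div_assoc', div_lt_iff₀ (by linarith)]
      nlinarith
    linarith
  have hβρ : β ≤ ρ := by
    rw [hρ, le_div_iff₀ (by linarith)]
    have : β ≤ β⁻¹ := hβ1.le.trans (one_le_inv_iff₀.2 ⟨hβ0, hβ1.le⟩)
    linarith
  have hqβ : (d : ℝ)⁻¹ ≤ β := by
    rw [hβ, inv_eq_one_div, div_le_div_iff₀ (by linarith) (by linarith)]
    linarith
  set f : V → ℝ := fun y => C * (d : ℝ)⁻¹ ^ T.dist x y with hf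
  set p : ℕ → V → ℝ := fun k y => (walkLaw T x k y).toReal with hp
  have f_eq : ∀ y, f y = p 0 y + (∑ z ∈ T.neighborFinset y, f z) / (d + 1) := by
    intro y
    by_cases hy : y = x
    · subst hy
      have h1 := sum_neighbor_radial_self hk y (fun n => C * (d : ℝ)⁻¹ ^ n)
      have h2 : p 0 y = 1 := by simp [hp, walkLaw]
      simp only [hf]
      rw [h1, h2]
      simp only [SimpleGraph.dist_self, hC]
      field_simp
      ring
    · have h1 := sum_neighbor_radial hT hk hy (fun n => C * (d : ℝ)⁻¹ ^ n)
      have h2 : p 0 y = 0 := by simp [hp, walkLaw, hy]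
      have h3 : 0 < T.dist x y := hT.connected.pos_dist_of_ne (Ne.symm hy)
      simp only [hf]
      rw [h1, h2]
      obtain ⟨n, hn⟩ : ∃ n, T.dist x y = n + 1 := ⟨T.dist x y - 1, by omega⟩
      rw [hn, Nat.add_sub_cancel, pow_succ _ n, pow_succ _ (n + 1), pow_succ _ n]
      field_simp
      ring
  set e : ℕ → V → ℝ := fun n y => f y - ∑ k ∈ Finset.range n, p k y with he
  have e_succ : ∀ n y, e (n + 1) y = (∑ z ∈ T.neighborFinset y, e n z) / (d + 1) := by
    intro n y
    simp only [he]
    rw [Finset.sum_range_succ', f_eq y, Finset.sum_sub_distrib, Finset.sum_comm, sub_div,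
      Finset.sum_div (s := Finset.range n)]
    have : ∀ k, p (k + 1) y = (∑ z ∈ T.neighborFinset y, p k z) / (d + 1) := fun k =>
      walkLaw_succ_toReal hk x y k
    simp only [this]
    ring
  have bound : ∀ n y, 0 ≤ e n y ∧ e n y ≤ C * ρ ^ n * β ^ T.dist x y := by
    intro n
    induction n with
    | zero =>
      intro y
      simp only [he, hf, Finset.range_zero, Finset.sum_empty, sub_zero, pow_zero, mul_one]
      exact ⟨by positivity, by gcongr⟩
    | succ n ih =>
      intro y
      rw [e_succ]
      refine ⟨div_nonneg (Finset.sum_nonneg fun z _ => (ih z).1) (by positivity), ?_⟩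
      rw [div_le_iff₀ (by positivity)]
      refine (Finset.sum_le_sum fun z _ => (ih z).2).trans ?_
      by_cases hy : y = x
      · subst hy
        rw [sum_neighbor_radial_self hk y (fun m => C * ρ ^ n * β ^ m), SimpleGraph.dist_self]
        have : C * ρ ^ n * β ≤ C * ρ ^ n * ρ := by gcongr
        calc (d + 1) * (C * ρ ^ n * β ^ 1) = C * ρ ^ n * β * (d + 1) := by ring
          _ ≤ C * ρ ^ n * ρ * (d + 1) := by gcongr
          _ = _ := by ring
      · rw [sum_neighbor_radial hT hk hy (fun m => C * ρ ^ n * β ^ m)]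
        have h3 : 0 < T.dist x y := hT.connected.pos_dist_of_ne (Ne.symm hy)
        obtain ⟨m, hm⟩ : ∃ m, T.dist x y = m + 1 := ⟨T.dist x y - 1, by omega⟩
        rw [hm, Nat.add_sub_cancel]
        have e1 : C * ρ ^ (n + 1) * β ^ (m + 1) * (d + 1) =
            C * ρ ^ n * (ρ * (d + 1)) * β ^ (m + 1) := by ring
        have e2 : ρ * (d + 1) = β⁻¹ + d * β := by rw [hρ]; field_simp
        rw [e1, e2]
        refine le_of_eq ?_
        rw [pow_succ β (m + 1), pow_succ β m]
        field_simp
  rw [hasSum_iff_tendsto_nat_of_nonneg fun k => ENNReal.toReal_nonneg]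
  have lim : Filter.Tendsto (fun n => e n y) Filter.atTop (nhds 0) := by
    refine squeeze_zero (fun n => (bound n y).1) (fun n => (bound n y).2) ?_
    have := ((tendsto_pow_atTop_nhds_zero_of_lt_one hρ0.le hρ1).const_mul C).mul_const
      (β ^ T.dist x y)
    simpa using this
  have := lim.const_sub (f y)
  simpa [he, hf, hp] using this

/-- The Green function of the `(d+1)`-regular tree. -/
theorem green_eq (hd : 2 ≤ d) (hT : T.IsTree) (hk : T.IsRegularOfDegree (d + 1)) (x y : V) :
    green T x y = sigmaSq d * (d : ℝ)⁻¹ ^ T.dist x y := by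
  have hd' : (2 : ℝ) ≤ d := by exact_mod_cast hd
  have h1 : (d : ℝ) - 1 ≠ 0 := by linarith
  have h2 : (d : ℝ) ^ 2 - 1 = (d - 1) * (d + 1) := by ring
  rw [green, hk y, ENNReal.toReal_mul, ENNReal.tsum_toReal_eq fun k => PMF.apply_ne_top _ _,
    (hasSum_walkLaw hd hT hk x y).tsum_eq, sigmaSq_coe hd, h2]
  simp only [ENNReal.toReal_inv, ENNReal.toReal_natCast]
  push_cast
  field_simp

end Green

/-! ### Innovations of the Gaussian free field -/

section Innovations

variable {V : Type*} {T : SimpleGraph V} {d : ℕ}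

open Classical in
/-- The increment `f y - f (parent of y) / d` of a configuration along the edge above `y`, and
its value at the root. -/
def innov (T : SimpleGraph V) (d : ℕ) (r : V) (f : V → ℝ) (y : V) : ℝ :=
  f y - (if y = r then 0 else (d : ℝ)⁻¹) * f (par T r y)

theorem innov_root (r : V) (f : V → ℝ) : innov T d r f r = f r := by simp [innov]

theorem eq_add_innov {r y : V} (hy : y ≠ r) (f : V → ℝ) :
    f y = f (par T r y) / d + innov T d r f y := by
  rw [innov, if_neg hy]; ring

theorem root_notMem_desc {r z : V} (hz : z ≠ r) : r ∉ desc T r z := by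
  rintro ⟨n, hn⟩
  rw [Function.iterate_fixed (par_root r)] at hn
  exact hz hn.symm

variable {Ω : Type*} [MeasurableSpace Ω] {P : Measure Ω} {φ : V → Ω → ℝ}

theorem isGaussianProcess_innov (hφ : IsGaussianProcess φ P) (r : V) :
    IsGaussianProcess (fun y ω => innov T d r (fun x => φ x ω) y) P := by
  classical
  refine hφ.of_isGaussianProcess fun y => ⟨{y, par T r y},
    ContinuousLinearMap.proj (R := ℝ) (φ := fun _ : ({y, par T r y} : Finset V) => ℝ)
      ⟨y, by simp⟩ - (if y = r then 0 else (d : ℝ)⁻¹) •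
      ContinuousLinearMap.proj (R := ℝ) (φ := fun _ : ({y, par T r y} : Finset V) => ℝ)
      ⟨par T r y, by simp⟩, fun ω => ?_⟩
  simp only [innov]
  split_ifs <;> simp

variable [T.LocallyFinite]

theorem IsGaussianFreeField.memLp_two (hφ : IsGaussianFreeField T φ P) (x : V) :
    MemLp (φ x) 2 P := (hφ.gaussian.hasGaussianLaw_eval x).memLp_two

theorem cov_innov_left (hφ : IsGaussianFreeField T φ P) [IsProbabilityMeasure P] (r y : V)
    {Y : Ω → ℝ} (hY : MemLp Y 2 P) [Decidable (y = r)] :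
    cov[fun ω => innov T d r (fun x => φ x ω) y, Y; P] =
      cov[φ y, Y; P] - (if y = r then 0 else (d : ℝ)⁻¹) * cov[φ (par T r y), Y; P] := by
  rw [← covariance_const_mul_left, ← covariance_fun_sub_left (hφ.memLp_two y)
    ((hφ.memLp_two _).const_mul _) hY]
  simp only [innov]
  congr!

/-- From a vertex outside the subtree of `z`, the distance to `z` is one more than to its parent,
and the Green function drops by exactly `1/d`: the Markov property along the edge. -/
theorem cov_innov_field (hd : 2 ≤ d) (hT : T.IsTree) (hk : T.IsRegularOfDegree (d + 1))
    (hφ : IsGaussianFreeField T φ P) [IsProbabilityMeasure P] {r z w : V} (hz : z ≠ r)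
    (hw : w ∉ desc T r z) : cov[fun ω => innov T d r (fun x => φ x ω) z, φ w; P] = 0 := by
  classical
  rw [cov_innov_left hφ r z (hφ.memLp_two w), if_neg hz, hφ.covariance_eq, hφ.covariance_eq,
    green_eq hd hT hk, green_eq hd hT hk, SimpleGraph.dist_comm, dist_par_of_notMem_desc hT hz hw,
    SimpleGraph.dist_comm (u := w)]
  ring

theorem memLp_innov (hφ : IsGaussianFreeField T φ P) (r y : V) :
    MemLp (fun ω => innov T d r (fun x => φ x ω) y) 2 P :=
  (hφ.memLp_two y).sub ((hφ.memLp_two _).const_mul _)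

/-- Of two distinct vertices, one is not the root and does not have the other below it. Its
innovation is uncorrelated with the field outside its subtree, hence with the other innovation. -/
theorem cov_innov_innov (hd : 2 ≤ d) (hT : T.IsTree) (hk : T.IsRegularOfDegree (d + 1))
    (hφ : IsGaussianFreeField T φ P) [IsProbabilityMeasure P] {r y z : V} (hyz : y ≠ z) :
    cov[fun ω => innov T d r (fun x => φ x ω) y, fun ω => innov T d r (fun x => φ x ω) z; P]
      = 0 := by
  classical
  have key : ∀ y z : V, y ≠ r → z ∉ desc T r y →
      cov[fun ω => innov T d r (fun x => φ x ω) y, fun ω => innov T d r (fun x => φ x ω) z; P]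
        = 0 := by
    intro y z hy hz
    rw [covariance_comm, cov_innov_left hφ r z (memLp_innov hφ r y), covariance_comm,
      cov_innov_field hd hT hk hφ hy hz, covariance_comm,
      cov_innov_field hd hT hk hφ hy (fun h => hz (mem_desc_of_par h))]
    ring
  by_cases h : y ≠ r ∧ z ∉ desc T r y
  · exact key y z h.1 h.2
  · rw [covariance_comm]
    rw [not_and_or, not_not, not_not] at h
    rcases h with rfl | h
    · exact key z y hyz.symm (root_notMem_desc hyz.symm)
    · refine key z y ?_ (not_mem_desc_of_mem_desc hT.connected hyz h)
      rintro rfl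
      exact root_notMem_desc hyz h

/-- The innovations are independent. -/
theorem iIndepFun_innov (hd : 2 ≤ d) (hT : T.IsTree) (hk : T.IsRegularOfDegree (d + 1))
    (hφ : IsGaussianFreeField T φ P) [IsProbabilityMeasure P] (r : V) :
    iIndepFun (fun y ω => innov T d r (fun x => φ x ω) y) P := by
  have hG := (isGaussianProcess_innov (T := T) (d := d) hφ.gaussian r).comp_right
    (fun p : (_ : V) × Unit => p.1)
  have := hG.iIndepFun_of_covariance_eq_zero (S := fun _ : V => Unit)
    (X := fun y _ ω => innov T d r (fun x => φ x ω) y)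
    (fun y _ => (memLp_innov hφ r y).1.aemeasurable)
    (fun y z hyz _ _ => cov_innov_innov hd hT hk hφ hyz)
  exact this.comp (fun _ f => f ()) fun _ => measurable_pi_apply _

theorem map_root (hd : 2 ≤ d) (hT : T.IsTree) (hk : T.IsRegularOfDegree (d + 1))
    (hφ : IsGaussianFreeField T φ P) [IsProbabilityMeasure P] (r : V) :
    P.map (φ r) = statLaw d := by
  rw [(hφ.gaussian.hasGaussianLaw_eval r).map_eq_gaussianReal, hφ.centered,
    ← covariance_self (hφ.memLp_two r).1.aemeasurable, hφ.covariance_eq, green_eq hd hT hk]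
  simp [statLaw]

theorem map_innov (hd : 2 ≤ d) (hT : T.IsTree) (hk : T.IsRegularOfDegree (d + 1))
    (hφ : IsGaussianFreeField T φ P) [IsProbabilityMeasure P] {r y : V} (hy : y ≠ r) :
    P.map (fun ω => innov T d r (fun x => φ x ω) y) = gaussianReal 0 (innovVar d) := by
  classical
  have hd' : (2 : ℝ) ≤ d := by exact_mod_cast hd
  have hmean : ∫ ω, innov T d r (fun x => φ x ω) y ∂P = 0 := by
    simp only [innov]
    rw [integral_sub ((hφ.memLp_two _).integrable (by norm_num))
      (((hφ.memLp_two _).integrable (by norm_num)).const_mul _), integral_const_mul,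
      hφ.centered, hφ.centered]
    ring
  have hvar : Var[fun ω => innov T d r (fun x => φ x ω) y; P] = (d : ℝ)⁻¹ := by
    have h1 := (par_spec hT.connected hy).1
    rw [← covariance_self (memLp_innov hφ r y).1.aemeasurable,
      cov_innov_left hφ r y (memLp_innov hφ r y),
      covariance_comm (φ y), cov_innov_left hφ r y (hφ.memLp_two _),
      covariance_comm (φ (par T r y)) fun ω => innov T d r (fun x => φ x ω) y,
      cov_innov_left hφ r y (hφ.memLp_two _), if_neg hy]
    simp only [hφ.covariance_eq, green_eq hd hT hk, SimpleGraph.dist_self, pow_zero,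
      SimpleGraph.dist_eq_one_iff_adj.2 h1, SimpleGraph.dist_eq_one_iff_adj.2 h1.symm, pow_one]
    rw [sigmaSq_coe hd]
    have : (d : ℝ) ^ 2 - 1 ≠ 0 := by nlinarith
    field_simp
    ring
  rw [((isGaussianProcess_innov (T := T) (d := d) hφ.gaussian r).hasGaussianLaw_eval
    y).map_eq_gaussianReal, hmean, hvar]
  congr 1
  ext
  rw [Real.coe_toNNReal _ (by positivity)]
  simp [innovVar]

theorem IsGaussianFreeField.congr {ψ : V → Ω → ℝ} (hφ : IsGaussianFreeField T φ P)
    (h : ∀ x, φ x =ᵐ[P] ψ x) : IsGaussianFreeField T ψ P where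
  gaussian := hφ.gaussian.congr h
  centered x := by rw [← integral_congr_ae (h x), hφ.centered]
  covariance_eq x y := by
    rw [← hφ.covariance_eq, covariance, covariance, ← integral_congr_ae (h x),
      ← integral_congr_ae (h y)]
    refine integral_congr_ae ?_
    filter_upwards [h x, h y] with ω h1 h2
    rw [h1, h2]

end Innovations

/-! ### Functionals of the subtrees -/

section Functionals

variable {V : Type*} {T : SimpleGraph V} {Ω : Type*} {X : V → Ω → ℝ}
  {d : ℕ} {r : V}

/-- The `σ`-algebra generated by the variables with index in `S`. -/
abbrev famAlg (X : V → Ω → ℝ) (S : Set V) : MeasurableSpace Ω :=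
  ⨆ i ∈ S, MeasurableSpace.comap (X i) inferInstance

theorem famAlg_mono {S S' : Set V} (h : S ⊆ S') : famAlg X S ≤ famAlg X S' :=
  biSup_mono h

theorem measurable_famAlg_eval {S : Set V} {y : V} (hy : y ∈ S) :
    Measurable[famAlg X S] (X y) :=
  Measurable.mono (comap_measurable (X y))
    (le_iSup₂ (f := fun i (_ : i ∈ S) => MeasurableSpace.comap (X i) inferInstance) y hy) le_rfl

open Classical in
theorem measurable_famAlg_indicator (S : Set V) :
    Measurable[famAlg X S] (fun ω => S.indicator fun z => X z ω) := by
  refine @measurable_pi_lambda _ _ _ (famAlg X S) _ _ fun z => ?_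
  by_cases hz : z ∈ S
  · simp only [Set.indicator_of_mem hz]
    exact measurable_famAlg_eval hz
  · simp only [Set.indicator_of_notMem hz]
    exact measurable_const

variable [mΩ : MeasurableSpace Ω] {P : Measure Ω}

theorem famAlg_le (hX : ∀ y, Measurable (X y)) (S : Set V) : famAlg X S ≤ mΩ :=
  iSup₂_le fun i _ => (hX i).comap_le

theorem indep_famAlg (hX : ∀ y, Measurable (X y)) (hI : iIndepFun X P) {S S' : Set V}
    (h : Disjoint S S') : Indep (famAlg X S) (famAlg X S') P :=
  indep_iSup_of_disjoint (fun i => (hX i).comap_le) hI.iIndep h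

/-- A functional of a value and of a configuration which only depends on the restriction of the
configuration to `S`. -/
structure IsLocal (S : Set V) (K : ℝ → (V → ℝ) → ℝ≥0∞) : Prop where
  meas : Measurable fun p : ℝ × (V → ℝ) => K p.1 p.2
  eq_of : ∀ a v v', (∀ z ∈ S, v z = v' z) → K a v = K a v'

theorem IsLocal.eq_indicator {S : Set V} {K : ℝ → (V → ℝ) → ℝ≥0∞} (hK : IsLocal S K) (a : ℝ)
    (v : V → ℝ) : K a v = K a (S.indicator v) :=
  hK.eq_of a _ _ fun _ hz => (Set.indicator_of_mem hz v).symm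

variable [IsProbabilityMeasure P]

/-- Conditioning a functional on an independent value. -/
theorem lintegral_local (hX : ∀ y, Measurable (X y)) (hI : iIndepFun X P) {S : Set V} {y : V}
    (hy : y ∉ S) {K : ℝ → (V → ℝ) → ℝ≥0∞} (hK : IsLocal S K) :
    ∫⁻ ω, K (X y ω) (fun z => X z ω) ∂P =
      ∫⁻ u, ∫⁻ ω, K u (fun z => X z ω) ∂P ∂(P.map (X y)) := by
  set Y : Ω → V → ℝ := fun ω => S.indicator fun z => X z ω with hY
  have mY' : Measurable[famAlg X S] Y := measurable_famAlg_indicator S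
  have mY : Measurable Y := mY'.mono (famAlg_le hX S) le_rfl
  have hind : IndepFun (X y) Y P := by
    have h1 := indep_famAlg hX hI (Set.disjoint_singleton_left.2 hy)
    rw [IndepFun_iff_Indep]
    refine indep_of_indep_of_le_left (indep_of_indep_of_le_right h1 mY'.comap_le) ?_
    exact (measurable_famAlg_eval (Set.mem_singleton y)).comap_le
  have e : ∀ a ω, K a (fun z => X z ω) = K a (Y ω) := fun a ω => hK.eq_indicator a _
  simp_rw [e]
  have hmap := (indepFun_iff_map_prod_eq_prod_map_map (hX y).aemeasurable mY.aemeasurable).1 hind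
  calc ∫⁻ ω, K (X y ω) (Y ω) ∂P
      = ∫⁻ p, K p.1 p.2 ∂(P.map fun ω => (X y ω, Y ω)) := by
        rw [lintegral_map hK.meas ((hX y).prodMk mY)]
    _ = ∫⁻ u, ∫⁻ v, K u v ∂(P.map Y) ∂(P.map (X y)) := by
        rw [hmap]
        have : IsProbabilityMeasure (P.map Y) := Measure.isProbabilityMeasure_map mY.aemeasurable
        exact lintegral_prod _ hK.meas.aemeasurable
    _ = _ := by
        refine lintegral_congr fun u => ?_
        have mK : Measurable fun v => K u v :=
          hK.meas.comp (by fun_prop : Measurable fun v : V → ℝ => (u, v))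
        rw [lintegral_map mK mY]

/-- `H y a v` is a functional of the subtree below `y` whose expectation, when `y` has value `a`
and the innovations below `y` are given by `X`, is `f a`. -/
structure Represents (T : SimpleGraph V) (r : V) (P : Measure Ω) (X : V → Ω → ℝ)
    (H : V → ℝ → (V → ℝ) → ℝ≥0∞) (f : ℝ → ℝ≥0∞) : Prop where
  isLocal : ∀ y, IsLocal (sdesc T r y) (H y)
  meas : Measurable f
  lintegral_eq : ∀ y, y ≠ r → ∀ a, ∫⁻ ω, H y a (fun z => X z ω) ∂P = f a

theorem Represents.lintegral_kid (hd : 2 ≤ d) (hX : ∀ y, Measurable (X y))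
    (hI : iIndepFun X P) (hlaw : ∀ y, y ≠ r → P.map (X y) = gaussianReal 0 (innovVar d))
    {H : V → ℝ → (V → ℝ) → ℝ≥0∞} {f : ℝ → ℝ≥0∞} (hH : Represents T r P X H f) {z : V}
    (hz : z ≠ r) (a : ℝ) :
    ∫⁻ ω, H z (a / d + X z ω) (fun z => X z ω) ∂P = pou d f a := by
  have hK : IsLocal (sdesc T r z) fun u v => H z (a / d + u) v :=
    ⟨(hH.isLocal z).meas.comp
      (by fun_prop : Measurable fun p : ℝ × (V → ℝ) => (a / (d : ℝ) + p.1, p.2)),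
      fun u v v' h => (hH.isLocal z).eq_of _ _ _ h⟩
  rw [lintegral_local hX hI (notMem_sdesc_self r z) hK, hlaw z hz,
    pou_eq_lintegral_innov hd hH.meas]
  exact lintegral_congr fun u => hH.lintegral_eq z hz _

variable [T.LocallyFinite]

/-- The product over the children of `y` of a functional, in terms of the value of `y`. -/
def kidsProd (T : SimpleGraph V) [T.LocallyFinite] (d : ℕ) (r : V)
    (H : V → ℝ → (V → ℝ) → ℝ≥0∞) (y : V) (a : ℝ) (v : V → ℝ) : ℝ≥0∞ :=
  ∏ z ∈ kids T r y, H z (a / d + v z) v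

theorem isLocal_kidsProd (hT : T.IsTree) {H : V → ℝ → (V → ℝ) → ℝ≥0∞}
    (hH : ∀ y, IsLocal (sdesc T r y) (H y)) (y : V) :
    IsLocal (sdesc T r y) (kidsProd T d r H y) where
  meas := by
    refine Finset.measurable_fun_prod _ fun z _ => ?_
    exact (hH z).meas.comp
      (by fun_prop : Measurable fun p : ℝ × (V → ℝ) => (p.1 / (d : ℝ) + p.2 z, p.2))
  eq_of a v v' h := by
    refine Finset.prod_congr rfl fun z hz => ?_
    obtain ⟨hzr, rfl⟩ := (mem_kids hT).1 hz
    have hsub := desc_kid_subset hT.connected hzr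
    rw [h z (hsub (mem_desc_self r z))]
    exact (hH z).eq_of _ _ _ fun w hw => h w (hsub hw.1)

/-- Distinct children have disjoint subtrees, so their factors are functions of disjoint families of
innovations and the expectation of the product factorizes. -/
theorem Represents.lintegral_kidsProd (hd : 2 ≤ d) (hT : T.IsTree) (hX : ∀ y, Measurable (X y))
    (hI : iIndepFun X P) (hlaw : ∀ y, y ≠ r → P.map (X y) = gaussianReal 0 (innovVar d))
    {H : V → ℝ → (V → ℝ) → ℝ≥0∞} {f : ℝ → ℝ≥0∞} (hH : Represents T r P X H f) (y : V) (a : ℝ) :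
    ∫⁻ ω, kidsProd T d r H y a (fun z => X z ω) ∂P = pou d f a ^ (kids T r y).card := by
  classical
  set F : V → Ω → ℝ≥0∞ := fun z ω => H z (a / d + X z ω) (fun z => X z ω) with hF
  have mF : ∀ z, Measurable[famAlg X (desc T r z)] (F z) := by
    intro z
    have h1 : Measurable[famAlg X (desc T r z)] (X z) := measurable_famAlg_eval (mem_desc_self r z)
    have h2 : Measurable[famAlg X (desc T r z)]
        (fun ω => (sdesc T r z).indicator fun w => X w ω) :=
      (measurable_famAlg_indicator (sdesc T r z)).mono (famAlg_mono Set.sdiff_subset) le_rfl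
    have h3 : F z = fun ω => H z (a / d + X z ω) ((sdesc T r z).indicator fun w => X w ω) := by
      ext ω
      exact (hH.isLocal z).eq_indicator _ _
    rw [h3]
    exact (hH.isLocal z).meas.comp (Measurable.prodMk (h1.const_add _) h2)
  have key : ∀ s : Finset V, s ⊆ kids T r y →
      ∫⁻ ω, ∏ z ∈ s, F z ω ∂P = pou d f a ^ s.card := by
    intro s
    induction s using Finset.induction_on with
    | empty => simp
    | insert z s hzs ih =>
      intro hs
      have hzk := hs (Finset.mem_insert_self z s)
      have hsk : s ⊆ kids T r y := fun w hw => hs (Finset.mem_insert_of_mem hw)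
      simp_rw [Finset.prod_insert hzs]
      have hz := (mem_kids hT).1 hzk
      have hdisj : Disjoint (desc T r z) (⋃ w ∈ s, desc T r w) := by
        rw [Set.disjoint_iUnion₂_right]
        intro w hw
        have hw' := (mem_kids hT).1 (hsk hw)
        refine disjoint_desc hT.connected hz.1 (by rintro rfl; exact hzs hw) ?_
        rw [(par_spec hT.connected hz.1).2, (par_spec hT.connected hw'.1).2, hz.2, hw'.2]
      rw [lintegral_mul_eq_lintegral_mul_lintegral_of_independent_measurableSpace
        (famAlg_le hX _) (famAlg_le hX _) (indep_famAlg hX hI hdisj) (mF z), ih hsk,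
        hH.lintegral_kid hd hX hI hlaw hz.1, Finset.card_insert_of_notMem hzs, pow_succ']
      refine Finset.measurable_fun_prod _ fun w hw => (mF w).mono (famAlg_mono ?_) le_rfl
      exact Set.subset_biUnion_of_mem (u := fun w => desc T r w) hw
  exact key _ subset_rfl

/-- One generation of the recursion for functionals of subtrees. -/
theorem Represents.step (hd : 2 ≤ d) (hT : T.IsTree) (hk : T.IsRegularOfDegree (d + 1))
    (hX : ∀ y, Measurable (X y))
    (hI : iIndepFun X P) (hlaw : ∀ y, y ≠ r → P.map (X y) = gaussianReal 0 (innovVar d))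
    {H : V → ℝ → (V → ℝ) → ℝ≥0∞} {f α β : ℝ → ℝ≥0∞} (hH : Represents T r P X H f)
    (hα : Measurable α) (hβ : Measurable β) :
    Represents T r P X (fun y a v => α a + β a * kidsProd T d r H y a v)
      (fun a => α a + β a * pou d f a ^ d) where
  isLocal y :=
    { meas := by
        have := (isLocal_kidsProd (d := d) hT hH.isLocal y).meas
        fun_prop
      eq_of := fun a v v' h => by
        rw [(isLocal_kidsProd (d := d) hT hH.isLocal y).eq_of a v v' h] }
  meas := by
    have := hH.meas
    fun_prop
  lintegral_eq y hy a := by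
    have hm : Measurable fun ω => kidsProd T d r H y a (fun z => X z ω) :=
      (isLocal_kidsProd (d := d) hT hH.isLocal y).meas.comp
        (by fun_prop : Measurable fun ω => (a, fun z => X z ω))
    rw [lintegral_add_left measurable_const, lintegral_const_mul _ hm,
      hH.lintegral_kidsProd hd hT hX hI hlaw, card_kids hT hk hy]
    simp

/-- The exponent is `d + 1` instead of `d` because the root has no parent among its neighbours. -/
theorem Represents.lintegral_root (hd : 2 ≤ d) (hT : T.IsTree) (hk : T.IsRegularOfDegree (d + 1))
    (hX : ∀ y, Measurable (X y)) (hI : iIndepFun X P)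
    (hlaw : ∀ y, y ≠ r → P.map (X y) = gaussianReal 0 (innovVar d))
    (hroot : P.map (X r) = statLaw d)
    {H : V → ℝ → (V → ℝ) → ℝ≥0∞} {f : ℝ → ℝ≥0∞} (hH : Represents T r P X H f) :
    ∫⁻ ω, kidsProd T d r H r (X r ω) (fun z => X z ω) ∂P =
      ∫⁻ a, pou d f a ^ (d + 1) ∂(statLaw d) := by
  rw [lintegral_local hX hI (notMem_sdesc_self r r) (isLocal_kidsProd hT hH.isLocal r), hroot]
  refine lintegral_congr fun a => ?_
  rw [hH.lintegral_kidsProd hd hT hX hI hlaw, card_kids_root hk]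

end Functionals

/-! ### Level sets along the generations of a rooted tree -/

section Survival

variable {V : Type*} {T : SimpleGraph V}

/-- A connection to the root must run through all ancestors. Along the walk towards the root, a step
to the parent removes one ancestor to check, and a step to a child only enlarges the ancestral line.
-/
theorem forall_iterate_par_of_reachable (hT : T.IsTree) {f : V → ℝ} {h : ℝ}
    {r w : {x : V | h ≤ f x}} (hw : (levelGraph T f h).Reachable r w) (k : ℕ) :
    h ≤ f ((par T r)^[k] w) := by
  obtain ⟨p⟩ := hw.symm
  revert k
  induction p with
  | @nil u =>
    intro k
    rw [Function.iterate_fixed (par_root _)]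
    exact u.2
  | @cons u v r hadj p ih =>
    have hadj' : T.Adj (u : V) v := hadj
    rcases hT.dist_eq_dist_add_one_of_adj r hadj' with h1 | h1
    · rintro (_ | k)
      · exact u.2
      · rw [Function.iterate_succ_apply, eq_par hT hadj' h1]
        exact ih ⟨p.reverse⟩ k
    · intro k
      rw [← eq_par hT hadj'.symm h1, ← Function.iterate_succ_apply]
      exact ih ⟨p.reverse⟩ (k + 1)

variable [T.LocallyFinite]

/-- The vertex `y` is connected to one of its descendants `n` generations below in the level set
of `f` above `h`. -/
def Surv (T : SimpleGraph V) [T.LocallyFinite] (r : V) (f : V → ℝ) (h : ℝ) : ℕ → V → Prop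
  | 0 => fun y => h ≤ f y
  | n + 1 => fun y => h ≤ f y ∧ ∃ z ∈ kids T r y, Surv T r f h n z

/-- One of the descendants of `y` that are `m` generations below `y` is connected to its own
descendants `n` generations further below. -/
def SurvBelow (T : SimpleGraph V) [T.LocallyFinite] (r : V) (f : V → ℝ) (h : ℝ) (n : ℕ) :
    ℕ → V → Prop
  | 0 => Surv T r f h n
  | m + 1 => fun y => ∃ z ∈ kids T r y, SurvBelow T r f h n m z

variable {r : V} {f : V → ℝ} {h : ℝ}

theorem Surv.le {n : ℕ} {y : V} (hs : Surv T r f h n y) : h ≤ f y := by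
  cases n with
  | zero => exact hs
  | succ n => exact hs.1

theorem Surv.of_succ {n : ℕ} : ∀ {y : V}, Surv T r f h (n + 1) y → Surv T r f h n y := by
  induction n with
  | zero => exact fun hs => hs.1
  | succ n ih => exact fun ⟨hy, z, hz, hs⟩ => ⟨hy, z, hz, ih hs⟩

theorem antitone_surv (y : V) : Antitone fun n => Surv T r f h n y :=
  antitone_nat_of_succ_le fun _ => Surv.of_succ

theorem SurvBelow.of_succ {n m : ℕ} :
    ∀ {y : V}, SurvBelow T r f h (n + 1) m y → SurvBelow T r f h n m y := by
  induction m with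
  | zero => exact Surv.of_succ
  | succ m ih => exact fun ⟨z, hz, hs⟩ => ⟨z, hz, ih hs⟩

theorem dist_of_mem_kids (hT : T.IsTree) {y z : V} (hz : z ∈ kids T r y) :
    T.Adj y z ∧ T.dist r z = T.dist r y + 1 := by
  obtain ⟨hzr, rfl⟩ := (mem_kids hT).1 hz
  have := par_spec hT.connected hzr
  exact ⟨this.1.symm, this.2⟩

theorem SurvBelow.exists_surv (hT : T.IsTree) {n m : ℕ} :
    ∀ {y : V}, SurvBelow T r f h n m y → ∃ w, T.dist r w = T.dist r y + m ∧ Surv T r f h n w := by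
  induction m with
  | zero => exact fun {y} hs => ⟨y, rfl, hs⟩
  | succ m ih =>
    rintro y ⟨z, hz, hs⟩
    obtain ⟨w, hw, hs⟩ := ih hs
    exact ⟨w, by rw [hw, (dist_of_mem_kids hT hz).2]; ring, hs⟩

theorem Surv.exists_reachable (hT : T.IsTree) {n : ℕ} :
    ∀ {y : V} (hs : Surv T r f h n y), ∃ w : {x : V | h ≤ f x}, T.dist r w = T.dist r y + n ∧
      (levelGraph T f h).Reachable ⟨y, hs.le⟩ w := by
  induction n with
  | zero => exact fun {y} hs => ⟨⟨y, hs⟩, rfl, .rfl⟩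
  | succ n ih =>
    rintro y ⟨hy, z, hz, hs⟩
    obtain ⟨w, hw, hr⟩ := ih hs
    obtain ⟨hadj, hdist⟩ := dist_of_mem_kids hT hz
    refine ⟨w, by rw [hw, hdist]; ring, .trans (SimpleGraph.Adj.reachable ?_) hr⟩
    exact hadj

/-- If there is survival to all generations from one of the vertices at a given depth, then the
level set percolates. -/
theorem exists_infinite_of_forall_survBelow (hT : T.IsTree) {m : ℕ}
    (hs : ∀ n, SurvBelow T r f h n m r) :
    ∃ C : (levelGraph T f h).ConnectedComponent, C.supp.Infinite := by
  -- Compactness: if each vertex dies out at some time, the maximum of these times over the finite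
  -- ball of radius `m` contradicts survival from depth `m`.
  obtain ⟨y, hy⟩ : ∃ y, ∀ n, Surv T r f h n y := by
    by_contra! hcon
    choose N hN using hcon
    have hfin := finite_dist_le hT.connected r m
    obtain ⟨w, hw, hsw⟩ := (hs (hfin.toFinset.sup N)).exists_surv hT
    refine hN w (antitone_surv w (Finset.le_sup (f := N) ?_) hsw)
    simp [hw]
  refine ⟨(levelGraph T f h).connectedComponentMk ⟨y, hy 0⟩, fun hfin => ?_⟩
  obtain ⟨M, hM⟩ := (hfin.image fun w : {x : V | h ≤ f x} => T.dist r w).bddAbove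
  obtain ⟨w, hw, hr⟩ := (hy (M + 1)).exists_reachable hT
  have := hM ⟨w, SimpleGraph.ConnectedComponent.eq.2 hr.symm, rfl⟩
  simp only at this
  omega

theorem surv_iterate_par (hT : T.IsTree) {w : V} (hw : ∀ k, h ≤ f ((par T r)^[k] w)) :
    ∀ {j : ℕ}, j ≤ T.dist r w → Surv T r f h j ((par T r)^[j] w)
  | 0, _ => hw 0
  | j + 1, hj => by
    refine ⟨hw _, (par T r)^[j] w, (mem_kids hT).2 ⟨fun h0 => ?_, ?_⟩,
      surv_iterate_par hT hw (by omega)⟩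
    · have := dist_par_iterate hT.connected r w j
      rw [h0, SimpleGraph.dist_self] at this
      omega
    · rw [Function.iterate_succ_apply']

/-- If a vertex has an infinite cluster, then in the tree rooted at this vertex, there is survival
to all generations. -/
theorem surv_of_infinite (hT : T.IsTree) {C : (levelGraph T f h).ConnectedComponent}
    (hC : C.supp.Infinite) {x : {x : V | h ≤ f x}} (hx : x ∈ C.supp) (n : ℕ) :
    Surv T x f h n x := by
  -- Balls are finite by local finiteness, so an infinite cluster leaves each of them.
  obtain ⟨w, hwC, hw⟩ : ∃ w ∈ C.supp, n < T.dist x w := by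
    by_contra! hcon
    exact hC (((finite_dist_le hT.connected (x : V) n).preimage
      Subtype.val_injective.injOn).subset fun w hw => hcon w hw)
  have hr : (levelGraph T f h).Reachable x w :=
    SimpleGraph.ConnectedComponent.eq.1 (hx.trans hwC.symm)
  have hs := surv_iterate_par hT (forall_iterate_par_of_reachable hT hr) le_rfl
  have h0 : (par T x)^[T.dist x w] w = (x : V) := by
    have := dist_par_iterate hT.connected (x : V) w (T.dist x w)
    rw [Nat.sub_self] at this
    exact (hT.connected.dist_eq_zero_iff.1 this).symm
  rw [h0] at hs
  exact antitone_surv _ hw.le hs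

end Survival

/-! ### Survival and the recursion -/

section Indicators

variable {V : Type*} {T : SimpleGraph V} [T.LocallyFinite] {d : ℕ} {r : V} {h : ℝ}

/-- The indicator function of the absence of survival during `n` generations, as a functional of
the value at a vertex and of the innovations below it. -/
def noSurvFun (T : SimpleGraph V) [T.LocallyFinite] (d : ℕ) (r : V) (h : ℝ) :
    ℕ → V → ℝ → (V → ℝ) → ℝ≥0∞
  | 0 => fun _ a _ => (Set.Iio h).indicator 1 a
  | n + 1 => fun y a v => (Set.Iio h).indicator 1 a +
      (Set.Ici h).indicator 1 a * kidsProd T d r (noSurvFun T d r h n) y a v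

/-- The indicator function of the absence of survival during `n` generations from the vertices
`m` generations below, as a functional of the value at a vertex and of the innovations below
it. -/
def noSurvBelowFun (T : SimpleGraph V) [T.LocallyFinite] (d : ℕ) (r : V) (h : ℝ) (n : ℕ) :
    ℕ → V → ℝ → (V → ℝ) → ℝ≥0∞
  | 0 => noSurvFun T d r h n
  | m + 1 => kidsProd T d r (noSurvBelowFun T d r h n m)

open Classical in
/-- The indicator function of the complement of an event. -/
def notInd (p : Prop) : ℝ≥0∞ := if p then 0 else 1

theorem notInd_of {p : Prop} (hp : p) : notInd p = 0 := if_pos hp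

theorem notInd_of_not {p : Prop} (hp : ¬ p) : notInd p = 1 := if_neg hp

/-- A product of indicators of failure is the indicator that all children fail. Evaluated at the
innovations of `f`, the functional sees the true values at the children, which links the recursion
to actual events. -/
theorem kidsProd_eq_notInd (hT : T.IsTree) {H : V → ℝ → (V → ℝ) → ℝ≥0∞} {f : V → ℝ}
    {p : V → Prop} (hp : ∀ z, H z (f z) (innov T d r f) = notInd (p z)) (y : V) :
    kidsProd T d r H y (f y) (innov T d r f) = notInd (∃ z ∈ kids T r y, p z) := by
  have e : kidsProd T d r H y (f y) (innov T d r f) = ∏ z ∈ kids T r y, notInd (p z) := by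
    refine Finset.prod_congr rfl fun z hz => ?_
    obtain ⟨hzr, rfl⟩ := (mem_kids hT).1 hz
    rw [← eq_add_innov hzr, hp]
  rw [e]
  by_cases hex : ∃ z ∈ kids T r y, p z
  · rw [notInd_of hex]
    obtain ⟨z, hz, hpz⟩ := hex
    exact Finset.prod_eq_zero hz (notInd_of hpz)
  · rw [notInd_of_not hex]
    push Not at hex
    exact Finset.prod_eq_one fun z hz => notInd_of_not (hex z hz)

theorem noSurvFun_eq_notInd (hT : T.IsTree) (f : V → ℝ) (n : ℕ) : ∀ y,
    noSurvFun T d r h n y (f y) (innov T d r f) = notInd (Surv T r f h n y) := by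
  induction n with
  | zero =>
    intro y
    by_cases hy : h ≤ f y <;> simp [noSurvFun, notInd, Surv, hy, not_lt.2, lt_of_not_ge]
  | succ n ih =>
    intro y
    have e := kidsProd_eq_notInd hT ih y
    simp only [noSurvFun, e]
    by_cases hy : h ≤ f y
    · simp [Surv, hy]
    · simp [notInd, Surv, hy, lt_of_not_ge]

theorem noSurvBelowFun_eq_notInd (hT : T.IsTree) (f : V → ℝ) (n m : ℕ) : ∀ y,
    noSurvBelowFun T d r h n m y (f y) (innov T d r f) = notInd (SurvBelow T r f h n m y) := by
  induction m with
  | zero => exact noSurvFun_eq_notInd hT f n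
  | succ m ih => exact kidsProd_eq_notInd hT ih

variable {Ω : Type*} [MeasurableSpace Ω] {P : Measure Ω} [IsProbabilityMeasure P] {X : V → Ω → ℝ}

theorem represents_noSurvFun (hd : 2 ≤ d) (hT : T.IsTree) (hk : T.IsRegularOfDegree (d + 1))
    (hX : ∀ y, Measurable (X y)) (hI : iIndepFun X P)
    (hlaw : ∀ y, y ≠ r → P.map (X y) = gaussianReal 0 (innovVar d)) :
    ∀ n, Represents T r P X (noSurvFun T d r h n) (noSurv d h n)
  | 0 =>
    { isLocal := fun _ =>
        ⟨(measurable_one.indicator measurableSet_Iio).comp measurable_fst, fun _ _ _ _ => rfl⟩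
      meas := measurable_noSurv h 0
      lintegral_eq := fun _ _ _ => by simp [noSurvFun, noSurv] }
  | n + 1 => (represents_noSurvFun hd hT hk hX hI hlaw n).step hd hT hk hX hI hlaw
      (measurable_one.indicator measurableSet_Iio) (measurable_one.indicator measurableSet_Ici)

theorem represents_noSurvBelowFun (hd : 2 ≤ d) (hT : T.IsTree)
    (hk : T.IsRegularOfDegree (d + 1)) (hX : ∀ y, Measurable (X y)) (hI : iIndepFun X P)
    (hlaw : ∀ y, y ≠ r → P.map (X y) = gaussianReal 0 (innovVar d)) (n : ℕ) :
    ∀ m, Represents T r P X (noSurvBelowFun T d r h n m) (noSurvBelow d h n m)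
  | 0 => represents_noSurvFun hd hT hk hX hI hlaw n
  | m + 1 => by
    have := (represents_noSurvBelowFun hd hT hk hX hI hlaw n m).step hd hT hk hX hI hlaw
      (α := fun _ => 0) (β := fun _ => 1) measurable_const measurable_const
    simp only [zero_add, one_mul] at this
    exact this

end Indicators

/-! ### Percolation of the level sets -/

section Percolation

variable {V : Type*} {T : SimpleGraph V} [T.LocallyFinite] {d : ℕ} {h : ℝ}
  {Ω : Type*} [MeasurableSpace Ω] {P : Measure Ω} {φ : V → Ω → ℝ}

theorem IsGaussianFreeField.exists_measurable (hT : T.IsTree) (hφ : IsGaussianFreeField T φ P) :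
    ∃ ψ : V → Ω → ℝ, (∀ x, Measurable (ψ x)) ∧ IsGaussianFreeField T ψ P ∧
      ∀ᵐ ω ∂P, (fun x => φ x ω) = fun x => ψ x ω := by
  have : Countable V := countable_of_connected hT.connected
  have hae : ∀ x, AEMeasurable (φ x) P := fun x => (hφ.memLp_two x).1.aemeasurable
  refine ⟨fun x => (hae x).mk, fun x => (hae x).measurable_mk,
    hφ.congr fun x => (hae x).ae_eq_mk, ?_⟩
  filter_upwards [ae_all_iff.2 fun x => (hae x).ae_eq_mk] with ω hω
  exact funext hω

variable [IsProbabilityMeasure P]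

/-- The probability of an event determined by the vertices next to the root. -/
theorem measure_not_eq (hd : 2 ≤ d) (hT : T.IsTree) (hk : T.IsRegularOfDegree (d + 1))
    (hφ : IsGaussianFreeField T φ P) (hm : ∀ x, Measurable (φ x)) (r : V)
    {H : V → ℝ → (V → ℝ) → ℝ≥0∞} {g : ℝ → ℝ≥0∞}
    (hH : Represents T r P (fun y ω => innov T d r (fun x => φ x ω) y) H g)
    {p : Ω → V → Prop}
    (hp : ∀ ω z, H z (φ z ω) (innov T d r fun x => φ x ω) = notInd (p ω z)) :
    MeasurableSet {ω | ¬ ∃ z ∈ kids T r r, p ω z} ∧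
      P {ω | ¬ ∃ z ∈ kids T r r, p ω z} = ∫⁻ a, pou d g a ^ (d + 1) ∂(statLaw d) := by
  classical
  set X : V → Ω → ℝ := fun y ω => innov T d r (fun x => φ x ω) y with hXdef
  have mX : ∀ y, Measurable (X y) := fun y => (hm y).sub ((hm _).const_mul _)
  have hXr : X r = φ r := funext fun ω => innov_root r _
  set K : Ω → ℝ≥0∞ := fun ω => kidsProd T d r H r (X r ω) (fun z => X z ω)
  have hK : ∀ ω, K ω = notInd (∃ z ∈ kids T r r, p ω z) := fun ω => by
    rw [← kidsProd_eq_notInd hT (hp ω) r]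
    simp only [K, hXr]
    rfl
  have mK : Measurable K := (isLocal_kidsProd (d := d) hT hH.isLocal r).meas.comp
    (by fun_prop : Measurable fun ω => (X r ω, fun z => X z ω))
  set A := {ω | ¬ ∃ z ∈ kids T r r, p ω z} with hA
  have hAK : A = K ⁻¹' {1} := by
    ext ω
    simp only [A, Set.mem_ofPred_eq, Set.mem_preimage, Set.mem_singleton_iff, hK ω, notInd]
    split_ifs with hc <;> simp [hc]
  have mA : MeasurableSet A := hAK ▸ mK (measurableSet_singleton 1)
  refine ⟨mA, ?_⟩
  rw [← hH.lintegral_root hd hT hk mX (iIndepFun_innov hd hT hk hφ r)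
    (fun y hy => map_innov hd hT hk hφ hy) (hXr ▸ map_root hd hT hk hφ r),
    ← lintegral_indicator_one mA]
  refine lintegral_congr fun ω => ?_
  change _ = K ω
  rw [hK]
  by_cases hc : ∃ z ∈ kids T r r, p ω z
  · rw [notInd_of hc, Set.indicator_of_notMem (show ω ∉ A from fun hω => hω hc)]
  · rw [notInd_of_not hc, Set.indicator_of_mem hc, Pi.one_apply]

/-- For each root, survival forever has probability at most `d + 1` times the mean survival
probability over `n` generations, which tends to zero. Countability of the vertex set handles all
roots at once. -/
theorem ae_finite_of_lam_lt_one (hd : 2 ≤ d) (hT : T.IsTree) (hk : T.IsRegularOfDegree (d + 1))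
    (hφ : IsGaussianFreeField T φ P) (hm : ∀ x, Measurable (φ x)) (hl : lam d h < 1) :
    ∀ᵐ ω ∂P, ∀ C : (levelGraph T (fun x => φ x ω) h).ConnectedComponent, C.supp.Finite := by
  classical
  have : Countable V := countable_of_connected hT.connected
  have key : ∀ r : V, ∀ᵐ ω ∂P, ¬ ∀ n, Surv T r (fun x => φ x ω) h n r := by
    intro r
    have mX : ∀ y, Measurable fun ω => innov T d r (fun x => φ x ω) y :=
      fun y => (hm y).sub ((hm _).const_mul _)
    have bound : ∀ n, P {ω | ∀ n, Surv T r (fun x => φ x ω) h n r} ≤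
        (d + 1 : ℕ) * ∫⁻ a, (1 - noSurv d h n a) ∂(statLaw d) := by
      intro n
      obtain ⟨mA, hA⟩ := measure_not_eq hd hT hk hφ hm r
        (represents_noSurvFun (h := h) hd hT hk mX (iIndepFun_innov hd hT hk hφ r)
          (fun y hy => map_innov hd hT hk hφ hy) n)
        (p := fun ω z => Surv T r (fun x => φ x ω) h n z)
        (fun ω => noSurvFun_eq_notInd hT (fun x => φ x ω) n)
      have hsub : {ω | ∀ n, Surv T r (fun x => φ x ω) h n r} ⊆
          {ω | ¬ ∃ z ∈ kids T r r, Surv T r (fun x => φ x ω) h n z}ᶜ :=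
        -- Survival of the root for `n + 1` generations provides a child surviving for `n`.
        fun ω hω => not_not.2 (hω (n + 1)).2
      refine (measure_mono hsub).trans ?_
      rw [prob_compl_eq_one_sub mA, hA, tsub_le_iff_right]
      have h1 := lintegral_pou hd (f := fun a => 1 - noSurv d h n a) (by fun_prop)
      rw [← h1, ← lintegral_const_mul _ (measurable_pou (by fun_prop)),
        ← lintegral_add_left ((measurable_pou (by fun_prop)).const_mul _)]
      calc (1 : ℝ≥0∞) = ∫⁻ _, 1 ∂(statLaw d) := by simp
        _ ≤ _ := lintegral_mono fun a => ?_
      rw [pou_one_sub hd (measurable_noSurv h n) (noSurv_le_one hd h n)]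
      exact tsub_le_iff_right.1 (one_sub_pow_le _ (pou_le_one hd (noSurv_le_one hd h n) a))
    have hlim := ENNReal.Tendsto.const_mul (a := ((d + 1 : ℕ) : ℝ≥0∞))
      (tendsto_lintegral_one_sub_noSurv hd hl) (Or.inr (ENNReal.natCast_ne_top _))
    rw [mul_zero] at hlim
    rw [ae_iff]
    simp only [not_not]
    exact le_antisymm (ge_of_tendsto' hlim bound) zero_le
  filter_upwards [ae_all_iff.2 key] with ω hω C
  by_contra hC
  obtain ⟨x, hx⟩ := C.nonempty_supp
  exact hω x (surv_of_infinite hT hC hx)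

/-- Taking the depth large makes the failure probability at most `ε`, uniformly in the number of
further generations. The failure events increase with that number, so their union keeps the bound;
then `ε` is arbitrary, and no ergodicity is needed. -/
theorem ae_exists_infinite_of_one_lt_lam (hd : 2 ≤ d) (hT : T.IsTree)
    (hk : T.IsRegularOfDegree (d + 1)) (hφ : IsGaussianFreeField T φ P)
    (hm : ∀ x, Measurable (φ x)) (hl : 1 < lam d h) :
    ∀ᵐ ω ∂P, ∃ C : (levelGraph T (fun x => φ x ω) h).ConnectedComponent, C.supp.Infinite := by
  classical
  obtain ⟨r⟩ := hT.connected.nonempty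
  have mX : ∀ y, Measurable fun ω => innov T d r (fun x => φ x ω) y :=
    fun y => (hm y).sub ((hm _).const_mul _)
  rw [ae_iff]
  refine le_antisymm (le_of_forall_pos_le_add fun ε hε => ?_) zero_le
  rw [zero_add]
  obtain ⟨m, hmε⟩ := exists_lintegral_noSurvBelow_le hd hl hε
  set B : ℕ → Set Ω := fun n => {ω | ¬ ∃ z ∈ kids T r r, SurvBelow T r (fun x => φ x ω) h n m z}
    with hB
  have hBle : ∀ n, P (B n) ≤ ε := by
    intro n
    obtain ⟨-, hA⟩ := measure_not_eq hd hT hk hφ hm r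
      (represents_noSurvBelowFun (h := h) hd hT hk mX (iIndepFun_innov hd hT hk hφ r)
        (fun y hy => map_innov hd hT hk hφ hy) n m)
      (p := fun ω z => SurvBelow T r (fun x => φ x ω) h n m z)
      (fun ω => noSurvBelowFun_eq_notInd hT (fun x => φ x ω) n m)
    rw [hA]
    refine le_trans (lintegral_mono fun a => ?_)
      ((lintegral_pou hd (measurable_noSurvBelow h n m)).trans_le (hmε n))
    exact pow_le_of_le_one zero_le (pou_le_one hd (noSurvBelow_le_one hd h n m) a)
      (Nat.succ_ne_zero d)
  have hBm : Monotone B := monotone_nat_of_le_succ fun n ω hω hω' => hω <| by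
    obtain ⟨z, hz, hs⟩ := hω'
    exact ⟨z, hz, hs.of_succ⟩
  have hsub : {ω | ¬ ∃ C : (levelGraph T (fun x => φ x ω) h).ConnectedComponent,
      C.supp.Infinite} ⊆ ⋃ n, B n := by
    intro ω hω
    by_contra hcon
    -- The events `B n` look at depth `m` below the children of the root, hence at depth `m + 1`
    -- below the root.
    exact hω (exists_infinite_of_forall_survBelow hT (r := r) (m := m + 1) fun n =>
      by_contra fun hn => hcon (Set.mem_iUnion.2 ⟨n, hn⟩))
  calc _ ≤ P (⋃ n, B n) := measure_mono hsub
    _ = ⨆ n, P (B n) := hBm.measure_iUnion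
    _ ≤ ε := iSup_le hBle

end Percolation

end TreeGFF

end

theorem proposition3p3 (d : ℕ) (hd : 2 ≤ d) :
    (∃! hs : ℝ, TreeGFF.lam d hs = 1) ∧
    ∀ hs : ℝ, TreeGFF.lam d hs = 1 →
      ∀ {V : Type*} (T : SimpleGraph V) [T.LocallyFinite],
        T.IsTree → T.IsRegularOfDegree (d + 1) →
        ∀ {Ω : Type*} [MeasurableSpace Ω] (P : Measure Ω) [IsProbabilityMeasure P]
          (φ : V → Ω → ℝ), TreeGFF.IsGaussianFreeField T φ P →
          (∀ h : ℝ, h < hs → ∀ᵐ ω ∂P,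
            ∃ C : (TreeGFF.levelGraph T (fun x => φ x ω) h).ConnectedComponent,
              C.supp.Infinite) ∧
          (∀ h : ℝ, hs < h → ∀ᵐ ω ∂P,
            ∀ C : (TreeGFF.levelGraph T (fun x => φ x ω) h).ConnectedComponent,
              C.supp.Finite) := by
  refine ⟨TreeGFF.existsUnique_lam_eq_one hd,
    fun hs h1 V T _ hT hk Ω _ P _ φ hφ => ?_⟩
  -- The coordinates are only almost everywhere measurable; on a countable vertex set, all of them
  -- may be replaced by measurable versions outside a single null set.
  obtain ⟨ψ, hm, hψ, hφψ⟩ := hφ.exists_measurable hT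
  refine ⟨fun h hlt => ?_, fun h hlt => ?_⟩
  · filter_upwards [hφψ, TreeGFF.ae_exists_infinite_of_one_lt_lam hd hT hk hψ hm
      (TreeGFF.one_lt_lam hd h1 hlt)] with ω hω hC
    exact (congrArg (fun f : V → ℝ => ∃ C : (TreeGFF.levelGraph T f h).ConnectedComponent,
      C.supp.Infinite) hω).mpr hC
  · filter_upwards [hφψ, TreeGFF.ae_finite_of_lam_lt_one hd hT hk hψ hm
      (TreeGFF.lam_lt_one hd h1 hlt)] with ω hω hC
    exact (congrArg (fun f : V → ℝ => ∀ C : (TreeGFF.levelGraph T f h).ConnectedComponent,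
      C.supp.Finite) hω).mpr hC
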